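/- **Setting.** Let $V$ and $\mathcal C$ be finite sets, let $\sigma\mapsto\sigma(0)$ be an injective map $\mathcal C\to V$, and let $\mathcal A=V\sqcup\{\sigma(k):\sigma\in\mathcal C,\ k\ge 1\}$. Let $L$ be a real symmetric matrix on $\mathcal A\times\mathcal A$ whose only possibly non-zero entries outside $V\times V$ are $L(\sigma(k),\sigma(k))=\mathfrak a_\sigma(k)$ for $k\ge1$ and $L(\sigma(k),\sigma(k+1))=L(\sigma(k+1),\sigma(k))=-\mathfrak b_\sigma(k)$ with $\mathfrak b_\sigma(k)>0$, for $k\ge 0$. Suppose that there are $a_\sigma\in\mathbb R$, $b_\sigma>0$ and $\varepsilon>0$ with $$\sum_{k\ge1}(1+\varepsilon)^k\{|\mathfrak a_\sigma(k)-a_\sigma|+|\mathfrak b_\sigma(k)-b_\sigma|\}<\infty\qquad(\sigma\in\mathcal C),$$ that $\bigcup_{\sigma}(a_\sigma-2b_\sigma,a_\sigma+2b_\sigma)$ is non-empty and connected, and that $\bigcup_\sigma[a_\sigma-2b_\sigma,a_\sigma+2b_\sigma]=[a-2b,a+2b]$. Let $\mathbb D$ be the open unit disk, $\mathbb T$ its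 boundary, and $\lambda(\omega)=a-b(\omega+\omega^{-1})$. For $\omega\in\mathbb D\setminus\{0\}$ let $\theta_\sigma(\omega)\in\mathbb D\setminus\{0\}$ be the solution of $a_\sigma-b_\sigma(\theta_\sigma+\theta_\sigma^{-1})=\lambda(\omega)$. Let $e_\sigma(k,\theta)$, $k\ge 0$, be the Jost solution, that is, the solution of $$-\mathfrak b_\sigma(k-1)x(k-1)+\mathfrak a_\sigma(k)x(k)-\mathfrak b_\sigma(k)x(k+1)=z\,x(k),\qquad k\ge1,$$ with $z=a_\sigma-b_\sigma(\theta+\theta^{-1})$ and $x(k)=\theta^k(1+o(1))$ as $k\to\infty$. Let $p_\sigma(k,\omega)$ be the solution of this equation with $z=\lambda(\omega)$, $p_\sigma(0,\omega)=1$, $p_\sigma(1,\omega)=0$. Let $\mathcal R(\lambda)=(r(\sigma(0),\nu(0);\lambda))_{\sigma,\nu\in\mathcal C}$, where $r(\cdot,\cdot;\lambda)$ are the entries of $(L|_{V\times V}-\lambda I)^{-1}$. Put $B=\mathrm{diag}(b_\sigma)$, $B(0)=\mathrm{diag}(\mathfrak b_\sigma(0))$, $\mathcal E(k,\omega)=\mathrm{diag}(e_\sigma(k,\theta_\sigma(\omega)))$,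 $P(k,\omega)=\mathrm{diag}(p_\sigma(k,\omega))$, $D(\omega)=\mathrm{diag}(\theta_\sigma(\omega)^{-1}-\theta_\sigma(\omega))$, $T(\omega)=\mathcal E(0,\omega)-\mathcal R(\lambda(\omega))B(0)\mathcal E(1,\omega)$ and $$U(k,\omega)=\left[-P(k,\omega)+\mathcal E(k,\omega)T(\omega)^{-1}\right]BB(0)^{-1}D(\omega)\mathcal E(1,\omega)^{-1}.$$ Call $\hat\omega\in\mathbb T\setminus\{\pm1\}$ a *branch point* if $\lambda(\hat\omega)\in\{a_\sigma-2b_\sigma,a_\sigma+2b_\sigma\}$ for some $\sigma$. At a point $\hat\omega$ of $\overline{\mathbb D}$, "holomorphic" and "pole" refer to a function that is holomorphic, respectively meromorphic, in a full neighbourhood $N$ of $\hat\omega$ and coincides with $U(k,\cdot)$ on $(N\cap\mathbb D)\setminus\{\hat\omega\}$. **Lemma.** There is a finite set $\Omega\subset\mathbb T\cup(-1,1)$ with $0\notin\Omega$ such that for every $k\ge0$: 1. $U(k,\cdot)$ is holomorphic at every point of $\overline{\mathbb D}\setminus(\Omega\cup\{0\})$; in particular all its poles in $\overline{\mathbb D}$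 lie in $\Omega\cup\{0\}$. 2. At the origin $U(k,\cdot)$ has a pole of order exactly $k$ (for $k=0$: it is holomorphic there, with a non-zero value). 3. At every $\hat\omega\in\Omega$ which is not a branch point, $U(k,\cdot)$ is holomorphic or has a simple pole, provided that, in case $\hat\omega=\pm1$, the number $\lambda(\pm1)=a\mp2b$ is not an eigenvalue of $L$ in $\ell^2(\mathcal A)$. Without this proviso, $U(k,\cdot)$ has at most a pole of order $2$ at the points of $\Omega\cap\{1,-1\}$. 4. At every branch point $\hat\omega\in\Omega$ the limit of $(\omega-\hat\omega)U(k,\omega)$, as $\omega\to\hat\omega$ in $\mathbb D$, exists. -/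

import Mathlib

open Filter Topology

noncomputable section

/-- A web-like system of particles. The finite set `V` is the central part, `C` is the set of
channels; the particle `σ(0)` is `attach σ ∈ V`, and the particles `σ(1), σ(2), …` of the channels
lie outside `V`. The interaction is real and symmetric; it is given by its restriction `central`
to the central part and, along a channel, by `L(σ(k), σ(k)) = onsite σ k` for `k ≥ 1` (the value at
`k = 0` is not used) and `L(σ(k), σ(k+1)) = - hop σ k` for `k ≥ 0`. -/
structure WebSystem (V C : Type*) where
  central : Matrix V V ℝ
  central_symm : central.IsSymm
  attach : C → V
  attach_injective : Function.Injective attach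
  onsite : C → ℕ → ℝ
  hop : C → ℕ → ℝ
  hop_pos : ∀ σ k, 0 < hop σ k

/-- The map `θ ↦ a - b (θ + θ⁻¹)`. -/
def zhukovskii (a b : ℝ) (θ : ℂ) : ℂ := (a : ℂ) - (b : ℂ) * (θ + θ⁻¹)

/-- For `ω` in the punctured unit disk, `channelParam aσ bσ a b ω` is the point `θ` of the punctured
unit disk with `aσ - bσ (θ + θ⁻¹) = a - b (ω + ω⁻¹)`. -/
def channelParam (aσ bσ a b : ℝ) (ω : ℂ) : ℂ :=
  Function.invFunOn (zhukovskii aσ bσ) (Metric.ball 0 1 \ {0}) (zhukovskii a b ω)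

/-- The equation `- 𝔟(k-1) x(k-1) + 𝔞(k) x(k) - 𝔟(k) x(k+1) = z x(k)` for all `k ≥ 1`. -/
def IsChannelSolution (onsite hop : ℕ → ℝ) (z : ℂ) (x : ℕ → ℂ) : Prop :=
  ∀ k : ℕ, -(hop k : ℂ) * x k + (onsite (k + 1) : ℂ) * x (k + 1) - (hop (k + 1) : ℂ) * x (k + 2)
    = z * x (k + 1)

/-- `x` solves the channel equation at `z = a - b (θ + θ⁻¹)`, and `x k = θ ^ k (1 + o(1))`. -/
def IsJostSolution (onsite hop : ℕ → ℝ) (a b : ℝ) (θ : ℂ) (x : ℕ → ℂ) : Prop :=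
  IsChannelSolution onsite hop (zhukovskii a b θ) x ∧
    Tendsto (fun k : ℕ => x k / θ ^ k) atTop (𝓝 1)

open Classical in
/-- The Jost solution `k ↦ e(k, θ)` (used for `0 < |θ| < 1`, where there is exactly one when the
coefficients converge to `a`, `b > 0` exponentially fast). -/
def jost (onsite hop : ℕ → ℝ) (a b : ℝ) (θ : ℂ) : ℕ → ℂ :=
  if h : ∃ x, IsJostSolution onsite hop a b θ x then h.choose else 0

/-- The solution `k ↦ p(k)` of the channel equation with `p(0) = 1`, `p(1) = 0`. -/
def channelP (onsite hop : ℕ → ℝ) (z : ℂ) : ℕ → ℂ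
  | 0 => 1
  | 1 => 0
  | k + 2 => (((onsite (k + 1) : ℂ) - z) * channelP onsite hop z (k + 1)
      - (hop k : ℂ) * channelP onsite hop z k) / (hop (k + 1) : ℂ)

namespace WebSystem

variable {V C : Type*} [Fintype V] [DecidableEq V] [Fintype C] [DecidableEq C]

/-- The full interaction matrix; the particle `σ(j + 1)` is `Sum.inr (σ, j)`. -/
def interaction (S : WebSystem V C) : V ⊕ (C × ℕ) → V ⊕ (C × ℕ) → ℝ
  | Sum.inl α, Sum.inl β => S.central α β
  | Sum.inl α, Sum.inr (σ, j) => if α = S.attach σ ∧ j = 0 then -S.hop σ 0 else 0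
  | Sum.inr (σ, j), Sum.inl α => if α = S.attach σ ∧ j = 0 then -S.hop σ 0 else 0
  | Sum.inr (σ, i), Sum.inr (ν, j) =>
      if σ = ν then
        if i = j then S.onsite σ (i + 1)
        else if j = i + 1 then -S.hop σ (i + 1)
        else if i = j + 1 then -S.hop σ (j + 1)
        else 0
      else 0

/-- `z` is an eigenvalue of the interaction matrix, acting on square summable functions. -/
def IsEigenvalue (S : WebSystem V C) (z : ℂ) : Prop :=
  ∃ ξ : V ⊕ (C × ℕ) → ℂ, ξ ≠ 0 ∧ Summable (fun α => ‖ξ α‖ ^ 2) ∧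
    ∀ α, ∑ᶠ β, (S.interaction α β : ℂ) * ξ β = z * ξ α

/-- The block with rows and columns `σ(0)`, `σ ∈ C`, of the resolvent of the central part. -/
def resolventBlock (S : WebSystem V C) (z : ℂ) : Matrix C C ℂ :=
  ((S.central.map (fun r : ℝ => (r : ℂ)) - z • (1 : Matrix V V ℂ))⁻¹).submatrix S.attach S.attach

/-- The diagonal matrix `E(k, ω)` of the values `e_σ(k, θ_σ(ω))` of the Jost solutions. -/
def jostMatrix (S : WebSystem V C) (aInf bInf : C → ℝ) (a b : ℝ) (k : ℕ) (ω : ℂ) : Matrix C C ℂ :=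
  Matrix.diagonal fun σ =>
    jost (S.onsite σ) (S.hop σ) (aInf σ) (bInf σ) (channelParam (aInf σ) (bInf σ) a b ω) k

/-- The diagonal matrix `P(k, ω)`. -/
def pMatrix (S : WebSystem V C) (a b : ℝ) (k : ℕ) (ω : ℂ) : Matrix C C ℂ :=
  Matrix.diagonal fun σ => channelP (S.onsite σ) (S.hop σ) (zhukovskii a b ω) k

/-- The diagonal matrix `B(0)`. -/
def hopMatrix (S : WebSystem V C) : Matrix C C ℂ :=
  Matrix.diagonal fun σ => (S.hop σ 0 : ℂ)

/-- `T(ω) = E(0, ω) - R(λ(ω)) B(0) E(1, ω)`. -/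
def tMatrix (S : WebSystem V C) (aInf bInf : C → ℝ) (a b : ℝ) (ω : ℂ) : Matrix C C ℂ :=
  S.jostMatrix aInf bInf a b 0 ω
    - S.resolventBlock (zhukovskii a b ω) * S.hopMatrix * S.jostMatrix aInf bInf a b 1 ω

/-- The diagonal matrix `D(ω)` with entries `θ_σ(ω)⁻¹ - θ_σ(ω)`. -/
def dMatrix (aInf bInf : C → ℝ) (a b : ℝ) (ω : ℂ) : Matrix C C ℂ :=
  Matrix.diagonal fun σ =>
    (channelParam (aInf σ) (bInf σ) a b ω)⁻¹ - channelParam (aInf σ) (bInf σ) a b ω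

/-- `U(k, ω) = [-P(k, ω) + E(k, ω) T(ω)⁻¹] B B(0)⁻¹ D(ω) E(1, ω)⁻¹`, for `ω` in the punctured open
unit disk. -/
def uMatrix (S : WebSystem V C) (aInf bInf : C → ℝ) (a b : ℝ) (k : ℕ) (ω : ℂ) : Matrix C C ℂ :=
  (-S.pMatrix a b k ω + S.jostMatrix aInf bInf a b k ω * (S.tMatrix aInf bInf a b ω)⁻¹)
    * Matrix.diagonal (fun σ => (bInf σ : ℂ)) * S.hopMatrix⁻¹
    * dMatrix aInf bInf a b ω * (S.jostMatrix aInf bInf a b 1 ω)⁻¹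

end WebSystem

/-- A matrix function `F` given on the open unit disk has, at a point `ω₀` of the closed disk, at
most a pole of order `n`: near `ω₀` it coincides in the open disk with `(ω - ω₀)⁻ⁿ G(ω)`, where `G`
is holomorphic in a full neighbourhood of `ω₀`. For `n = 0`, `F` extends holomorphically to a
neighbourhood of `ω₀`. -/
def HasPoleOfOrderAtMost {C : Type*} (F : ℂ → Matrix C C ℂ) (n : ℕ) (ω₀ : ℂ) : Prop :=
  ∃ G : ℂ → Matrix C C ℂ, (∀ i j, AnalyticAt ℂ (fun ω => G ω i j) ω₀) ∧
    ∀ᶠ ω in 𝓝[Metric.ball 0 1 \ {ω₀}] ω₀, F ω = ((ω - ω₀) ^ n)⁻¹ • G ω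

/-- As above, with a pole of order exactly `n` (so for `n = 0`, `F` is holomorphic at `ω₀` after
removing the singularity, and its value there is not `0`). -/
def HasPoleOfOrder {C : Type*} (F : ℂ → Matrix C C ℂ) (n : ℕ) (ω₀ : ℂ) : Prop :=
  ∃ G : ℂ → Matrix C C ℂ, (∀ i j, AnalyticAt ℂ (fun ω => G ω i j) ω₀) ∧ G ω₀ ≠ 0 ∧
    ∀ᶠ ω in 𝓝[Metric.ball 0 1 \ {ω₀}] ω₀, F ω = ((ω - ω₀) ^ n)⁻¹ • G ω

/-- `ω₀` is a point of the unit circle, other than `±1`, which `ω ↦ a - b (ω + ω⁻¹)` maps to an end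
point of one of the intervals `[a_σ - 2 b_σ, a_σ + 2 b_σ]`. At these points, and at no other points
of the closed disk, one of the functions `θ_σ` has a square root branch point. -/
def IsBranchPoint {C : Type*} (aInf bInf : C → ℝ) (a b : ℝ) (ω₀ : ℂ) : Prop :=
  ‖ω₀‖ = 1 ∧ ω₀ ≠ 1 ∧ ω₀ ≠ -1 ∧
    ∃ σ, zhukovskii a b ω₀ = ((aInf σ - 2 * bInf σ : ℝ) : ℂ) ∨
      zhukovskii a b ω₀ = ((aInf σ + 2 * bInf σ : ℝ) : ℂ)

end

/-!
The singularities of `U(k, ·)` are controlled by the self-adjointness of `L`, through one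
observation: a column of `U` is, up to elementary factors and a cut at a finite distance, a column
of the resolvent of `L`. More precisely, if column `σ` of `U(k, ω)`, extended to the central part,
is cut off beyond `σ(j+1)` in channel `σ`, it becomes a solution of `(L - λ(ω)) u = c δ` with a
point source at `σ(j+1)` and `c = b_σ (θ_σ⁻¹ - θ_σ) / e_σ(j+1)` (`isForcedSolution_cutColumn`).
Summing by parts and taking imaginary parts gives `|Im λ| ‖u‖ ≤ |c|`
(`IsForcedSolution.sum_norm_sq_le`). This is used for the explicit decaying solutions only, so that
`L` never has to be treated as an operator. The same identity shows that `e_σ(1)`, the central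
block and `T` are invertible as long as `Im λ ≠ 0`. Hence `U = O(1 / |Im λ|)` near each point of
the closed disk (`IsLocalModel.exists_bound`).

This is a bound on the order of a pole once `U` is known to be meromorphic, and it is so in a
suitable coordinate. By the exponential decay of the perturbation, `θ^{-k} e_σ(k, θ)` is
holomorphic in a disk of radius larger than one (`exists_isJostFunction`). The parameters
`θ_σ(ω)` continue analytically across the unit circle except at branch points, where they are
analytic in the square root `(1 - ω / ω₀)^{1/2}` (`IsDiskChart.exists_channelParam_eq`). Since
`U` is built from these functions by matrix products and inverses, it is meromorphic in the
coordinate `ω`, respectively in the square root.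

A pole at a point `ω₀` is then at most of order `m` as soon as `|Im λ|` is at least a multiple of
`|ζ - ζ₀|^m` along one path ending at `ω₀` (`IsApproachOrder`, `IsLocalModel.exists_chartU_eq`).
One may take `m = 0` at non-real points of the open disk, `m = 1` at real points `≠ 0` of it and
at points of the circle other than `±1`, and `m = 2` at `±1`. At a branch point `m = 2` in the
square root coordinate, that is, `(ω - ω₀) U` has a limit. At `±1` a genuine double pole would have
leading Laurent coefficients that satisfy the equation of `L` at `λ(±1)` and, by the resolvent
bound, lie in `ℓ²`; unless `λ(±1)` is an eigenvalue they vanish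
(`IsLocalModel.exists_chartU_eq_of_not_isEigenvalue`).

The origin, where `λ = ∞`, is treated by expanding `U(0)` and `ω U(1)` explicitly
(`exists_origin_expansion`); the three-term recurrence in `k` gains a factor `ω⁻¹` with a non-zero
coefficient in each step (`hasPoleOfOrder_origin`). By the same recurrence, away from the origin all
`U(k)` are holomorphic wherever `U(0)` and `U(1)` are, so that one exceptional set serves
all `k`. It is finite since it has no accumulation point in the closed disk
(`IsLocalModel.eventually_holomorphic`).
-/

noncomputable section

set_option linter.unusedSectionVars false

/-! ### The Jost solution -/

/-- One backward step of the channel equation, normalised to limits `a = 0`, `b = 1`. If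
`x k = θ ^ k f k`, the state at level `k` is the pair `(f k, w k)` with
`w k = β k * f k - f (k + 1)`. -/
def jostStep (α β β' : ℝ) (θ : ℂ) (v : ℂ × ℂ) : ℂ × ℂ :=
  ((v.1 + (θ ^ 2 * ((1 - (β' : ℂ) ^ 2) * v.1 + β' * v.2) + α * θ * v.1)) / β,
    θ ^ 2 * ((1 - (β' : ℂ) ^ 2) * v.1 + β' * v.2) + α * θ * v.1)

/-- The state at level `k` that is reached by `i` backward steps from the state `(1, 0)` at level
`k + i`. -/
def jostIter (α β : ℕ → ℝ) (θ : ℂ) : ℕ → ℕ → ℂ × ℂ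
  | 0, _ => (1, 0)
  | i + 1, k => jostStep (α (k + 1)) (β k) (β (k + 1)) θ (jostIter α β θ i (k + 1))

lemma jostStep_sub (α β β' : ℝ) (θ : ℂ) (u v : ℂ × ℂ) :
    jostStep α β β' θ u - jostStep α β β' θ v = jostStep α β β' θ (u - v) := by
  ext <;> simp only [jostStep, Prod.fst_sub, Prod.snd_sub] <;> ring

/-- A backward step is almost a contraction for the weighted norms `max ‖v.1‖ (ρ ^ k * ‖v.2‖)`. -/
lemma jostStep_bound {α β β' ρ d D : ℝ} {θ : ℂ} {k : ℕ} (hρ : 1 ≤ ρ) (hθ : ‖θ‖ ^ 2 ≤ ρ)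
    (h1 : |1 - β' ^ 2| ≤ d) (h2 : |β'| ≤ 1 + d) (h3 : |α| ≤ d) (h4 : |β⁻¹| ≤ 1 + d)
    (hD : ρ ^ (k + 1) * d ≤ D) {c : ℝ} {v : ℂ × ℂ} (hv1 : ‖v.1‖ ≤ c)
    (hv2 : ρ ^ (k + 1) * ‖v.2‖ ≤ c) :
    ‖(jostStep α β β' θ v).1‖
        ≤ (1 + (d + (1 + D) * (1 + 3 * D) * (ρ⁻¹) ^ k + 3 * (ρ ^ (k + 1) * d))) * c ∧
      ρ ^ k * ‖(jostStep α β β' θ v).2‖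
        ≤ (1 + (d + (1 + D) * (1 + 3 * D) * (ρ⁻¹) ^ k + 3 * (ρ ^ (k + 1) * d))) * c := by
  have hd : 0 ≤ d := (abs_nonneg _).trans h1
  have hc : 0 ≤ c := (norm_nonneg _).trans hv1
  have hρ0 : 0 < ρ := by linarith
  have hρk : 1 ≤ ρ ^ (k + 1) := one_le_pow₀ hρ
  have hdD : d ≤ D := (le_mul_of_one_le_left hd hρk).trans hD
  have hD0 : 0 ≤ D := hd.trans hdD
  have hθ1 : ‖θ‖ ≤ ρ := by
    by_contra h
    push Not at h
    nlinarith
  set w := θ ^ 2 * ((1 - (β' : ℂ) ^ 2) * v.1 + β' * v.2) + α * θ * v.1 with hw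
  have n1 : ‖(1 - (β' : ℂ) ^ 2)‖ = |1 - β' ^ 2| := by
    rw [← Real.norm_eq_abs, ← Complex.norm_real]; push_cast; rfl
  have hwb : ‖w‖ ≤ ρ * (d * c + (1 + d) * ‖v.2‖) + d * ρ * c := by
    calc ‖w‖ ≤ ‖θ‖ ^ 2 * (|1 - β' ^ 2| * ‖v.1‖ + |β'| * ‖v.2‖) + |α| * ‖θ‖ * ‖v.1‖ := by
          refine (norm_add_le _ _).trans ?_
          rw [norm_mul, norm_pow, norm_mul, norm_mul, Complex.norm_real, Real.norm_eq_abs]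
          gcongr
          refine (norm_add_le _ _).trans ?_
          rw [norm_mul, norm_mul, n1, Complex.norm_real, Real.norm_eq_abs]
      _ ≤ _ := by gcongr
  have hwk : ρ ^ k * ‖w‖ ≤ (1 + 3 * (ρ ^ (k + 1) * d)) * c := by
    have e1 : ρ ^ k * ‖w‖ ≤ ρ ^ k * (ρ * (d * c + (1 + d) * ‖v.2‖) + d * ρ * c) := by gcongr
    have e2 : ρ ^ k * (ρ * (d * c + (1 + d) * ‖v.2‖) + d * ρ * c)
        = 2 * (ρ ^ (k + 1) * d) * c + (1 + d) * (ρ ^ (k + 1) * ‖v.2‖) := by ring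
    have e3 : (1 + d) * (ρ ^ (k + 1) * ‖v.2‖) ≤ (1 + ρ ^ (k + 1) * d) * c := by
      gcongr
      exact le_mul_of_one_le_left hd hρk
    rw [e2] at e1
    linarith
  have hρk0 : 0 < ρ ^ k := pow_pos hρ0 k
  have hτ : (ρ⁻¹) ^ k * ρ ^ k = 1 := by rw [← mul_pow, inv_mul_cancel₀ hρ0.ne', one_pow]
  have hτ0 : 0 < (ρ⁻¹) ^ k := by positivity
  have hw' : ‖w‖ ≤ (ρ⁻¹) ^ k * ((1 + 3 * D) * c) := by
    calc ‖w‖ = (ρ⁻¹) ^ k * (ρ ^ k * ‖w‖) := by rw [← mul_assoc, hτ, one_mul]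
      _ ≤ (ρ⁻¹) ^ k * ((1 + 3 * D) * c) := by
        refine mul_le_mul_of_nonneg_left (hwk.trans ?_) hτ0.le
        gcongr
  constructor
  · calc ‖(jostStep α β β' θ v).1‖ = |β⁻¹| * ‖v.1 + w‖ := by
          simp only [jostStep, ← hw]
          rw [norm_div, Complex.norm_real, Real.norm_eq_abs, abs_inv, div_eq_inv_mul]
      _ ≤ (1 + d) * (c + (ρ⁻¹) ^ k * ((1 + 3 * D) * c)) := by
          gcongr
          exact (norm_add_le _ _).trans (add_le_add hv1 hw')
      _ = (1 + (d + (1 + d) * (1 + 3 * D) * (ρ⁻¹) ^ k)) * c := by ring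
      _ ≤ (1 + (d + (1 + D) * (1 + 3 * D) * (ρ⁻¹) ^ k + 3 * (ρ ^ (k + 1) * d))) * c := by
          refine mul_le_mul_of_nonneg_right ?_ hc
          have : 0 ≤ 3 * (ρ ^ (k + 1) * d) := by positivity
          have : (1 + d) * (1 + 3 * D) * (ρ⁻¹) ^ k ≤ (1 + D) * (1 + 3 * D) * (ρ⁻¹) ^ k := by
            gcongr
          linarith
  · refine hwk.trans ?_
    gcongr
    have : 0 ≤ (1 + D) * (1 + 3 * D) * (ρ⁻¹) ^ k := by positivity
    linarith

/-- The state `(1, 0)` is almost fixed by a backward step. -/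
lemma jostStep_one_zero_bound {α β β' ρ d D : ℝ} {θ : ℂ} {k : ℕ} (hρ : 1 ≤ ρ)
    (hθ : ‖θ‖ ^ 2 ≤ ρ) (h1 : |1 - β' ^ 2| ≤ d) (h3 : |α| ≤ d) (h4 : |β⁻¹| ≤ 1 + d)
    (h5 : |β⁻¹ - 1| ≤ d) (hD : ρ ^ (k + 1) * d ≤ D) :
    ‖(jostStep α β β' θ (1, 0) - (1, 0)).1‖
        ≤ d + (1 + D) * (1 + 3 * D) * (ρ⁻¹) ^ k + 3 * (ρ ^ (k + 1) * d) ∧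
      ρ ^ k * ‖(jostStep α β β' θ (1, 0) - (1, 0)).2‖
        ≤ d + (1 + D) * (1 + 3 * D) * (ρ⁻¹) ^ k + 3 * (ρ ^ (k + 1) * d) := by
  have hd : 0 ≤ d := (abs_nonneg _).trans h1
  have hρ0 : 0 < ρ := by linarith
  have hρk : 1 ≤ ρ ^ (k + 1) := one_le_pow₀ hρ
  have hdD : d ≤ D := (le_mul_of_one_le_left hd hρk).trans hD
  have hD0 : 0 ≤ D := hd.trans hdD
  have hθ1 : ‖θ‖ ≤ ρ := by
    by_contra h
    push Not at h
    nlinarith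
  set w := θ ^ 2 * (1 - (β' : ℂ) ^ 2) + α * θ with hw
  have n1 : ‖(1 - (β' : ℂ) ^ 2)‖ = |1 - β' ^ 2| := by
    rw [← Real.norm_eq_abs, ← Complex.norm_real]; push_cast; rfl
  have hwb : ‖w‖ ≤ ρ * d + d * ρ := by
    refine (norm_add_le _ _).trans ?_
    rw [norm_mul, norm_pow, norm_mul, n1, Complex.norm_real, Real.norm_eq_abs]
    gcongr
  have hwk : ρ ^ k * ‖w‖ ≤ 2 * (ρ ^ (k + 1) * d) := by
    have e1 : ρ ^ k * ‖w‖ ≤ ρ ^ k * (ρ * d + d * ρ) := by gcongr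
    have e2 : ρ ^ k * (ρ * d + d * ρ) = 2 * (ρ ^ (k + 1) * d) := by ring
    linarith
  have hτ : (ρ⁻¹) ^ k * ρ ^ k = 1 := by rw [← mul_pow, inv_mul_cancel₀ hρ0.ne', one_pow]
  have hτ0 : 0 < (ρ⁻¹) ^ k := by positivity
  have hw' : ‖w‖ ≤ (ρ⁻¹) ^ k * (2 * D) := by
    calc ‖w‖ = (ρ⁻¹) ^ k * (ρ ^ k * ‖w‖) := by rw [← mul_assoc, hτ, one_mul]
      _ ≤ (ρ⁻¹) ^ k * (2 * D) := by
        refine mul_le_mul_of_nonneg_left (hwk.trans ?_) hτ0.le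
        gcongr
  have hp : 0 ≤ ρ ^ (k + 1) * d := by positivity
  constructor
  · have e : (jostStep α β β' θ (1, 0) - (1, 0)).1 = (((β⁻¹ - 1 : ℝ)) : ℂ) + ((β⁻¹ : ℝ) : ℂ) * w := by
      simp only [jostStep, Prod.fst_sub, hw]
      push_cast
      ring
    rw [e]
    calc _ ≤ |β⁻¹ - 1| + |β⁻¹| * ‖w‖ := by
          refine (norm_add_le _ _).trans ?_
          rw [norm_mul, Complex.norm_real, Complex.norm_real, Real.norm_eq_abs, Real.norm_eq_abs]
      _ ≤ d + (1 + D) * ((ρ⁻¹) ^ k * (2 * D)) := by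
          gcongr
          linarith
      _ ≤ _ := by
          have : 0 ≤ (1 + D) * (1 + D) * (ρ⁻¹) ^ k := by positivity
          nlinarith
  · have e : (jostStep α β β' θ (1, 0) - (1, 0)).2 = w := by
      simp only [jostStep, Prod.snd_sub, hw]
      ring
    rw [e]
    have : 0 ≤ (1 + D) * (1 + 3 * D) * (ρ⁻¹) ^ k := by positivity
    linarith

/-- Starting the backward recursion one step further out changes its value at `k` by at most a
constant times `η (k + i)`, uniformly in `θ`; this is summable in `i`. The second component is
measured with the weight `ρ ^ k`. -/
lemma jostIter_sub_bound {α β d : ℕ → ℝ} {ρ D : ℝ} (hρ : 1 ≤ ρ)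
    (h1 : ∀ k, |1 - β (k + 1) ^ 2| ≤ d k) (h2 : ∀ k, |β (k + 1)| ≤ 1 + d k)
    (h3 : ∀ k, |α (k + 1)| ≤ d k) (h4 : ∀ k, |(β k)⁻¹| ≤ 1 + d k)
    (h5 : ∀ k, |(β k)⁻¹ - 1| ≤ d k) (hD : ∀ k, ρ ^ (k + 1) * d k ≤ D) (η : ℕ → ℝ)
    (hη : ∀ k, η k = d k + (1 + D) * (1 + 3 * D) * (ρ⁻¹) ^ k + 3 * (ρ ^ (k + 1) * d k))
    (θ : ℂ) (hθ : ‖θ‖ ^ 2 ≤ ρ) (i : ℕ) : ∀ k,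
    ‖(jostIter α β θ (i + 1) k - jostIter α β θ i k).1‖
        ≤ Real.exp (∑ l ∈ Finset.range i, η (k + l)) * η (k + i) ∧
      ρ ^ k * ‖(jostIter α β θ (i + 1) k - jostIter α β θ i k).2‖
        ≤ Real.exp (∑ l ∈ Finset.range i, η (k + l)) * η (k + i) := by
  induction i with
  | zero =>
    intro k
    have := jostStep_one_zero_bound (k := k) hρ hθ (h1 k) (h3 k) (h4 k) (h5 k) (hD k)
    rw [← hη] at this
    simpa [jostIter] using this
  | succ i ih =>
    intro k
    have hstep : jostIter α β θ (i + 1 + 1) k - jostIter α β θ (i + 1) k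
        = jostStep (α (k + 1)) (β k) (β (k + 1)) θ
          (jostIter α β θ (i + 1) (k + 1) - jostIter α β θ i (k + 1)) := by
      rw [← jostStep_sub]; rfl
    obtain ⟨i1, i2⟩ := ih (k + 1)
    have hb := jostStep_bound hρ hθ (h1 k) (h2 k) (h3 k) (h4 k) (hD k) i1 i2
    rw [← hη, ← hstep] at hb
    have key : (1 + η k) * (Real.exp (∑ l ∈ Finset.range i, η (k + 1 + l)) * η (k + 1 + i))
        ≤ Real.exp (∑ l ∈ Finset.range (i + 1), η (k + l)) * η (k + (i + 1)) := by
      have hη0 : 0 ≤ Real.exp (∑ l ∈ Finset.range i, η (k + 1 + l)) * η (k + 1 + i) :=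
        (norm_nonneg _).trans i1
      rw [Finset.sum_range_succ', Real.exp_add, add_zero, mul_comm (Real.exp _) (Real.exp (η k)),
        mul_assoc]
      have e1 : ∀ l, k + (l + 1) = k + 1 + l := fun l => by ring
      rw [e1 i, Finset.sum_congr rfl fun l _ => congrArg η (e1 l)]
      refine mul_le_mul_of_nonneg_right ?_ hη0
      linarith [Real.add_one_le_exp (η k)]
    exact ⟨hb.1.trans key, hb.2.trans key⟩

lemma differentiable_jostIter (α β : ℕ → ℝ) (i : ℕ) : ∀ k,
    Differentiable ℂ (fun θ => (jostIter α β θ i k).1) ∧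
      Differentiable ℂ (fun θ => (jostIter α β θ i k).2) := by
  induction i with
  | zero => intro k; simp [jostIter]
  | succ i ih =>
    intro k
    obtain ⟨i1, i2⟩ := ih (k + 1)
    constructor <;> simp only [jostIter, jostStep] <;> fun_prop

/-- Existence of the Jost solution in a disk of radius larger than one, for coefficients that are
normalised to limits `0` and `1`. -/
lemma exists_normalized_jost {α β d : ℕ → ℝ} {ρ : ℝ} (hρ : 1 < ρ) (hβ : ∀ k, 0 < β k)
    (h1 : ∀ k, |1 - β (k + 1) ^ 2| ≤ d k) (h2 : ∀ k, |β (k + 1)| ≤ 1 + d k)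
    (h3 : ∀ k, |α (k + 1)| ≤ d k) (h4 : ∀ k, |(β k)⁻¹| ≤ 1 + d k)
    (h5 : ∀ k, |(β k)⁻¹ - 1| ≤ d k) (hs : Summable fun k => ρ ^ (k + 1) * d k) :
    ∃ F : ℕ → ℂ → ℂ, (∀ k, DifferentiableOn ℂ (F k) (Metric.ball 0 (√ρ))) ∧
      (∀ θ ∈ Metric.ball (0 : ℂ) (√ρ), Tendsto (fun k => F k θ) atTop (𝓝 1)) ∧
      ∀ θ ∈ Metric.ball (0 : ℂ) (√ρ), ∀ k,
        (β k : ℂ) * F k θ = F (k + 1) θ * (1 + θ ^ 2 + α (k + 1) * θ)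
          - θ ^ 2 * β (k + 1) * F (k + 2) θ := by
  have hρ0 : 0 < ρ := by linarith
  have hd0 : ∀ k, 0 ≤ d k := fun k => (abs_nonneg _).trans (h1 k)
  have hp0 : ∀ k, 0 ≤ ρ ^ (k + 1) * d k := fun k => mul_nonneg (by positivity) (hd0 k)
  set D := ∑' k, ρ ^ (k + 1) * d k with hDdef
  have hD : ∀ k, ρ ^ (k + 1) * d k ≤ D := fun k => hs.le_tsum k (fun j _ => hp0 j)
  have hD0 : 0 ≤ D := (hp0 0).trans (hD 0)
  set η : ℕ → ℝ := fun k =>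
    d k + (1 + D) * (1 + 3 * D) * (ρ⁻¹) ^ k + 3 * (ρ ^ (k + 1) * d k) with hη
  have hη0 : ∀ k, 0 ≤ η k := fun k => by
    have := hp0 k; have := hd0 k
    simp only [hη]; positivity
  have hds : Summable d := hs.of_nonneg_of_le hd0
    (fun k => le_mul_of_one_le_left (hd0 k) (one_le_pow₀ hρ.le))
  have hηs : Summable η := by
    refine (hds.add ((summable_geometric_of_lt_one (by positivity) (inv_lt_one_of_one_lt₀ hρ)).mul_left
      _)).add (hs.mul_left 3)
  set K := Real.exp (∑' k, η k) with hK
  have hball : ∀ θ ∈ Metric.ball (0 : ℂ) (√ρ), ‖θ‖ ^ 2 ≤ ρ := fun θ hθ => by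
    rw [mem_ball_zero_iff] at hθ
    have := Real.sq_sqrt hρ0.le
    nlinarith [norm_nonneg θ]
  have hsum : ∀ k i, Real.exp (∑ l ∈ Finset.range i, η (k + l)) ≤ K := fun k i => by
    refine Real.exp_le_exp.2 ?_
    have e : ∑ l ∈ Finset.range i, η (k + l) = ∑ l ∈ (Finset.range i).map (addLeftEmbedding k), η l := by
      simp [Finset.sum_map]
    rw [e]
    exact hηs.sum_le_tsum _ (fun j _ => hη0 j)
  have hbd : ∀ θ ∈ Metric.ball (0 : ℂ) (√ρ), ∀ i k,
      ‖(jostIter α β θ (i + 1) k - jostIter α β θ i k).1‖ ≤ K * η (k + i) ∧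
      ‖(jostIter α β θ (i + 1) k - jostIter α β θ i k).2‖ ≤ K * η (k + i) := fun θ hθ i k => by
    obtain ⟨b1, b2⟩ := jostIter_sub_bound hρ.le h1 h2 h3 h4 h5 hD η (fun _ => rfl) θ (hball θ hθ) i k
    have hle := mul_le_mul_of_nonneg_right (hsum k i) (hη0 (k + i))
    exact ⟨b1.trans hle,
      ((le_mul_of_one_le_left (norm_nonneg _) (one_le_pow₀ hρ.le)).trans b2).trans hle⟩
  have hshift : ∀ k, Summable fun i => K * η (k + i) := fun k => by
    simpa [add_comm] using ((summable_nat_add_iff k).2 hηs).mul_left K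
  have htel : ∀ (f : ℕ → ℂ), Summable (fun i => f (i + 1) - f i) →
      Tendsto f atTop (𝓝 (f 0 + ∑' i, (f (i + 1) - f i))) := fun f hf => by
    have := (hf.hasSum.tendsto_sum_nat).const_add (f 0)
    simpa only [Finset.sum_range_sub, add_sub_cancel] using this
  set F : ℕ → ℂ → ℂ := fun k θ =>
    1 + ∑' i, (jostIter α β θ (i + 1) k - jostIter α β θ i k).1 with hF
  set W : ℕ → ℂ → ℂ := fun k θ =>
    0 + ∑' i, (jostIter α β θ (i + 1) k - jostIter α β θ i k).2 with hW
  have hFlim : ∀ θ ∈ Metric.ball (0 : ℂ) (√ρ), ∀ k,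
      Tendsto (fun i => (jostIter α β θ i k).1) atTop (𝓝 (F k θ)) := fun θ hθ k =>
    htel (fun i => (jostIter α β θ i k).1)
      (Summable.of_norm_bounded (hshift k) (fun i => (hbd θ hθ i k).1))
  have hWlim : ∀ θ ∈ Metric.ball (0 : ℂ) (√ρ), ∀ k,
      Tendsto (fun i => (jostIter α β θ i k).2) atTop (𝓝 (W k θ)) := fun θ hθ k =>
    htel (fun i => (jostIter α β θ i k).2)
      (Summable.of_norm_bounded (hshift k) (fun i => (hbd θ hθ i k).2))
  have hWstep : ∀ θ ∈ Metric.ball (0 : ℂ) (√ρ), ∀ k,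
      W k θ = θ ^ 2 * ((1 - (β (k + 1) : ℂ) ^ 2) * F (k + 1) θ + β (k + 1) * W (k + 1) θ)
        + α (k + 1) * θ * F (k + 1) θ := fun θ hθ k => by
    refine tendsto_nhds_unique ((tendsto_add_atTop_iff_nat 1).2 (hWlim θ hθ k)) ?_
    have t1 := hFlim θ hθ (k + 1)
    have t2 := hWlim θ hθ (k + 1)
    exact (((t1.const_mul _).add (t2.const_mul _)).const_mul _).add (t1.const_mul _)
  have hFstep : ∀ θ ∈ Metric.ball (0 : ℂ) (√ρ), ∀ k,
      F k θ = (F (k + 1) θ + W k θ) / β k := fun θ hθ k => by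
    refine tendsto_nhds_unique ((tendsto_add_atTop_iff_nat 1).2 (hFlim θ hθ k)) ?_
    have t1 := hFlim θ hθ (k + 1)
    exact (t1.add ((tendsto_add_atTop_iff_nat 1).2 (hWlim θ hθ k))).div_const _
  refine ⟨F, fun k => ?_, fun θ hθ => ?_, fun θ hθ k => ?_⟩
  · refine (differentiableOn_const _).add (Complex.differentiableOn_tsum_of_summable_norm (hshift k)
      (fun i => ?_) Metric.isOpen_ball (fun i θ hθ => (hbd θ hθ i k).1))
    exact (((differentiable_jostIter α β (i + 1) k).1).sub
      ((differentiable_jostIter α β i k).1)).differentiableOn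
  · have hb : ∀ k, ‖F k θ - 1‖ ≤ K * ∑' i, η (i + k) := fun k => by
      have e : F k θ - 1 = ∑' i, (jostIter α β θ (i + 1) k - jostIter α β θ i k).1 := by
        simp [hF]
      rw [e, ← tsum_mul_left]
      refine tsum_of_norm_bounded ?_ (fun i => (hbd θ hθ i k).1)
      have := (hshift k).hasSum
      simpa only [add_comm] using this
    have hz : Tendsto (fun k => K * ∑' i, η (i + k)) atTop (𝓝 0) := by
      simpa using (tendsto_sum_nat_add η).const_mul K
    have := squeeze_zero_norm hb hz
    simpa using this.add_const 1
  · have hβk : (β k : ℂ) ≠ 0 := by exact_mod_cast (hβ k).ne'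
    have hβk1 : (β (k + 1) : ℂ) ≠ 0 := by exact_mod_cast (hβ (k + 1)).ne'
    have e1 : (β k : ℂ) * F k θ = F (k + 1) θ + W k θ := by
      rw [hFstep θ hθ k]; field_simp
    have e2 : (β (k + 1) : ℂ) * F (k + 1) θ = F (k + 2) θ + W (k + 1) θ := by
      rw [hFstep θ hθ (k + 1)]; field_simp
    rw [e1, hWstep θ hθ k]
    linear_combination (θ ^ 2 * (β (k + 1) : ℂ)) * (-e2)

/-- `F` is the normalised Jost function of a channel: `θ ^ k * F k θ` is the Jost solution, and
`F k` is holomorphic in a disk of radius `r > 1`. -/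
structure IsJostFunction (onsite hop : ℕ → ℝ) (a b r : ℝ) (F : ℕ → ℂ → ℂ) : Prop where
  hop_pos : ∀ k, 0 < hop k
  b_pos : 0 < b
  one_lt : 1 < r
  analyticAt : ∀ k θ, ‖θ‖ < r → AnalyticAt ℂ (F k) θ
  tendsto_one : ∀ θ : ℂ, ‖θ‖ < r → Tendsto (fun k => F k θ) atTop (𝓝 1)
  recurrence : ∀ θ : ℂ, ‖θ‖ < r → ∀ k, (hop k : ℂ) * F k θ
    = ((onsite (k + 1) - a) * θ + b * (1 + θ ^ 2)) * F (k + 1) θ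
      - hop (k + 1) * θ ^ 2 * F (k + 2) θ

namespace IsJostFunction

variable {onsite hop : ℕ → ℝ} {a b r : ℝ} {F : ℕ → ℂ → ℂ}

lemma isChannelSolution (h : IsJostFunction onsite hop a b r F) {θ : ℂ} (h0 : θ ≠ 0)
    (hr : ‖θ‖ < r) :
    IsChannelSolution onsite hop (zhukovskii a b θ) (fun k => θ ^ k * F k θ) := by
  intro k
  have hrec := h.recurrence θ hr k
  simp only [zhukovskii]
  have e : (θ : ℂ) ^ (k + 1) * θ⁻¹ = θ ^ k := by rw [pow_succ]; field_simp
  linear_combination (-θ ^ k) * hrec + (b : ℂ) * F (k + 1) θ * e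

lemma isJostSolution (h : IsJostFunction onsite hop a b r F) {θ : ℂ} (h0 : θ ≠ 0)
    (hr : ‖θ‖ < r) : IsJostSolution onsite hop a b θ (fun k => θ ^ k * F k θ) := by
  refine ⟨h.isChannelSolution h0 hr, (h.tendsto_one θ hr).congr fun k => ?_⟩
  field_simp

/-- The Jost function vanishes nowhere at two consecutive sites. -/
lemma exists_ne_zero (h : IsJostFunction onsite hop a b r F) {θ : ℂ} (hr : ‖θ‖ < r) (k : ℕ) :
    F k θ ≠ 0 ∨ F (k + 1) θ ≠ 0 := by
  by_contra hcon
  push Not at hcon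
  obtain ⟨N, hN⟩ := ((h.tendsto_one θ hr).eventually_ne one_ne_zero).exists_forall_of_atTop
  -- at `θ = 0` the recurrence is of first order, otherwise it is solved forward
  have hall : ∀ n, F (k + n) θ = 0 ∧ F (k + n + 1) θ = 0 := by
    intro n
    induction n with
    | zero => exact hcon
    | succ n ih =>
      refine ⟨ih.2, ?_⟩
      have hrec := h.recurrence θ hr (k + n)
      by_cases hθ : θ = 0
      · subst hθ
        have hrec2 := h.recurrence 0 hr (k + n + 1)
        have hb : (b : ℂ) ≠ 0 := by exact_mod_cast h.b_pos.ne'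
        rw [ih.2] at hrec2
        have e : F (k + n + 1 + 1) 0 = 0 := by simpa [hb] using hrec2.symm
        exact e
      · have hh : (hop (k + n + 1) : ℂ) ≠ 0 := by exact_mod_cast (h.hop_pos _).ne'
        rw [ih.1, ih.2] at hrec
        have e : F (k + n + 2) θ = 0 := by simpa [hθ, hh] using hrec
        exact e
  exact hN (k + N) (by omega) (hall N).1

lemma apply_zero_ne_zero (h : IsJostFunction onsite hop a b r F) (k : ℕ) : F k 0 ≠ 0 := by
  intro h0
  have hr : ‖(0 : ℂ)‖ < r := by simpa using zero_lt_one.trans h.one_lt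
  rcases h.exists_ne_zero hr k with h1 | h1
  · exact h1 h0
  · have hrec := h.recurrence 0 hr k
    have hb : (b : ℂ) ≠ 0 := by exact_mod_cast h.b_pos.ne'
    rw [h0] at hrec
    simp [hb] at hrec
    exact h1 hrec

end IsJostFunction

/-- Two Jost solutions at a point of the open disk have Wronskian zero, hence they agree. -/
lemma IsJostSolution.unique {onsite hop : ℕ → ℝ} {a b : ℝ} (hpos : ∀ k, 0 < hop k)
    (hhop : Tendsto hop atTop (𝓝 b)) {θ : ℂ} (h0 : θ ≠ 0) (h1 : ‖θ‖ < 1) {x y : ℕ → ℂ}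
    (hx : IsJostSolution onsite hop a b θ x) (hy : IsJostSolution onsite hop a b θ y) : x = y := by
  obtain ⟨hx, hx1⟩ := hx
  obtain ⟨hy, hy1⟩ := hy
  have hne : ∀ k, (hop k : ℂ) ≠ 0 := fun k => by exact_mod_cast (hpos k).ne'
  have hconst : ∀ k, (hop k : ℂ) * (x k * y (k + 1) - x (k + 1) * y k)
      = hop 0 * (x 0 * y 1 - x 1 * y 0) := by
    intro k
    induction k with
    | zero => rfl
    | succ k ih =>
      rw [← ih]
      linear_combination y (k + 1) * hx k - x (k + 1) * hy k
  have hθ : Tendsto (fun k : ℕ => θ ^ k) atTop (𝓝 0) := tendsto_pow_atTop_nhds_zero_of_norm_lt_one h1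
  have small : ∀ z : ℕ → ℂ, Tendsto (fun k : ℕ => z k / θ ^ k) atTop (𝓝 1) →
      Tendsto z atTop (𝓝 0) := fun z hz => by
    have := hz.mul hθ
    rw [one_mul] at this
    exact this.congr fun k => by field_simp
  have sx := small x hx1
  have sy := small y hy1
  have hhopc : Tendsto (fun k => (hop k : ℂ)) atTop (𝓝 (b : ℂ)) :=
    (Complex.continuous_ofReal.tendsto b).comp hhop
  have hW : hop 0 * (x 0 * y 1 - x 1 * y 0) = (0 : ℂ) := by
    have t : Tendsto (fun k => (hop k : ℂ) * (x k * y (k + 1) - x (k + 1) * y k)) atTop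
        (𝓝 (b * (0 * 0 - 0 * 0))) :=
      hhopc.mul ((sx.mul (sy.comp (tendsto_add_atTop_nat 1))).sub
        ((sx.comp (tendsto_add_atTop_nat 1)).mul sy))
    simp only [mul_zero, sub_zero] at t
    exact tendsto_nhds_unique (tendsto_const_nhds.congr fun k => (hconst k).symm) t
  have hWk : ∀ k, x k * y (k + 1) = x (k + 1) * y k := fun k => by
    have := hconst k
    rw [hW] at this
    exact sub_eq_zero.1 ((mul_eq_zero.1 this).resolve_left (hne k))
  obtain ⟨N, hN⟩ := (((hx1.eventually_ne one_ne_zero).and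
    (hy1.eventually_ne one_ne_zero))).exists_forall_of_atTop
  have hxN : ∀ k, N ≤ k → x k ≠ 0 := fun k hk h => (hN k hk).1 (by simp [h])
  have hyN : ∀ k, N ≤ k → y k ≠ 0 := fun k hk h => (hN k hk).2 (by simp [h])
  have hquot : ∀ n, x (N + n) / y (N + n) = x N / y N := by
    intro n
    induction n with
    | zero => rfl
    | succ n ih =>
      rw [← ih, div_eq_div_iff (hyN _ (by omega)) (hyN _ (by omega))]
      exact (hWk (N + n)).symm
  have hq1 : x N / y N = 1 := by
    have t := hx1.div hy1 one_ne_zero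
    rw [div_one] at t
    have t' : Tendsto (fun n => x (N + n) / y (N + n)) atTop (𝓝 1) := by
      refine (t.comp (tendsto_add_atTop_nat N)).congr fun n => ?_
      have : θ ^ (n + N) ≠ 0 := pow_ne_zero _ h0
      simp only [Function.comp, Pi.div_apply]
      rw [add_comm N n]
      exact div_div_div_cancel_right₀ this _ _
    exact tendsto_nhds_unique (tendsto_const_nhds.congr fun n => (hquot n).symm) t'
  have htail : ∀ k, N ≤ k → x k = y k := fun k hk => by
    obtain ⟨n, rfl⟩ := Nat.exists_eq_add_of_le hk
    have := hquot n
    rw [hq1] at this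
    exact (div_eq_one_iff_eq (hyN _ (by omega))).1 this
  have hdown : ∀ n k, N ≤ k + n → x k = y k := by
    intro n
    induction n with
    | zero => intro k hk; exact htail k hk
    | succ n ih =>
      intro k hk
      have e1 := ih (k + 1) (by omega)
      have e2 := ih (k + 2) (by
        by_cases hn : n = 0
        · subst hn; omega
        · omega)
      have hxk := hx k
      have hyk := hy k
      rw [e1, e2] at hxk
      have : (hop k : ℂ) * x k = hop k * y k := by linear_combination hyk - hxk
      exact mul_left_cancel₀ (hne k) this
  exact funext fun k => hdown N k (by omega)

lemma IsJostFunction.jost_eq {onsite hop : ℕ → ℝ} {a b r : ℝ} {F : ℕ → ℂ → ℂ}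
    (h : IsJostFunction onsite hop a b r F) (hhop : Tendsto hop atTop (𝓝 b)) {θ : ℂ} (h0 : θ ≠ 0)
    (h1 : ‖θ‖ < 1) (k : ℕ) : jost onsite hop a b θ k = θ ^ k * F k θ := by
  have hJ := h.isJostSolution h0 (h1.trans h.one_lt)
  have hex : ∃ x, IsJostSolution onsite hop a b θ x := ⟨_, hJ⟩
  have : jost onsite hop a b θ = fun k => θ ^ k * F k θ := by
    rw [jost, dif_pos hex]
    exact IsJostSolution.unique h.hop_pos hhop h0 h1 hex.choose_spec hJ
  rw [this]

/-- Exponentially fast convergence of the coefficients yields a Jost function. -/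
theorem exists_isJostFunction {onsite hop : ℕ → ℝ} {a b ε : ℝ} (hpos : ∀ k, 0 < hop k)
    (hb : 0 < b) (hε : 0 < ε) (hs : Summable fun k : ℕ =>
      (1 + ε) ^ (k + 1) * (|onsite (k + 1) - a| + |hop (k + 1) - b|)) :
    Tendsto hop atTop (𝓝 b) ∧ ∃ r F, IsJostFunction onsite hop a b r F := by
  have hρ : (1 : ℝ) < 1 + ε := by linarith
  have hρ0 : (0 : ℝ) < 1 + ε := by linarith
  have hs2 : Summable fun k : ℕ => (1 + ε) ^ (k + 1) * |hop (k + 1) - b| :=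
    hs.of_nonneg_of_le (fun k => by positivity) fun k => by
      gcongr
      linarith [abs_nonneg (onsite (k + 1) - a)]
  have hhop : Tendsto hop atTop (𝓝 b) := by
    refine (tendsto_add_atTop_iff_nat 1).1 ?_
    rw [tendsto_iff_norm_sub_tendsto_zero]
    refine squeeze_zero (fun _ => norm_nonneg _) (fun k => ?_) hs2.tendsto_atTop_zero
    exact le_mul_of_one_le_left (abs_nonneg _) (one_le_pow₀ hρ.le)
  refine ⟨hhop, ?_⟩
  obtain ⟨M, hM1, hM, hMinv⟩ : ∃ M : ℝ, 1 ≤ M ∧ (∀ k, hop k / b ≤ M) ∧ ∀ k, (hop k / b)⁻¹ ≤ M := by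
    have t : Tendsto (fun k => hop k / b) atTop (𝓝 1) := by
      simpa [hb.ne'] using hhop.div_const b
    obtain ⟨M1, h1⟩ := t.bddAbove_range
    obtain ⟨M2, h2⟩ := (t.inv₀ one_ne_zero).bddAbove_range
    exact ⟨max 1 (max M1 M2), le_max_left _ _,
      fun k => (h1 ⟨k, rfl⟩).trans ((le_max_left _ _).trans (le_max_right _ _)),
      fun k => (h2 ⟨k, rfl⟩).trans ((le_max_right _ _).trans (le_max_right _ _))⟩
  set d : ℕ → ℝ := fun k =>
    (1 + M) / b * (|onsite (k + 1) - a| + |hop (k + 1) - b| + |hop k - b|) with hd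
  have hK : 0 ≤ (1 + M) / b := by positivity
  have eβ : ∀ k, |1 - hop k / b| = |hop k - b| / b := fun k => by
    rw [show 1 - hop k / b = -((hop k - b) / b) by field_simp; ring, abs_neg, abs_div,
      abs_of_pos hb]
  have dle : ∀ k x, 0 ≤ x → x ≤ |onsite (k + 1) - a| + |hop (k + 1) - b| + |hop k - b| →
      (1 + M) * (x / b) ≤ d k := fun k x _ hx => by
    simp only [hd]
    calc (1 + M) * (x / b) = (1 + M) / b * x := by ring
      _ ≤ _ := by gcongr
  have hβ0 : ∀ k, 0 < hop k / b := fun k => div_pos (hpos k) hb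
  have hx1 : ∀ k, (1 + M) * |1 - hop (k + 1) / b| ≤ d k := fun k => by
    rw [eβ]
    exact dle k _ (abs_nonneg _) (by linarith [abs_nonneg (onsite (k + 1) - a), abs_nonneg (hop k - b)])
  have hx0 : ∀ k, (1 + M) * |1 - hop k / b| ≤ d k := fun k => by
    rw [eβ]
    exact dle k _ (abs_nonneg _)
      (by linarith [abs_nonneg (onsite (k + 1) - a), abs_nonneg (hop (k + 1) - b)])
  have h5 : ∀ k, |(hop k / b)⁻¹ - 1| ≤ d k := fun k => by
    have e : (hop k / b)⁻¹ - 1 = (hop k / b)⁻¹ * (1 - hop k / b) := by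
      have := (hβ0 k).ne'
      rw [mul_sub, mul_one, inv_mul_cancel₀ this]
    rw [e, abs_mul, abs_of_pos (inv_pos.2 (hβ0 k))]
    refine le_trans ?_ (hx0 k)
    gcongr
    linarith [hMinv k]
  have h2 : ∀ k, |hop (k + 1) / b| ≤ 1 + d k := fun k => by
    have := hx1 k
    have h3 : |1 - hop (k + 1) / b| ≤ (1 + M) * |1 - hop (k + 1) / b| :=
      le_mul_of_one_le_left (abs_nonneg _) (by linarith)
    rw [abs_of_pos (hβ0 _)]
    linarith [neg_abs_le (1 - hop (k + 1) / b)]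
  have h4 : ∀ k, |(hop k / b)⁻¹| ≤ 1 + d k := fun k => by
    rw [abs_of_pos (inv_pos.2 (hβ0 k))]
    linarith [h5 k, le_abs_self ((hop k / b)⁻¹ - 1)]
  have h1 : ∀ k, |1 - (hop (k + 1) / b) ^ 2| ≤ d k := fun k => by
    rw [show 1 - (hop (k + 1) / b) ^ 2 = (1 + hop (k + 1) / b) * (1 - hop (k + 1) / b) by ring,
      abs_mul, abs_of_pos (by linarith [hβ0 (k + 1)] : 0 < 1 + hop (k + 1) / b)]
    refine le_trans ?_ (hx1 k)
    gcongr
    exact hM _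
  have h3 : ∀ k, |(fun k => (onsite k - a) / b) (k + 1)| ≤ d k := fun k => by
    simp only
    rw [abs_div, abs_of_pos hb]
    refine le_trans (le_mul_of_one_le_left (by positivity) (by linarith : 1 ≤ 1 + M))
      (dle k _ (abs_nonneg _) (by linarith [abs_nonneg (hop (k + 1) - b), abs_nonneg (hop k - b)]))
  have hsd : Summable fun k => (1 + ε) ^ (k + 1) * d k := by
    have hs0 : Summable fun k : ℕ => (1 + ε) ^ k * |hop k - b| := (summable_nat_add_iff 1).1 hs2
    refine ((hs.add (hs0.mul_left (1 + ε))).mul_left ((1 + M) / b)).congr fun k => ?_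
    simp only [hd]
    ring
  obtain ⟨F, hF1, hF2, hF3⟩ := exists_normalized_jost
    (α := fun k => (onsite k - a) / b) (β := fun k => hop k / b) hρ hβ0 h1 h2 h3 h4 h5 hsd
  have hr1 : 1 < √(1 + ε) := by rw [Real.lt_sqrt zero_le_one]; linarith
  refine ⟨√(1 + ε), F, hpos, hb, hr1, fun k θ hθ => ?_, fun θ hθ => hF2 θ (by simpa using hθ),
    fun θ hθ k => ?_⟩
  · exact (hF1 k).analyticAt (Metric.isOpen_ball.mem_nhds (by simpa using hθ))
  · have e := hF3 θ (by simpa using hθ) k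
    have hbc : (b : ℂ) ≠ 0 := by exact_mod_cast hb.ne'
    push_cast at e
    field_simp at e
    linear_combination e

/-! ### The flux identity and the resolvent of the interaction at non-real points -/

namespace WebSystem

variable {V C : Type*} [Fintype V] [DecidableEq V] [Fintype C] [DecidableEq C]

/-- The function with values `y` on the central part and `x ν k` at the particles `ν(k)`, `k ≥ 0`,
satisfies `(L - z) (y, x) = c δ`, where `δ` is the unit mass at the particle `σ(j + 1)`. -/
structure IsForcedSolution (S : WebSystem V C) (z : ℂ) (y : V → ℂ) (x : C → ℕ → ℂ) (σ : C) (j : ℕ)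
    (c : ℂ) : Prop where
  attach_eq : ∀ ν, x ν 0 = y (S.attach ν)
  central_eq : ∀ α, ∑ β, (S.central α β : ℂ) * y β
    - ∑ ν, (if S.attach ν = α then (S.hop ν 0 : ℂ) * x ν 1 else 0) = z * y α
  channel_eq : ∀ ν k, -(S.hop ν k : ℂ) * x ν k + (S.onsite ν (k + 1) : ℂ) * x ν (k + 1)
    - (S.hop ν (k + 1) : ℂ) * x ν (k + 2) = z * x ν (k + 1) + if ν = σ ∧ k = j then c else 0

/-- The flux of a channel function through the bond between the sites `k` and `k + 1`. -/
def flux (hop : ℕ → ℝ) (x : ℕ → ℂ) (k : ℕ) : ℝ :=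
  hop k * ((x k).re * (x (k + 1)).im - (x k).im * (x (k + 1)).re)

/-- The imaginary part of `conj u * v`. -/
def imProd (u v : ℂ) : ℝ := u.re * v.im - u.im * v.re

lemma abs_imProd_le (u v : ℂ) : |imProd u v| ≤ ‖u‖ * ‖v‖ := by
  have : imProd u v = ((starRingEnd ℂ) u * v).im := by simp [imProd]; ring
  rw [this]
  refine (Complex.abs_im_le_norm _).trans ?_
  rw [norm_mul, RCLike.norm_conj]

lemma flux_eq (hop : ℕ → ℝ) (x : ℕ → ℂ) (k : ℕ) : flux hop x k = hop k * imProd (x k) (x (k + 1)) :=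
  rfl

lemma norm_sq_eq_re_im (u : ℂ) : ‖u‖ ^ 2 = u.re * u.re + u.im * u.im := by
  rw [← Complex.normSq_eq_norm_sq, Complex.normSq_apply]

/-- The loss of flux at a site. -/
lemma flux_sub_flux {onsite hop : ℕ → ℝ} {z : ℂ} {x : ℕ → ℂ} {k : ℕ} {q : ℂ}
    (h : -(hop k : ℂ) * x k + (onsite (k + 1) : ℂ) * x (k + 1) - (hop (k + 1) : ℂ) * x (k + 2)
      = z * x (k + 1) + q) :
    flux hop x k - flux hop x (k + 1) = z.im * ‖x (k + 1)‖ ^ 2 + imProd (x (k + 1)) q := by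
  have hr := congrArg Complex.re h
  have hi := congrArg Complex.im h
  simp at hr hi
  rw [norm_sq_eq_re_im]
  simp only [flux, imProd]
  linear_combination (x (k + 1)).re * hi - (x (k + 1)).im * hr

lemma flux_zero_sub_flux {onsite hop : ℕ → ℝ} {z : ℂ} {x : ℕ → ℂ} {q : ℕ → ℂ}
    (h : ∀ k, -(hop k : ℂ) * x k + (onsite (k + 1) : ℂ) * x (k + 1)
      - (hop (k + 1) : ℂ) * x (k + 2) = z * x (k + 1) + q k) (N : ℕ) :
    flux hop x 0 - flux hop x N = z.im * ∑ k ∈ Finset.range N, ‖x (k + 1)‖ ^ 2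
      + ∑ k ∈ Finset.range N, imProd (x (k + 1)) (q k) := by
  rw [← Finset.sum_range_sub', Finset.mul_sum, ← Finset.sum_add_distrib]
  exact Finset.sum_congr rfl fun k _ => flux_sub_flux (h k)

lemma tendsto_flux {hop : ℕ → ℝ} {b : ℝ} (hhop : Tendsto hop atTop (𝓝 b)) {x : ℕ → ℂ}
    (hx : Tendsto x atTop (𝓝 0)) : Tendsto (flux hop x) atTop (𝓝 0) := by
  have t : Tendsto (fun k => |hop k| * (‖x k‖ * ‖x (k + 1)‖)) atTop (𝓝 (|b| * (0 * 0))) := by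
    have hn : Tendsto (fun k => ‖x k‖) atTop (𝓝 0) := by simpa using hx.norm
    exact hhop.abs.mul (hn.mul (hn.comp (tendsto_add_atTop_nat 1)))
  simp only [mul_zero] at t
  refine squeeze_zero_norm (fun k => ?_) t
  rw [flux_eq, Real.norm_eq_abs, abs_mul]
  exact mul_le_mul_of_nonneg_left (abs_imProd_le _ _) (abs_nonneg _)

/-- The quadratic form of a real symmetric matrix is real. -/
lemma sum_imProd_symm (S : WebSystem V C) (y : V → ℂ) :
    ∑ α, imProd (y α) (∑ β, (S.central α β : ℂ) * y β) = 0 := by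
  have e : ∀ α, imProd (y α) (∑ β, (S.central α β : ℂ) * y β)
      = ∑ β, S.central α β * imProd (y α) (y β) := fun α => by
    simp only [imProd, Complex.re_sum, Complex.im_sum, Complex.re_ofReal_mul, Complex.im_ofReal_mul]
    rw [Finset.mul_sum, Finset.mul_sum, ← Finset.sum_sub_distrib]
    exact Finset.sum_congr rfl fun β _ => by ring
  simp only [e]
  have h : ∑ α, ∑ β, S.central α β * imProd (y α) (y β)
      = -∑ α, ∑ β, S.central α β * imProd (y α) (y β) := by
    conv_lhs => rw [Finset.sum_comm]
    rw [← Finset.sum_neg_distrib]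
    refine Finset.sum_congr rfl fun α _ => ?_
    rw [← Finset.sum_neg_distrib]
    refine Finset.sum_congr rfl fun β _ => ?_
    rw [S.central_symm.apply α β]
    simp only [imProd]
    ring
  linarith

lemma sum_imProd_eq (S : WebSystem V C) {z : ℂ} {y w : V → ℂ}
    (h : ∀ α, ∑ β, (S.central α β : ℂ) * y β - w α = z * y α) :
    z.im * ∑ α, ‖y α‖ ^ 2 = -∑ α, imProd (y α) (w α) := by
  have h0 := S.sum_imProd_symm y
  have e : ∀ α, imProd (y α) (∑ β, (S.central α β : ℂ) * y β)
      = imProd (y α) (w α) + z.im * ‖y α‖ ^ 2 := fun α => by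
    rw [sub_eq_iff_eq_add.1 (h α), norm_sq_eq_re_im]
    simp only [imProd, Complex.add_re, Complex.add_im, Complex.mul_re, Complex.mul_im]
    ring
  simp only [e, Finset.sum_add_distrib, ← Finset.mul_sum] at h0
  linarith

/-- The bound `‖(L - z)⁻¹‖ ≤ |Im z|⁻¹`, for a forced solution that decays in the channels. -/
lemma IsForcedSolution.sum_norm_sq_le {S : WebSystem V C} {z : ℂ} {y : V → ℂ} {x : C → ℕ → ℂ}
    {σ : C} {j : ℕ} {c : ℂ} (h : S.IsForcedSolution z y x σ j c) (hz : z.im ≠ 0) {bInf : C → ℝ}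
    (hhop : ∀ ν, Tendsto (S.hop ν) atTop (𝓝 (bInf ν))) (hx : ∀ ν, Tendsto (x ν) atTop (𝓝 0))
    (N : ℕ) :
    ∑ α, ‖y α‖ ^ 2 + ∑ ν, ∑ k ∈ Finset.range N, ‖x ν (k + 1)‖ ^ 2 ≤ (‖c‖ / |z.im|) ^ 2 := by
  set Q : ℕ → ℝ := fun N => ∑ α, ‖y α‖ ^ 2 + ∑ ν, ∑ k ∈ Finset.range N, ‖x ν (k + 1)‖ ^ 2 with hQ
  have hQmono : Monotone Q := fun M N hMN => by
    simp only [hQ]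
    gcongr
  have hcentral : z.im * ∑ α, ‖y α‖ ^ 2 = -∑ ν, flux (S.hop ν) (x ν) 0 := by
    rw [S.sum_imProd_eq h.central_eq]
    congr 1
    have e : ∀ α, imProd (y α) (∑ ν, if S.attach ν = α then (S.hop ν 0 : ℂ) * x ν 1 else 0)
        = ∑ ν, if S.attach ν = α then flux (S.hop ν) (x ν) 0 else 0 := fun α => by
      simp only [imProd, Complex.re_sum, Complex.im_sum, Finset.mul_sum, ← Finset.sum_sub_distrib]
      refine Finset.sum_congr rfl fun ν _ => ?_
      split_ifs with hν
      · rw [flux, h.attach_eq, hν]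
        simp only [Complex.re_ofReal_mul, Complex.im_ofReal_mul]
        ring
      · simp
    simp only [e]
    rw [Finset.sum_comm]
    simp
  have hident : ∀ N, j < N → z.im * Q N
      = -imProd (x σ (j + 1)) c - ∑ ν, flux (S.hop ν) (x ν) N := fun N hN => by
    have h1 : ∑ ν, (flux (S.hop ν) (x ν) 0 - flux (S.hop ν) (x ν) N)
        = ∑ ν, (z.im * ∑ k ∈ Finset.range N, ‖x ν (k + 1)‖ ^ 2
          + ∑ k ∈ Finset.range N, imProd (x ν (k + 1)) (if ν = σ ∧ k = j then c else 0)) :=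
      Finset.sum_congr rfl fun ν _ => flux_zero_sub_flux (h.channel_eq ν) N
    have h2 : ∑ ν, ∑ k ∈ Finset.range N, imProd (x ν (k + 1)) (if ν = σ ∧ k = j then c else 0)
        = imProd (x σ (j + 1)) c := by
      rw [Finset.sum_eq_single σ, Finset.sum_eq_single j]
      · simp
      · intro k _ hk; simp [hk, imProd]
      · intro hj; exact absurd (Finset.mem_range.2 hN) hj
      · intro ν _ hν; simp [hν, imProd]
      · simp
    rw [Finset.sum_sub_distrib, Finset.sum_add_distrib, h2, ← Finset.mul_sum] at h1
    simp only [hQ, mul_add]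
    linarith
  have hlim : ∀ M, |z.im| * Q M ≤ ‖c‖ * ‖x σ (j + 1)‖ := fun M => by
    have hfl : Tendsto (fun N => ‖c‖ * ‖x σ (j + 1)‖ + |∑ ν, flux (S.hop ν) (x ν) N|) atTop
        (𝓝 (‖c‖ * ‖x σ (j + 1)‖ + |∑ _ν : C, (0 : ℝ)|)) :=
      (tendsto_finsetSum _ fun ν _ => tendsto_flux (hhop ν) (hx ν)).abs.const_add _
    simp only [Finset.sum_const_zero, abs_zero, add_zero] at hfl
    refine ge_of_tendsto hfl ?_
    filter_upwards [eventually_ge_atTop (max M (j + 1))] with N hN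
    have hQ0 : 0 ≤ Q N := by simp only [hQ]; positivity
    calc |z.im| * Q M ≤ |z.im| * Q N := by
          gcongr
          exact hQmono ((le_max_left _ _).trans hN)
      _ = |z.im * Q N| := by rw [abs_mul, abs_of_nonneg hQ0]
      _ ≤ ‖c‖ * ‖x σ (j + 1)‖ + |∑ ν, flux (S.hop ν) (x ν) N| := by
          rw [hident N (by have := (le_max_right M (j + 1)).trans hN; omega)]
          refine (abs_sub _ _).trans ?_
          rw [abs_neg, mul_comm]
          gcongr
          exact abs_imProd_le _ _
  have hzpos : 0 < |z.im| := abs_pos.2 hz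
  have hxle : ∀ M, j < M → ‖x σ (j + 1)‖ ^ 2 ≤ Q M := fun M hM => by
    have h1 : ‖x σ (j + 1)‖ ^ 2 ≤ ∑ k ∈ Finset.range M, ‖x σ (k + 1)‖ ^ 2 :=
      Finset.single_le_sum (f := fun k => ‖x σ (k + 1)‖ ^ 2) (fun _ _ => by positivity)
        (Finset.mem_range.2 hM)
    have h2 : ∑ k ∈ Finset.range M, ‖x σ (k + 1)‖ ^ 2
        ≤ ∑ ν, ∑ k ∈ Finset.range M, ‖x ν (k + 1)‖ ^ 2 :=
      Finset.single_le_sum (f := fun ν => ∑ k ∈ Finset.range M, ‖x ν (k + 1)‖ ^ 2)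
        (fun _ _ => by positivity) (Finset.mem_univ σ)
    have h3 : 0 ≤ ∑ α, ‖y α‖ ^ 2 := by positivity
    simp only [hQ]
    linarith
  have hmain : ∀ M, j < M → Q M ≤ (‖c‖ / |z.im|) ^ 2 := fun M hM => by
    have h1 := hlim M
    have h2 := hxle M hM
    have hQ0 : 0 ≤ Q M := (sq_nonneg _).trans h2
    have h3 : Q M ≤ ‖c‖ / |z.im| * √(Q M) := by
      rw [div_mul_eq_mul_div, le_div_iff₀ hzpos, mul_comm (Q M)]
      refine h1.trans ?_
      gcongr
      exact Real.le_sqrt_of_sq_le h2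
    have h4 := Real.sq_sqrt hQ0
    have h5 := Real.sqrt_nonneg (Q M)
    have h6 : √(Q M) ≤ ‖c‖ / |z.im| := by
      by_contra hc
      push Not at hc
      have : 0 ≤ ‖c‖ / |z.im| := by positivity
      nlinarith
    rw [← h4]
    gcongr
  exact (hQmono (le_max_left N (j + 1))).trans
    (hmain _ (lt_of_lt_of_le (Nat.lt_succ_self j) (le_max_right N (j + 1))))

/-- The central part has no non-real eigenvalues. -/
lemma isUnit_det_central_sub (S : WebSystem V C) {z : ℂ} (hz : z.im ≠ 0) :
    IsUnit (S.central.map (fun r : ℝ => (r : ℂ)) - z • (1 : Matrix V V ℂ)).det := by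
  rw [isUnit_iff_ne_zero]
  intro hdet
  obtain ⟨y, hy0, hy⟩ := Matrix.exists_mulVec_eq_zero_iff.2 hdet
  have h : ∀ α, ∑ β, (S.central α β : ℂ) * y β - 0 = z * y α := fun α => by
    have := congrFun hy α
    rw [Matrix.sub_mulVec, Matrix.smul_mulVec, Matrix.one_mulVec] at this
    simp only [Pi.sub_apply, Pi.smul_apply, smul_eq_mul, Pi.zero_apply, Matrix.mulVec, dotProduct,
      Matrix.map_apply] at this
    linear_combination this
  have e := S.sum_imProd_eq h
  simp only [imProd, Complex.zero_im, Complex.zero_re, mul_zero, sub_zero, Finset.sum_const_zero,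
    neg_zero, mul_eq_zero, hz, false_or] at e
  apply hy0
  ext α
  have := (Finset.sum_eq_zero_iff_of_nonneg (fun α _ => sq_nonneg ‖y α‖)).1 e α (Finset.mem_univ _)
  simpa using this

/-- A decaying solution of the channel equation at a non-real point does not vanish at the first
site. -/
lemma channelSolution_one_ne_zero {onsite hop : ℕ → ℝ} {b : ℝ}
    (hhop : Tendsto hop atTop (𝓝 b)) {z : ℂ} (hz : z.im ≠ 0) {x : ℕ → ℂ}
    (h : IsChannelSolution onsite hop z x) (hx : Tendsto x atTop (𝓝 0))
    (hne : ∃ k, x (k + 1) ≠ 0) : x 1 ≠ 0 := by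
  intro h1
  obtain ⟨m, hm⟩ := hne
  have hsum : ∀ N, |z.im| * ∑ k ∈ Finset.range N, ‖x (k + 1)‖ ^ 2 = |flux hop x N| := fun N => by
    have h0 := flux_zero_sub_flux (q := fun _ => 0) (fun k => by simpa using h k) N
    have e0 : flux hop x 0 = 0 := by simp [flux, h1]
    have e1 : ∑ k ∈ Finset.range N, imProd (x (k + 1)) 0 = 0 := by simp [imProd]
    rw [e0, e1] at h0
    have hn : 0 ≤ ∑ k ∈ Finset.range N, ‖x (k + 1)‖ ^ 2 := by positivity
    rw [← abs_of_nonneg hn, ← abs_mul, show z.im * _ = -flux hop x N by linarith, abs_neg]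
  have hle : |z.im| * ‖x (m + 1)‖ ^ 2 ≤ 0 := by
    have t := (tendsto_flux hhop hx).abs
    rw [abs_zero] at t
    refine ge_of_tendsto t ?_
    filter_upwards [eventually_gt_atTop m] with N hN
    rw [← hsum N]
    gcongr
    exact Finset.single_le_sum (f := fun k => ‖x (k + 1)‖ ^ 2) (fun _ _ => by positivity)
        (Finset.mem_range.2 hN)
  have : 0 < |z.im| * ‖x (m + 1)‖ ^ 2 := by
    have := abs_pos.2 hz
    have := norm_pos_iff.2 hm
    positivity
  linarith

end WebSystem

/-! ### The scattering matrix as a column of the resolvent -/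

namespace WebSystem

variable {V C : Type*} [Fintype V] [DecidableEq V] [Fintype C] [DecidableEq C]

/-- The matrix `T` as a function of the spectral parameter `z` and of channel solutions `e`. -/
def connectionMatrix (S : WebSystem V C) (z : ℂ) (e : C → ℕ → ℂ) : Matrix C C ℂ :=
  Matrix.diagonal (fun σ => e σ 0)
    - S.resolventBlock z * S.hopMatrix * Matrix.diagonal (fun σ => e σ 1)

/-- The matrix `U(k)` as a function of the spectral parameter `z`, of channel solutions `e` and of
the channel parameters `θ`. -/
def scatterU (S : WebSystem V C) (bInf : C → ℝ) (z : ℂ) (e : C → ℕ → ℂ) (θ : C → ℂ) (k : ℕ) :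
    Matrix C C ℂ :=
  (-Matrix.diagonal (fun σ => channelP (S.onsite σ) (S.hop σ) z k)
      + Matrix.diagonal (fun σ => e σ k) * (S.connectionMatrix z e)⁻¹)
    * Matrix.diagonal (fun σ => (bInf σ : ℂ)) * S.hopMatrix⁻¹
    * Matrix.diagonal (fun σ => (θ σ)⁻¹ - θ σ) * (Matrix.diagonal (fun σ => e σ 1))⁻¹

/-- The function `y` on the central part with `(L|_{V × V} - z) y = ∑ ν, 𝔟_ν(0) t ν δ_{ν(0)}`. -/
def centralExt (S : WebSystem V C) (z : ℂ) (t : C → ℂ) : V → ℂ := fun α =>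
  ∑ ν, ((S.central.map (fun r : ℝ => (r : ℂ)) - z • (1 : Matrix V V ℂ))⁻¹) α (S.attach ν)
    * ((S.hop ν 0 : ℂ) * t ν)

lemma centralExt_central_eq (S : WebSystem V C) {z : ℂ}
    (hz : IsUnit (S.central.map (fun r : ℝ => (r : ℂ)) - z • (1 : Matrix V V ℂ)).det)
    (t : C → ℂ) (α : V) :
    ∑ β, (S.central α β : ℂ) * S.centralExt z t β
      - ∑ ν, (if S.attach ν = α then (S.hop ν 0 : ℂ) * t ν else 0) = z * S.centralExt z t α := by
  set M := S.central.map (fun r : ℝ => (r : ℂ)) - z • (1 : Matrix V V ℂ) with hM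
  set w : V → ℂ := fun α => ∑ ν, (if S.attach ν = α then (S.hop ν 0 : ℂ) * t ν else 0) with hw
  have hy : S.centralExt z t = M⁻¹.mulVec w := by
    ext α
    simp only [centralExt, ← hM, Matrix.mulVec, dotProduct, hw, Finset.mul_sum]
    rw [Finset.sum_comm]
    simp
  have h1 : M.mulVec (S.centralExt z t) = w := by
    rw [hy, Matrix.mulVec_mulVec, Matrix.mul_nonsing_inv _ hz, Matrix.one_mulVec]
  have h2 := congrFun h1 α
  rw [hM, Matrix.sub_mulVec, Matrix.smul_mulVec, Matrix.one_mulVec] at h2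
  simp only [Pi.sub_apply, Pi.smul_apply, smul_eq_mul, Matrix.mulVec, dotProduct,
      Matrix.map_apply] at h2
  linear_combination h2

lemma centralExt_attach (S : WebSystem V C) (z : ℂ) (t : C → ℂ) (μ : C) :
    S.centralExt z t (S.attach μ) = ((S.resolventBlock z * S.hopMatrix).mulVec t) μ := by
  simp only [centralExt, resolventBlock, hopMatrix, Matrix.mulVec, dotProduct,
    Matrix.mul_diagonal, Matrix.submatrix_apply, mul_assoc]

/-- A matching condition at the particles `ν(0)`. -/
lemma connectionMatrix_mulVec (S : WebSystem V C) (z : ℂ) (e : C → ℕ → ℂ) (c : C → ℂ) (μ : C) :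
    ((S.connectionMatrix z e).mulVec c) μ
      = c μ * e μ 0 - S.centralExt z (fun ν => c ν * e ν 1) (S.attach μ) := by
  have hd : (Matrix.diagonal (fun σ => e σ 1)).mulVec c = fun ν => c ν * e ν 1 := by
    ext ν; rw [Matrix.mulVec_diagonal]; ring
  rw [connectionMatrix, Matrix.sub_mulVec, Pi.sub_apply, Matrix.mulVec_diagonal,
    ← Matrix.mulVec_mulVec, hd, centralExt_attach]
  ring

/-- Otherwise `z` would be a non-real eigenvalue of the interaction. -/
lemma isUnit_det_connectionMatrix (S : WebSystem V C) {z : ℂ} (hz : z.im ≠ 0) {bInf : C → ℝ}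
    (hhop : ∀ ν, Tendsto (S.hop ν) atTop (𝓝 (bInf ν))) {e : C → ℕ → ℂ}
    (he : ∀ ν, IsChannelSolution (S.onsite ν) (S.hop ν) z (e ν))
    (hdec : ∀ ν, Tendsto (e ν) atTop (𝓝 0)) (hne : ∀ ν, ∃ k, e ν (k + 1) ≠ 0) :
    IsUnit (S.connectionMatrix z e).det := by
  rw [isUnit_iff_ne_zero]
  intro hdet
  obtain ⟨c, hc0, hc⟩ := Matrix.exists_mulVec_eq_zero_iff.2 hdet
  obtain ⟨μ, hμ⟩ := Function.ne_iff.1 hc0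
  have hsol : S.IsForcedSolution z (S.centralExt z (fun ν => c ν * e ν 1))
      (fun ν k => c ν * e ν k) μ 0 0 := by
    refine ⟨fun ν => ?_, fun α => S.centralExt_central_eq (S.isUnit_det_central_sub hz) _ α,
      fun ν k => ?_⟩
    · have := congrFun hc ν
      rw [connectionMatrix_mulVec] at this
      exact sub_eq_zero.1 this
    · simp only [ite_self]
      linear_combination c ν * he ν k
  obtain ⟨k, hk⟩ := hne μ
  have hb := hsol.sum_norm_sq_le hz hhop
    (fun ν => by simpa using (hdec ν).const_mul (c ν)) (k + 1)
  have h1 : ‖c μ * e μ (k + 1)‖ ^ 2 ≤ ∑ l ∈ Finset.range (k + 1), ‖c μ * e μ (l + 1)‖ ^ 2 :=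
    Finset.single_le_sum (f := fun l => ‖c μ * e μ (l + 1)‖ ^ 2) (fun _ _ => by positivity)
      (Finset.mem_range.2 (Nat.lt_succ_self k))
  have h2 : ∑ l ∈ Finset.range (k + 1), ‖c μ * e μ (l + 1)‖ ^ 2
      ≤ ∑ ν, ∑ l ∈ Finset.range (k + 1), ‖c ν * e ν (l + 1)‖ ^ 2 :=
    Finset.single_le_sum (f := fun ν => ∑ l ∈ Finset.range (k + 1), ‖c ν * e ν (l + 1)‖ ^ 2)
      (fun _ _ => by positivity) (Finset.mem_univ μ)
  have h3 : 0 ≤ ∑ α, ‖S.centralExt z (fun ν => c ν * e ν 1) α‖ ^ 2 := by positivity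
  have h4 : 0 < ‖c μ * e μ (k + 1)‖ ^ 2 := by
    have := norm_pos_iff.2 (mul_ne_zero hμ hk)
    positivity
  simp only [norm_zero, zero_div, ne_eq, OfNat.ofNat_ne_zero, not_false_eq_true, zero_pow] at hb
  linarith

lemma inv_diagonal_of_ne_zero {v : C → ℂ} (hv : ∀ σ, v σ ≠ 0) :
    (Matrix.diagonal v)⁻¹ = Matrix.diagonal fun σ => (v σ)⁻¹ := by
  refine Matrix.inv_eq_right_inv ?_
  rw [Matrix.diagonal_mul_diagonal, ← Matrix.diagonal_one]
  exact congrArg _ (funext fun σ => mul_inv_cancel₀ (hv σ))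

/-- The entries of `U(k)`. The hypothesis `h1` is needed already for the diagonal matrix `e(1)`: if
one of its entries vanishes, its matrix inverse is zero in all entries. -/
lemma scatterU_apply (S : WebSystem V C) (bInf : C → ℝ) (z : ℂ) {e : C → ℕ → ℂ} (θ : C → ℂ)
    (h1 : ∀ ν, e ν 1 ≠ 0) (k : ℕ) (ν σ : C) :
    S.scatterU bInf z e θ k ν σ
      = (-(if ν = σ then channelP (S.onsite σ) (S.hop σ) z k else 0)
          + (S.connectionMatrix z e)⁻¹ ν σ * e ν k)
        * (bInf σ * (S.hop σ 0 : ℂ)⁻¹ * ((θ σ)⁻¹ - θ σ) * (e σ 1)⁻¹) := by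
  have hh : ∀ σ, (S.hop σ 0 : ℂ) ≠ 0 := fun σ => by exact_mod_cast (S.hop_pos σ 0).ne'
  rw [scatterU, hopMatrix, inv_diagonal_of_ne_zero h1, inv_diagonal_of_ne_zero hh]
  simp only [Matrix.mul_diagonal, Matrix.add_apply, Matrix.neg_apply, Matrix.diagonal_mul,
    Matrix.diagonal_apply]
  have : (if ν = σ then channelP (S.onsite ν) (S.hop ν) z k else 0)
      = if ν = σ then channelP (S.onsite σ) (S.hop σ) z k else 0 := by
    split_ifs with h
    · rw [h]
    · rfl
  rw [this]
  ring

lemma isChannelSolution_channelP {onsite hop : ℕ → ℝ} (hpos : ∀ k, 0 < hop k) (z : ℂ) :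
    IsChannelSolution onsite hop z (channelP onsite hop z) := by
  intro k
  have hne : (hop (k + 1) : ℂ) ≠ 0 := by exact_mod_cast (hpos (k + 1)).ne'
  simp only [channelP]
  field_simp
  ring

/-- The columns of `U` satisfy the channel equation. -/
lemma isChannelSolution_scatterU (S : WebSystem V C) (bInf : C → ℝ) {z : ℂ} {e : C → ℕ → ℂ}
    (θ : C → ℂ) (he : ∀ ν, IsChannelSolution (S.onsite ν) (S.hop ν) z (e ν)) (ν σ : C) :
    IsChannelSolution (S.onsite ν) (S.hop ν) z (fun k => S.scatterU bInf z e θ k ν σ) := by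
  intro k
  simp only [scatterU, Matrix.mul_assoc]
  -- the last four factors do not depend on `k`
  generalize Matrix.diagonal (fun σ => (bInf σ : ℂ)) * (S.hopMatrix⁻¹
    * (Matrix.diagonal (fun σ => (θ σ)⁻¹ - θ σ) * (Matrix.diagonal (fun σ => e σ 1))⁻¹)) = W
  simp only [Matrix.mul_apply (N := W), Finset.mul_sum, ← Finset.sum_add_distrib,
    ← Finset.sum_sub_distrib]
  refine Finset.sum_congr rfl fun μ _ => ?_
  simp only [Matrix.add_apply, Matrix.neg_apply, Matrix.diagonal_mul, Matrix.diagonal_apply]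
  have hp := isChannelSolution_channelP (onsite := S.onsite ν) (S.hop_pos ν) z k
  split_ifs
  · linear_combination ((S.connectionMatrix z e)⁻¹ ν μ * he ν k - hp) * W μ σ
  · linear_combination ((S.connectionMatrix z e)⁻¹ ν μ * he ν k) * W μ σ

/-- The columns of `U` extend to the central part. -/
lemma scatterU_zero (S : WebSystem V C) (bInf : C → ℝ) {z : ℂ} {e : C → ℕ → ℂ} (θ : C → ℂ)
    (h1 : ∀ ν, e ν 1 ≠ 0) (hT : IsUnit (S.connectionMatrix z e).det) (ν σ : C) :
    S.scatterU bInf z e θ 0 ν σ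
      = S.centralExt z (fun μ => S.scatterU bInf z e θ 1 μ σ) (S.attach ν) := by
  set s := bInf σ * (S.hop σ 0 : ℂ)⁻¹ * ((θ σ)⁻¹ - θ σ) * (e σ 1)⁻¹ with hs
  have hcol : (S.connectionMatrix z e).mulVec (fun μ => (S.connectionMatrix z e)⁻¹ μ σ) ν
      = if ν = σ then 1 else 0 := by
    have := congrFun (congrFun (Matrix.mul_nonsing_inv _ hT) ν) σ
    rw [Matrix.one_apply] at this
    exact this
  rw [connectionMatrix_mulVec] at hcol
  have hext : S.centralExt z (fun μ => S.scatterU bInf z e θ 1 μ σ) (S.attach ν)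
      = S.centralExt z (fun μ => (S.connectionMatrix z e)⁻¹ μ σ * e μ 1) (S.attach ν) * s := by
    simp only [centralExt, Finset.sum_mul]
    refine Finset.sum_congr rfl fun μ _ => ?_
    rw [scatterU_apply S bInf z θ h1]
    simp only [channelP, ite_self, ← hs]
    ring
  rw [hext, scatterU_apply S bInf z θ h1, ← hs]
  simp only [channelP]
  linear_combination s * hcol

/-- The column `σ` of `U`, continued beyond the particle `σ(j + 1)` as a multiple of the decaying
solution `e σ`. Up to a factor it is a column of the resolvent of the interaction. -/
def cutColumn (S : WebSystem V C) (bInf : C → ℝ) (z : ℂ) (e : C → ℕ → ℂ) (θ : C → ℂ) (σ : C)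
    (j : ℕ) (ν : C) (k : ℕ) : ℂ :=
  if ν = σ ∧ j + 1 < k then
    S.scatterU bInf z e θ (j + 1) σ σ * (e σ (j + 1))⁻¹ * e σ k
  else S.scatterU bInf z e θ k ν σ

/-- The Wronskian of a column of `U` with the decaying solution. -/
lemma wronskian_scatterU (S : WebSystem V C) (bInf : C → ℝ) {z : ℂ} {e : C → ℕ → ℂ} (θ : C → ℂ)
    (he : ∀ ν, IsChannelSolution (S.onsite ν) (S.hop ν) z (e ν)) (h1 : ∀ ν, e ν 1 ≠ 0) (σ : C)
    (k : ℕ) :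
    (S.hop σ k : ℂ) * (S.scatterU bInf z e θ k σ σ * e σ (k + 1)
      - S.scatterU bInf z e θ (k + 1) σ σ * e σ k) = -(bInf σ * ((θ σ)⁻¹ - θ σ)) := by
  induction k with
  | zero =>
    rw [scatterU_apply S bInf z θ h1, scatterU_apply S bInf z θ h1]
    have hh : (S.hop σ 0 : ℂ) ≠ 0 := by exact_mod_cast (S.hop_pos σ 0).ne'
    have h1σ := h1 σ
    simp only [if_true, channelP, zero_add]
    field_simp
    ring
  | succ k ih =>
    rw [← ih]
    have hu := S.isChannelSolution_scatterU bInf θ he σ σ k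
    simp only at hu
    linear_combination e σ (k + 1) * hu - S.scatterU bInf z e θ (k + 1) σ σ * he σ k

lemma isForcedSolution_cutColumn (S : WebSystem V C) (bInf : C → ℝ) {z : ℂ} {e : C → ℕ → ℂ}
    (θ : C → ℂ) (he : ∀ ν, IsChannelSolution (S.onsite ν) (S.hop ν) z (e ν))
    (h1 : ∀ ν, e ν 1 ≠ 0) (hT : IsUnit (S.connectionMatrix z e).det)
    (hz : IsUnit (S.central.map (fun r : ℝ => (r : ℂ)) - z • (1 : Matrix V V ℂ)).det)
    (σ : C) (j : ℕ) (hj : e σ (j + 1) ≠ 0) :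
    S.IsForcedSolution z (S.centralExt z fun ν => S.cutColumn bInf z e θ σ j ν 1)
      (S.cutColumn bInf z e θ σ j) σ j (bInf σ * ((θ σ)⁻¹ - θ σ) * (e σ (j + 1))⁻¹) := by
  have hc1 : ∀ ν, S.cutColumn bInf z e θ σ j ν 1 = S.scatterU bInf z e θ 1 ν σ := fun ν => by
    simp [cutColumn]
  refine ⟨fun ν => ?_, fun α => S.centralExt_central_eq hz _ α, fun ν k => ?_⟩
  · simp only [hc1]
    rw [← S.scatterU_zero bInf θ h1 hT]
    simp [cutColumn]
  · by_cases hν : ν = σ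
    · subst hν
      have hu := S.isChannelSolution_scatterU bInf θ he ν ν k
      simp only at hu
      simp only [cutColumn, true_and]
      rcases lt_trichotomy k j with hk | hk | hk
      · rw [if_neg (by omega), if_neg (by omega), if_neg (by omega), if_neg (by omega)]
        linear_combination hu
      · subst hk
        rw [if_neg (by omega), if_neg (by omega), if_pos (by omega), if_pos rfl]
        have hW := S.wronskian_scatterU bInf θ he h1 ν (k + 1)
        have hinv : (e ν (k + 1))⁻¹ * e ν (k + 1) = 1 := inv_mul_cancel₀ hj
        linear_combination hu - (e ν (k + 1))⁻¹ * hW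
          - (S.hop ν (k + 1) : ℂ) * S.scatterU bInf z e θ (k + 2) ν ν * hinv
      · rw [if_pos (show j + 1 < k + 1 by omega), if_pos (show j + 1 < k + 2 by omega),
          if_neg (show ¬ k = j by omega), add_zero]
        have hinv : (e ν (j + 1))⁻¹ * e ν (j + 1) = 1 := inv_mul_cancel₀ hj
        set κ := S.scatterU bInf z e θ (j + 1) ν ν * (e ν (j + 1))⁻¹ with hκ
        have hk0 : (if j + 1 < k then κ * e ν k else S.scatterU bInf z e θ k ν ν) = κ * e ν k := by
          split_ifs with h
          · rfl
          · have : k = j + 1 := by omega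
            rw [this, hκ, mul_assoc, hinv, mul_one]
        rw [hk0]
        linear_combination κ * he ν k
    · have hu := S.isChannelSolution_scatterU bInf θ he ν σ k
      simp only at hu
      simp only [cutColumn, hν, false_and, if_false]
      linear_combination hu

lemma tendsto_cutColumn (S : WebSystem V C) (bInf : C → ℝ) {z : ℂ} {e : C → ℕ → ℂ}
    (θ : C → ℂ) (h1 : ∀ ν, e ν 1 ≠ 0) (hdec : ∀ ν, Tendsto (e ν) atTop (𝓝 0)) (σ : C) (j : ℕ)
    (ν : C) : Tendsto (S.cutColumn bInf z e θ σ j ν) atTop (𝓝 0) := by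
  by_cases hν : ν = σ
  · subst hν
    have t := (hdec ν).const_mul (S.scatterU bInf z e θ (j + 1) ν ν * (e ν (j + 1))⁻¹)
    rw [mul_zero] at t
    refine t.congr' ?_
    filter_upwards [eventually_gt_atTop (j + 1)] with k hk
    simp [cutColumn, hk]
  · have t := ((hdec ν).const_mul ((S.connectionMatrix z e)⁻¹ ν σ)).mul_const
      (bInf σ * (S.hop σ 0 : ℂ)⁻¹ * ((θ σ)⁻¹ - θ σ) * (e σ 1)⁻¹)
    rw [mul_zero, zero_mul] at t
    refine t.congr fun k => ?_
    simp only [cutColumn, hν, false_and, if_false, scatterU_apply S bInf z θ h1]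
    ring

end WebSystem

/-! ### The channel parameters -/

lemma zhukovskii_im (a b : ℝ) (θ : ℂ) :
    (zhukovskii a b θ).im = b * θ.im * ((Complex.normSq θ)⁻¹ - 1) := by
  simp only [zhukovskii, Complex.sub_im, Complex.ofReal_im, Complex.im_ofReal_mul, Complex.add_im,
    Complex.inv_im]
  ring

lemma zhukovskii_im_ne_zero {a b : ℝ} (hb : 0 < b) {θ : ℂ} (h1 : ‖θ‖ < 1) (him : θ.im ≠ 0) :
    (zhukovskii a b θ).im ≠ 0 := by
  have h0 : θ ≠ 0 := fun h => him (by simp [h])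
  have hn : 0 < Complex.normSq θ := Complex.normSq_pos.2 h0
  have hn1 : Complex.normSq θ < 1 := by
    rw [Complex.normSq_eq_norm_sq]
    have := norm_nonneg θ
    nlinarith
  rw [zhukovskii_im]
  have : 1 < (Complex.normSq θ)⁻¹ := (one_lt_inv₀ hn).2 hn1
  exact mul_ne_zero (mul_ne_zero hb.ne' him) (by linarith)

lemma zhukovskii_of_norm_eq_one (a b : ℝ) {θ : ℂ} (h : ‖θ‖ = 1) :
    zhukovskii a b θ = ((a - 2 * b * θ.re : ℝ) : ℂ) := by
  have hn : Complex.normSq θ = 1 := by rw [Complex.normSq_eq_norm_sq, h, one_pow]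
  apply Complex.ext
  · simp [zhukovskii, Complex.inv_re, hn]
    ring
  · simp [zhukovskii, Complex.inv_im, hn]

/-- Only the unit circle is mapped to the interval `[a - 2b, a + 2b]`. -/
lemma norm_eq_one_of_zhukovskii_mem {a b : ℝ} (hb : 0 < b) {θ : ℂ} (h0 : θ ≠ 0) {t : ℝ}
    (ht : t ∈ Set.Icc (a - 2 * b) (a + 2 * b)) (h : zhukovskii a b θ = t) : ‖θ‖ = 1 := by
  have hn : 0 < Complex.normSq θ := Complex.normSq_pos.2 h0
  suffices hs : Complex.normSq θ = 1 by
    rw [Complex.normSq_eq_norm_sq] at hs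
    nlinarith [norm_nonneg θ]
  have him := congrArg Complex.im h
  rw [zhukovskii_im, Complex.ofReal_im] at him
  rcases mul_eq_zero.1 him with h1 | h1
  · have hi : θ.im = 0 := (mul_eq_zero.1 h1).resolve_left hb.ne'
    have hre := congrArg Complex.re h
    simp only [zhukovskii, Complex.sub_re, Complex.ofReal_re, Complex.re_ofReal_mul, Complex.add_re,
      Complex.inv_re] at hre
    rw [Complex.normSq_apply, hi, mul_zero, add_zero] at hre ⊢
    have hr : θ.re ≠ 0 := fun hr => h0 (Complex.ext hr hi)
    have e : θ.re / (θ.re * θ.re) = θ.re⁻¹ := by field_simp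
    rw [e] at hre
    set r := θ.re
    have h2 : r * r⁻¹ = 1 := mul_inv_cancel₀ hr
    have hA : -2 ≤ r + r⁻¹ := by by_contra hc; push Not at hc; nlinarith [ht.1, ht.2]
    have hB : r + r⁻¹ ≤ 2 := by by_contra hc; push Not at hc; nlinarith [ht.1, ht.2]
    rcases lt_or_gt_of_ne hr with hneg | hpos
    · have : (r + 1) ^ 2 ≤ 0 := by nlinarith
      have : r + 1 = 0 := by nlinarith [sq_nonneg (r + 1)]
      nlinarith
    · have : (r - 1) ^ 2 ≤ 0 := by nlinarith
      have : r - 1 = 0 := by nlinarith [sq_nonneg (r - 1)]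
      nlinarith
  · have : (Complex.normSq θ)⁻¹ = 1 := by linarith
    exact inv_eq_one.1 this

lemma zhukovskii_eq_iff {a b : ℝ} (hb : 0 < b) {θ₁ θ₂ : ℂ} (h1 : θ₁ ≠ 0) (h2 : θ₂ ≠ 0) :
    zhukovskii a b θ₁ = zhukovskii a b θ₂ ↔ θ₁ = θ₂ ∨ θ₁ * θ₂ = 1 := by
  have hbc : (b : ℂ) ≠ 0 := by exact_mod_cast hb.ne'
  have e : zhukovskii a b θ₁ - zhukovskii a b θ₂
      = -b * (θ₁ * θ₂)⁻¹ * ((θ₁ - θ₂) * (θ₁ * θ₂ - 1)) := by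
    simp only [zhukovskii]
    field_simp
    ring
  rw [← sub_eq_zero, e]
  simp [hbc, h1, h2, sub_eq_zero]

lemma zhukovskii_inv (a b : ℝ) (θ : ℂ) : zhukovskii a b θ⁻¹ = zhukovskii a b θ := by
  simp [zhukovskii, add_comm]

lemma exists_zhukovskii_eq {a b : ℝ} (hb : 0 < b) (z : ℂ)
    (hz : ∀ t ∈ Set.Icc (a - 2 * b) (a + 2 * b), z ≠ (t : ℝ)) :
    ∃ θ ∈ Metric.ball (0 : ℂ) 1 \ {0}, zhukovskii a b θ = z := by
  have hbc : (b : ℂ) ≠ 0 := by exact_mod_cast hb.ne'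
  set c : ℂ := (a - z) / (2 * b) with hc
  obtain ⟨r, hr⟩ := IsAlgClosed.exists_pow_nat_eq (c ^ 2 - 1) (n := 2) two_pos
  have hprod : (c + r) * (c - r) = 1 := by linear_combination -hr
  have h0 : c + r ≠ 0 := left_ne_zero_of_mul_eq_one hprod
  have hinv : (c + r)⁻¹ = c - r := inv_eq_of_mul_eq_one_right hprod
  have hzh : zhukovskii a b (c + r) = z := by
    rw [zhukovskii, hinv, hc]
    field_simp
    ring
  rcases lt_trichotomy ‖c + r‖ 1 with h | h | h
  · exact ⟨c + r, ⟨by simpa using h, h0⟩, hzh⟩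
  · exfalso
    rw [zhukovskii_of_norm_eq_one a b h] at hzh
    have habs := Complex.abs_re_le_norm (c + r)
    rw [h, abs_le] at habs
    refine hz _ ⟨?_, ?_⟩ hzh.symm <;> nlinarith
  · refine ⟨(c + r)⁻¹, ⟨?_, inv_ne_zero h0⟩, by rw [zhukovskii_inv, hzh]⟩
    rw [mem_ball_zero_iff, norm_inv]
    exact inv_lt_one_of_one_lt₀ h

section channelParam

variable {aσ bσ a b : ℝ}

lemma zhukovskii_ne_of_mem_ball (hb : 0 < b)
    (hsub : Set.Icc (aσ - 2 * bσ) (aσ + 2 * bσ) ⊆ Set.Icc (a - 2 * b) (a + 2 * b)) {ω : ℂ}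
    (h0 : ω ≠ 0) (h1 : ‖ω‖ < 1) (t : ℝ) (ht : t ∈ Set.Icc (aσ - 2 * bσ) (aσ + 2 * bσ)) :
    zhukovskii a b ω ≠ t := fun h =>
  h1.ne (norm_eq_one_of_zhukovskii_mem hb h0 (hsub ht) h)

lemma channelParam_spec (hbσ : 0 < bσ) (hb : 0 < b)
    (hsub : Set.Icc (aσ - 2 * bσ) (aσ + 2 * bσ) ⊆ Set.Icc (a - 2 * b) (a + 2 * b)) {ω : ℂ}
    (h0 : ω ≠ 0) (h1 : ‖ω‖ < 1) :
    channelParam aσ bσ a b ω ≠ 0 ∧ ‖channelParam aσ bσ a b ω‖ < 1 ∧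
      zhukovskii aσ bσ (channelParam aσ bσ a b ω) = zhukovskii a b ω := by
  have hex := exists_zhukovskii_eq hbσ _ (zhukovskii_ne_of_mem_ball hb hsub h0 h1)
  have hm := Function.invFunOn_mem hex
  refine ⟨hm.2, mem_ball_zero_iff.1 hm.1, Function.invFunOn_eq hex⟩

lemma channelParam_eq (hbσ : 0 < bσ) {θ ω : ℂ} (h0 : θ ≠ 0) (h1 : ‖θ‖ < 1)
    (h : zhukovskii aσ bσ θ = zhukovskii a b ω) : channelParam aσ bσ a b ω = θ := by
  have hex : ∃ θ ∈ Metric.ball (0 : ℂ) 1 \ {0}, zhukovskii aσ bσ θ = zhukovskii a b ω :=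
    ⟨θ, ⟨by simpa using h1, h0⟩, h⟩
  have hm := Function.invFunOn_mem hex
  have he := Function.invFunOn_eq hex
  have hm1 : ‖channelParam aσ bσ a b ω‖ < 1 := by simpa [channelParam] using hm.1
  rcases (zhukovskii_eq_iff hbσ hm.2 h0).1 (he.trans h.symm) with h2 | h2
  · exact h2
  · exfalso
    have := congrArg norm h2
    rw [norm_mul, norm_one] at this
    have h3 : ‖channelParam aσ bσ a b ω‖ * ‖θ‖ < 1 :=
      mul_lt_one_of_nonneg_of_lt_one_left (norm_nonneg _) hm1 h1.le
    exact h3.ne this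

/-- A parameter on the unit circle would put `λ(ω)` into the band of the channel, hence into
`[a - 2b, a + 2b]`, which `λ` does not reach inside the disk. -/
lemma norm_ne_one_of_zhukovskii_eq (hbσ : 0 < bσ) (hb : 0 < b)
    (hsub : Set.Icc (aσ - 2 * bσ) (aσ + 2 * bσ) ⊆ Set.Icc (a - 2 * b) (a + 2 * b)) {θ ω : ℂ}
    (h0 : ω ≠ 0) (h1 : ‖ω‖ < 1) (h : zhukovskii aσ bσ θ = zhukovskii a b ω) : ‖θ‖ ≠ 1 := by
  intro hθ
  rw [zhukovskii_of_norm_eq_one _ _ hθ] at h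
  have habs := Complex.abs_re_le_norm θ
  rw [hθ, abs_le] at habs
  exact zhukovskii_ne_of_mem_ball hb hsub h0 h1 _ ⟨by nlinarith, by nlinarith⟩ h.symm

end channelParam

lemma analyticAt_zhukovskii (a b : ℝ) {ω : ℂ} (h : ω ≠ 0) : AnalyticAt ℂ (zhukovskii a b) ω := by
  unfold zhukovskii
  have : AnalyticAt ℂ (fun θ : ℂ => θ⁻¹) ω := analyticAt_inv h
  fun_prop

/-- A non-vanishing analytic function has an analytic square root near a point. -/
lemma AnalyticAt.exists_sq_eq {u : ℂ → ℂ} {ζ₀ : ℂ} (hu : AnalyticAt ℂ u ζ₀) (h0 : u ζ₀ ≠ 0) :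
    ∃ r : ℂ → ℂ, AnalyticAt ℂ r ζ₀ ∧ ∀ ζ, r ζ ^ 2 = u ζ := by
  obtain ⟨q, hq⟩ := IsAlgClosed.exists_pow_nat_eq (u ζ₀) (n := 2) two_pos
  refine ⟨fun ζ => q * (u ζ / u ζ₀) ^ (2⁻¹ : ℂ), ?_, fun ζ => ?_⟩
  · refine analyticAt_const.mul ((hu.div analyticAt_const h0).cpow analyticAt_const ?_)
    rw [Pi.div_apply, div_self h0]
    exact Complex.one_mem_slitPlane
  · rw [mul_pow, hq]
    have : ((u ζ / u ζ₀) ^ (2⁻¹ : ℂ)) ^ 2 = u ζ / u ζ₀ := by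
      exact_mod_cast Complex.cpow_nat_inv_pow (u ζ / u ζ₀) two_ne_zero
    rw [this]
    field_simp

/-- Where `Λ` avoids the end points of the channel spectrum, or attains its value to second order,
the equation `zhukovskii aσ bσ (Θ ζ) = Λ ζ` has an analytic solution. -/
lemma exists_analyticAt_zhukovskii_eq {aσ bσ : ℝ} (hbσ : 0 < bσ) {Λ : ℂ → ℂ} {ζ₀ : ℂ}
    (hΛ : AnalyticAt ℂ Λ ζ₀)
    (h : (Λ ζ₀ ≠ ((aσ - 2 * bσ : ℝ) : ℂ) ∧ Λ ζ₀ ≠ ((aσ + 2 * bσ : ℝ) : ℂ)) ∨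
      ∃ v : ℂ → ℂ, AnalyticAt ℂ v ζ₀ ∧ v ζ₀ ≠ 0 ∧
        ∀ᶠ ζ in 𝓝 ζ₀, Λ ζ = Λ ζ₀ + (ζ - ζ₀) ^ 2 * v ζ) :
    ∃ Θ : ℂ → ℂ, AnalyticAt ℂ Θ ζ₀ ∧ ∀ᶠ ζ in 𝓝 ζ₀, Θ ζ ≠ 0 ∧ zhukovskii aσ bσ (Θ ζ) = Λ ζ := by
  have hbc : (bσ : ℂ) ≠ 0 := by exact_mod_cast hbσ.ne'
  set c : ℂ → ℂ := fun ζ => (aσ - Λ ζ) / (2 * bσ) with hc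
  have hca : AnalyticAt ℂ c ζ₀ := by
    refine (analyticAt_const.sub hΛ).div analyticAt_const ?_
    simpa using hbc
  have hq : ∀ ζ, c ζ ^ 2 - 1
      = (Λ ζ - (aσ - 2 * bσ : ℝ)) * (Λ ζ - (aσ + 2 * bσ : ℝ)) / (4 * bσ ^ 2) := fun ζ => by
    simp only [hc]
    push_cast
    field_simp
    ring
  suffices hs : ∃ r : ℂ → ℂ, AnalyticAt ℂ r ζ₀ ∧ ∀ᶠ ζ in 𝓝 ζ₀, r ζ ^ 2 = c ζ ^ 2 - 1 by
    obtain ⟨r, hra, hr⟩ := hs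
    refine ⟨fun ζ => c ζ + r ζ, hca.add hra, hr.mono fun ζ hζ => ?_⟩
    have hprod : (c ζ + r ζ) * (c ζ - r ζ) = 1 := by linear_combination -hζ
    have hinv : (c ζ + r ζ)⁻¹ = c ζ - r ζ := inv_eq_of_mul_eq_one_right hprod
    refine ⟨left_ne_zero_of_mul_eq_one hprod, ?_⟩
    rw [zhukovskii, hinv]
    simp only [hc]
    field_simp
    ring
  by_cases hE : Λ ζ₀ ≠ ((aσ - 2 * bσ : ℝ) : ℂ) ∧ Λ ζ₀ ≠ ((aσ + 2 * bσ : ℝ) : ℂ)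
  · obtain ⟨r, hr, hr2⟩ := AnalyticAt.exists_sq_eq (u := fun ζ => c ζ ^ 2 - 1)
      ((hca.pow 2).sub analyticAt_const) (by
        rw [hq]
        exact div_ne_zero (mul_ne_zero (sub_ne_zero.2 hE.1) (sub_ne_zero.2 hE.2)) (by simpa using hbc))
    exact ⟨r, hr, Eventually.of_forall hr2⟩
  · obtain ⟨v, hv, hv0, hvΛ⟩ := h.resolve_left hE
    -- the factor that does not vanish at `ζ₀` belongs to the opposite end point
    obtain ⟨E, E', hEE, hne⟩ : ∃ E E' : ℂ, Λ ζ₀ = E ∧ E ≠ E' ∧ ∀ ζ, c ζ ^ 2 - 1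
        = (Λ ζ - E) * (Λ ζ - E') / (4 * bσ ^ 2) := by
      have hd : ((aσ - 2 * bσ : ℝ) : ℂ) ≠ ((aσ + 2 * bσ : ℝ) : ℂ) := by
        intro h
        have := Complex.ofReal_injective h
        linarith
      by_cases h1 : Λ ζ₀ = ((aσ - 2 * bσ : ℝ) : ℂ)
      · exact ⟨_, _, h1, hd, hq⟩
      · have h2 : Λ ζ₀ = ((aσ + 2 * bσ : ℝ) : ℂ) := by
          by_contra h2
          exact hE ⟨h1, h2⟩
        exact ⟨_, _, h2, hd.symm, fun ζ => by rw [hq, mul_comm (Λ ζ - _)]⟩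
    have h4 : (4 * bσ ^ 2 : ℂ) ≠ 0 := by simpa using hbc
    have hua : AnalyticAt ℂ (fun ζ => v ζ * (Λ ζ - E') / (4 * bσ ^ 2)) ζ₀ :=
      (hv.mul (hΛ.sub analyticAt_const)).div analyticAt_const h4
    have hu0 : v ζ₀ * (Λ ζ₀ - E') / (4 * bσ ^ 2) ≠ 0 := by
      rw [hEE]
      exact div_ne_zero (mul_ne_zero hv0 (sub_ne_zero.2 hne.1)) h4
    obtain ⟨r, hr, hr2⟩ := hua.exists_sq_eq hu0
    refine ⟨fun ζ => (ζ - ζ₀) * r ζ, ?_, hvΛ.mono fun ζ hζ => ?_⟩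
    · have : AnalyticAt ℂ (fun ζ : ℂ => ζ - ζ₀) ζ₀ := by fun_prop
      exact this.mul hr
    rw [hne.2, mul_pow, hr2, ← hEE, show Λ ζ - Λ ζ₀ = (ζ - ζ₀) ^ 2 * v ζ by rw [hζ]; ring]
    ring

/-- A local coordinate `ζ = s ω` on the closed unit disk, centred at `ω₀`, in which the spectral
parameter is the analytic function `Λ`. It is either `ω` itself or a square root of
`1 - ω / ω₀`. -/
structure IsDiskChart (a b : ℝ) (ω₀ : ℂ) (s : ℂ → ℂ) (ζ₀ : ℂ) (Λ : ℂ → ℂ) : Prop where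
  analyticAt : ∀ ω ∈ Metric.closedBall (0 : ℂ) 1, ω ≠ ω₀ → AnalyticAt ℂ s ω
  tendsto : Tendsto s (𝓝[Metric.closedBall 0 1] ω₀) (𝓝 ζ₀)
  ne : ∀ ω ∈ Metric.closedBall (0 : ℂ) 1, ω ≠ ω₀ → s ω ≠ ζ₀
  analyticAt_spectral : AnalyticAt ℂ Λ ζ₀
  spectral_eq : ∀ ω, Λ (s ω) = zhukovskii a b ω

lemma isDiskChart_id (a b : ℝ) {ω₀ : ℂ} (h0 : ω₀ ≠ 0) :
    IsDiskChart a b ω₀ id ω₀ (zhukovskii a b) :=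
  ⟨fun _ _ _ => analyticAt_id, tendsto_nhdsWithin_of_tendsto_nhds tendsto_id, fun _ _ h => h,
    analyticAt_zhukovskii a b h0, fun _ => rfl⟩

/-- The coordinate `(1 - ω / ω₀) ^ (1 / 2)` at a point `ω₀` of the unit circle. -/
def sqrtChart (ω₀ ω : ℂ) : ℂ := (1 - ω / ω₀) ^ (2⁻¹ : ℂ)

lemma sqrtChart_sq (ω₀ ω : ℂ) : sqrtChart ω₀ ω ^ 2 = 1 - ω / ω₀ := by
  exact_mod_cast Complex.cpow_nat_inv_pow (1 - ω / ω₀) two_ne_zero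

lemma isDiskChart_sqrtChart (a b : ℝ) {ω₀ : ℂ} (h1 : ‖ω₀‖ = 1) :
    IsDiskChart a b ω₀ (sqrtChart ω₀) 0 (fun ζ => zhukovskii a b (ω₀ * (1 - ζ ^ 2))) := by
  have h0 : ω₀ ≠ 0 := norm_ne_zero_iff.1 (by rw [h1]; exact one_ne_zero)
  refine ⟨fun ω hω hne => ?_, ?_, fun ω _ hne h => ?_, ?_, fun ω => ?_⟩
  · refine ((analyticAt_const.sub (analyticAt_id.div analyticAt_const h0)).cpow analyticAt_const ?_)
    left
    have hq : ‖ω / ω₀‖ ≤ 1 := by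
      rw [norm_div, h1, div_one]; simpa using hω
    have hre : (ω / ω₀).re ≤ 1 := (Complex.re_le_norm _).trans hq
    have hre1 : (ω / ω₀).re ≠ 1 := by
      intro hre1
      -- a point of the closed unit disk with real part one is `1`
      have hsq : ‖ω / ω₀‖ ^ 2 ≤ 1 := by nlinarith [norm_nonneg (ω / ω₀)]
      rw [← Complex.normSq_eq_norm_sq, Complex.normSq_apply, hre1] at hsq
      have him : (ω / ω₀).im = 0 := by nlinarith [mul_self_nonneg (ω / ω₀).im]
      have : ω / ω₀ = 1 := Complex.ext hre1 him
      exact hne ((div_eq_one_iff_eq h0).1 this)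
    change 0 < (1 - ω / ω₀).re
    rw [Complex.sub_re, Complex.one_re]
    have := lt_of_le_of_ne hre hre1
    linarith
  · have hc : ContinuousAt (sqrtChart ω₀) ω₀ := by
      have e : ContinuousAt (fun w : ℂ => w ^ (2⁻¹ : ℂ)) (1 - ω₀ / ω₀) := by
        rw [div_self h0, sub_self]
        exact Complex.continuousAt_cpow_const_of_re_pos (z := 0) (w := 2⁻¹) (by simp) (by norm_num)
      exact ContinuousAt.comp (f := fun ω : ℂ => 1 - ω / ω₀) e (by fun_prop)
    have ht := hc.tendsto
    have hv : sqrtChart ω₀ ω₀ = 0 := by simp [sqrtChart, div_self h0]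
    rw [hv] at ht
    exact ht.mono_left nhdsWithin_le_nhds
  · have := sqrtChart_sq ω₀ ω
    rw [h] at this
    have h2 : ω / ω₀ = 1 := by linear_combination this
    exact hne ((div_eq_one_iff_eq h0).1 h2)
  · have : AnalyticAt ℂ (zhukovskii a b) ((fun ζ : ℂ => ω₀ * (1 - ζ ^ 2)) 0) :=
      analyticAt_zhukovskii a b (by simpa using h0)
    exact this.comp (f := fun ζ : ℂ => ω₀ * (1 - ζ ^ 2)) (by fun_prop)
  · simp only [sqrtChart_sq]
    congr 1
    field_simp
    ring

/-- In a suitable chart the channel parameter is an analytic function of the coordinate. -/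
lemma IsDiskChart.exists_channelParam_eq {aσ bσ a b : ℝ} (hbσ : 0 < bσ) (hb : 0 < b)
    (hsub : Set.Icc (aσ - 2 * bσ) (aσ + 2 * bσ) ⊆ Set.Icc (a - 2 * b) (a + 2 * b))
    {ω₀ ζ₀ : ℂ} {s Λ : ℂ → ℂ} (hs : IsDiskChart a b ω₀ s ζ₀ Λ) (h0 : ω₀ ≠ 0) (h1 : ‖ω₀‖ ≤ 1)
    (h : (Λ ζ₀ ≠ ((aσ - 2 * bσ : ℝ) : ℂ) ∧ Λ ζ₀ ≠ ((aσ + 2 * bσ : ℝ) : ℂ)) ∨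
      ∃ v : ℂ → ℂ, AnalyticAt ℂ v ζ₀ ∧ v ζ₀ ≠ 0 ∧
        ∀ᶠ ζ in 𝓝 ζ₀, Λ ζ = Λ ζ₀ + (ζ - ζ₀) ^ 2 * v ζ) :
    ∃ Θ : ℂ → ℂ, AnalyticAt ℂ Θ ζ₀ ∧ Θ ζ₀ ≠ 0 ∧ ‖Θ ζ₀‖ ≤ 1 ∧
      ∀ᶠ ω in 𝓝[Metric.ball 0 1] ω₀, channelParam aσ bσ a b ω = Θ (s ω) := by
  obtain ⟨Θ, hΘ, hΘeq⟩ := exists_analyticAt_zhukovskii_eq hbσ hs.analyticAt_spectral h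
  have hev : ∀ᶠ ω in 𝓝[Metric.closedBall 0 1] ω₀, ContinuousAt Θ (s ω) ∧ Θ (s ω) ≠ 0 ∧
      zhukovskii aσ bσ (Θ (s ω)) = zhukovskii a b ω := by
    filter_upwards [hs.tendsto.eventually (hΘ.eventually_analyticAt.and hΘeq)] with ω hω
    exact ⟨hω.1.continuousAt, hω.2.1, hω.2.2.trans (hs.spectral_eq ω)⟩
  rw [eventually_nhdsWithin_iff, Metric.eventually_nhds_iff] at hev
  obtain ⟨δ', hδ', hev⟩ := hev
  set δ := min δ' ‖ω₀‖ with hδ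
  have hδ0 : 0 < δ := lt_min hδ' (norm_pos_iff.2 h0)
  set A := Metric.ball (0 : ℂ) 1 ∩ Metric.ball ω₀ δ with hA
  have hAprop : ∀ ω ∈ A, ContinuousAt Θ (s ω) ∧ Θ (s ω) ≠ 0 ∧
      zhukovskii aσ bσ (Θ (s ω)) = zhukovskii a b ω := fun ω hω =>
    hev (lt_of_lt_of_le hω.2 (min_le_left _ _)) (Metric.ball_subset_closedBall hω.1)
  have hA0 : ∀ ω ∈ A, ω ≠ 0 := fun ω hω h => by
    subst h
    have h2 := lt_of_lt_of_le (Metric.mem_ball.1 hω.2) (min_le_right _ _)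
    rw [dist_zero_left] at h2
    exact lt_irrefl _ h2
  have hne1 : ∀ ω ∈ A, ‖Θ (s ω)‖ ≠ 1 := fun ω hω =>
    norm_ne_one_of_zhukovskii_eq hbσ hb hsub (hA0 ω hω) (by simpa using hω.1) (hAprop ω hω).2.2
  have hscont : ContinuousOn s A := fun ω hω => by
    by_cases hωω : ω = ω₀
    · have hmem : ω₀ ∈ Metric.closedBall (0 : ℂ) 1 := by simpa using h1
      have hval : s ω₀ = ζ₀ := by
        have := hs.tendsto.mono_left (pure_le_nhdsWithin hmem)
        exact tendsto_nhds_unique (tendsto_pure_nhds s ω₀) this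
      rw [hωω]
      have ht := hs.tendsto
      rw [← hval] at ht
      exact ht.mono_left (nhdsWithin_mono _ fun x hx => Metric.ball_subset_closedBall hx.1)
    · exact (hs.analyticAt ω (Metric.ball_subset_closedBall hω.1)
        hωω).continuousAt.continuousWithinAt
  have hcont : ContinuousOn (fun ω => ‖Θ (s ω)‖) A := fun ω hω =>
    (((hAprop ω hω).1).comp_continuousWithinAt (hscont ω hω)).norm
  have hpre : IsPreconnected A := ((convex_ball _ _).inter (convex_ball _ _)).isPreconnected
  have hcl : ω₀ ∈ closure (Metric.ball (0 : ℂ) 1) := by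
    rw [closure_ball _ one_ne_zero]; simpa using h1
  have hAeq : 𝓝[A] ω₀ = 𝓝[Metric.ball 0 1] ω₀ := by
    rw [hA, Set.inter_comm]
    exact nhdsWithin_inter_of_mem (mem_nhdsWithin_of_mem_nhds (Metric.ball_mem_nhds ω₀ hδ0))
  have hbot : (𝓝[Metric.ball (0 : ℂ) 1] ω₀).NeBot := mem_closure_iff_nhdsWithin_neBot.1 hcl
  have hsA : Tendsto s (𝓝[Metric.ball 0 1] ω₀) (𝓝 ζ₀) :=
    hs.tendsto.mono_left (nhdsWithin_mono _ Metric.ball_subset_closedBall)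
  -- it remains to choose between the two solutions, which are inverse to each other
  have main : ∀ Ψ : ℂ → ℂ, AnalyticAt ℂ Ψ ζ₀ → Ψ ζ₀ ≠ 0 → (∀ ω ∈ A, ‖Ψ (s ω)‖ < 1 ∧
      Ψ (s ω) ≠ 0 ∧ zhukovskii aσ bσ (Ψ (s ω)) = zhukovskii a b ω) →
      ∃ Θ : ℂ → ℂ, AnalyticAt ℂ Θ ζ₀ ∧ Θ ζ₀ ≠ 0 ∧ ‖Θ ζ₀‖ ≤ 1 ∧
      ∀ᶠ ω in 𝓝[Metric.ball 0 1] ω₀, channelParam aσ bσ a b ω = Θ (s ω) := by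
    intro Ψ hΨ hΨ0 hΨA
    have hmemA : ∀ᶠ ω in 𝓝[Metric.ball 0 1] ω₀, ω ∈ A := by
      rw [← hAeq]; exact self_mem_nhdsWithin
    refine ⟨Ψ, hΨ, hΨ0, ?_, hmemA.mono fun ω hω =>
      channelParam_eq hbσ (hΨA ω hω).2.1 (hΨA ω hω).1 (hΨA ω hω).2.2⟩
    exact le_of_tendsto ((hΨ.continuousAt.tendsto.comp hsA).norm)
      (hmemA.mono fun ω hω => (hΨA ω hω).1.le)
  have hΘ0 : Θ ζ₀ ≠ 0 := hΘeq.self_of_nhds.1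
  by_cases hall : ∀ ω ∈ A, ‖Θ (s ω)‖ < 1
  · exact main Θ hΘ hΘ0 fun ω hω => ⟨hall ω hω, (hAprop ω hω).2⟩
  · push Not at hall
    obtain ⟨x, hx, hx1⟩ := hall
    have hgt : ∀ ω ∈ A, 1 < ‖Θ (s ω)‖ := fun ω hω => by
      by_contra hlt
      push Not at hlt
      obtain ⟨y, hy, hy1⟩ := hpre.intermediate_value hω hx hcont ⟨hlt, hx1⟩
      exact hne1 y hy hy1
    refine main (fun ζ => (Θ ζ)⁻¹) (hΘ.inv hΘ0) (inv_ne_zero hΘ0) fun ω hω => ⟨?_, ?_, ?_⟩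
    · rw [norm_inv]
      exact inv_lt_one_of_one_lt₀ (hgt ω hω)
    · exact inv_ne_zero (hAprop ω hω).2.1
    · rw [zhukovskii_inv]
      exact (hAprop ω hω).2.2

/-! ### Meromorphic matrix functions -/

/-- All entries of the matrix function `M` are meromorphic at `x`. -/
def MatMeromorphicAt {m n : Type*} (M : ℂ → Matrix m n ℂ) (x : ℂ) : Prop :=
  ∀ i j, MeromorphicAt (fun ζ => M ζ i j) x

namespace MatMeromorphicAt

variable {l m n : Type*} [Fintype m] {x : ℂ}

lemma mul {M : ℂ → Matrix l m ℂ} {N : ℂ → Matrix m n ℂ} (hM : MatMeromorphicAt M x)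
    (hN : MatMeromorphicAt N x) : MatMeromorphicAt (fun ζ => M ζ * N ζ) x := fun i j => by
  simp only [Matrix.mul_apply]
  exact MeromorphicAt.fun_sum fun k _ => (hM i k).mul (hN k j)

lemma add {M N : ℂ → Matrix l n ℂ} (hM : MatMeromorphicAt M x) (hN : MatMeromorphicAt N x) :
    MatMeromorphicAt (fun ζ => M ζ + N ζ) x := fun i j => (hM i j).add (hN i j)

lemma sub {M N : ℂ → Matrix l n ℂ} (hM : MatMeromorphicAt M x) (hN : MatMeromorphicAt N x) :
    MatMeromorphicAt (fun ζ => M ζ - N ζ) x := fun i j => (hM i j).sub (hN i j)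

lemma neg {M : ℂ → Matrix l n ℂ} (hM : MatMeromorphicAt M x) :
    MatMeromorphicAt (fun ζ => -M ζ) x := fun i j => (hM i j).neg

lemma const (M : Matrix l n ℂ) : MatMeromorphicAt (fun _ => M) x := fun _ _ =>
  MeromorphicAt.const _ _

lemma diagonal [DecidableEq n] {v : ℂ → n → ℂ} (hv : ∀ i, MeromorphicAt (fun ζ => v ζ i) x) :
    MatMeromorphicAt (fun ζ => Matrix.diagonal (v ζ)) x := fun i j => by
  by_cases h : i = j
  · subst h
    simpa only [Matrix.diagonal_apply_eq] using hv i
  · simp only [Matrix.diagonal_apply_ne _ h]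
    exact MeromorphicAt.const _ _

lemma det [DecidableEq m] {M : ℂ → Matrix m m ℂ} (hM : MatMeromorphicAt M x) :
    MeromorphicAt (fun ζ => (M ζ).det) x := by
  simp only [Matrix.det_apply']
  exact MeromorphicAt.fun_sum fun σ _ => (MeromorphicAt.const _ _).mul
    (MeromorphicAt.fun_prod fun i _ => hM _ _)

lemma inv [DecidableEq m] {M : ℂ → Matrix m m ℂ} (hM : MatMeromorphicAt M x) :
    MatMeromorphicAt (fun ζ => (M ζ)⁻¹) x := fun i j => by
  simp only [Matrix.inv_def, Ring.inverse_eq_inv', Matrix.smul_apply, smul_eq_mul,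
    Matrix.adjugate_apply]
  refine hM.det.inv.mul (det (M := fun ζ => (M ζ).updateRow j (Pi.single i 1)) fun k l => ?_)
  by_cases hk : k = j
  · subst hk
    simp only [Matrix.updateRow_self]
    exact MeromorphicAt.const _ _
  · simp only [Matrix.updateRow_ne hk]
    exact hM k l

end MatMeromorphicAt

/-- A meromorphic function which is `O(|ζ - ζ₀|⁻ᵐ)` along some path has at most a pole of order
`m`. -/
lemma MeromorphicAt.exists_eq_inv_pow_mul {h : ℂ → ℂ} {ζ₀ : ℂ} (hh : MeromorphicAt h ζ₀) (m : ℕ)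
    {ι : Type*} {l : Filter ι} [l.NeBot] {p : ι → ℂ} (hp : Tendsto p l (𝓝[≠] ζ₀)) {K : ℝ}
    (hK : ∀ᶠ t in l, ‖p t - ζ₀‖ ^ m * ‖h (p t)‖ ≤ K) :
    ∃ G : ℂ → ℂ, AnalyticAt ℂ G ζ₀ ∧ ∀ᶠ ζ in 𝓝[≠] ζ₀, h ζ = ((ζ - ζ₀) ^ m)⁻¹ * G ζ := by
  set f : ℂ → ℂ := fun ζ => (ζ - ζ₀) ^ m * h ζ with hf
  have hfm : MeromorphicAt f ζ₀ := by
    have : MeromorphicAt (fun ζ : ℂ => (ζ - ζ₀) ^ m) ζ₀ := by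
      apply AnalyticAt.meromorphicAt
      fun_prop
    exact this.mul hh
  have hord : 0 ≤ meromorphicOrderAt f ζ₀ := by
    by_contra hlt
    push Not at hlt
    have ht := (tendsto_cobounded_of_meromorphicOrderAt_neg hlt).comp hp
    have ht2 := tendsto_norm_cobounded_atTop.comp ht
    obtain ⟨t, ht3, ht4⟩ := ((ht2.eventually (eventually_gt_atTop K)).and hK).exists
    simp only [Function.comp, hf, norm_mul, norm_pow] at ht3
    linarith
  suffices hs : ∃ G : ℂ → ℂ, AnalyticAt ℂ G ζ₀ ∧ ∀ᶠ ζ in 𝓝[≠] ζ₀, f ζ = G ζ by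
    obtain ⟨G, hG, hGe⟩ := hs
    refine ⟨G, hG, ?_⟩
    filter_upwards [hGe, self_mem_nhdsWithin] with ζ hζ hne
    rw [← hζ]
    have : (ζ - ζ₀) ^ m ≠ 0 := pow_ne_zero _ (sub_ne_zero.2 hne)
    simp only [hf]
    field_simp
  by_cases htop : meromorphicOrderAt f ζ₀ = ⊤
  · exact ⟨fun _ => 0, analyticAt_const, meromorphicOrderAt_eq_top_iff.1 htop⟩
  · obtain ⟨n, hn⟩ := WithTop.ne_top_iff_exists.1 htop
    rw [← hn] at hord
    obtain ⟨g, hg, -, hge⟩ := (meromorphicOrderAt_eq_int_iff hfm).1 hn.symm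
    obtain ⟨N, rfl⟩ := Int.eq_ofNat_of_zero_le (by exact_mod_cast hord : 0 ≤ n)
    refine ⟨fun ζ => (ζ - ζ₀) ^ N * g ζ, ?_, hge.mono fun ζ hζ => by simpa using hζ⟩
    have : AnalyticAt ℂ (fun ζ : ℂ => (ζ - ζ₀) ^ N) ζ₀ := by fun_prop
    exact this.mul hg

lemma AnalyticAt.exists_eq_sub_mul {G : ℂ → ℂ} {ζ₀ : ℂ} (hG : AnalyticAt ℂ G ζ₀)
    (h0 : G ζ₀ = 0) :
    ∃ H : ℂ → ℂ, AnalyticAt ℂ H ζ₀ ∧ ∀ ζ, G ζ = (ζ - ζ₀) * H ζ := by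
  obtain ⟨p, hp⟩ := hG
  refine ⟨dslope G ζ₀, hp.has_fpower_series_dslope_fslope.analyticAt, fun ζ => ?_⟩
  have := sub_smul_dslope G ζ₀ ζ
  rw [h0, sub_zero, smul_eq_mul] at this
  exact this.symm

/-! ### The scattering matrix in a chart -/

/-- The family of the Jost solutions at given channel parameters. -/
def jostFamily {C : Type*} (F : C → ℕ → ℂ → ℂ) (θ : C → ℂ) (σ : C) (k : ℕ) : ℂ :=
  θ σ ^ k * F σ k (θ σ)

namespace WebSystem

variable {V C : Type*}

/-- The standing assumptions: every channel has a Jost function `F σ`, and every channel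
spectrum is contained in `[a - 2b, a + 2b]`. -/
structure IsScattering (S : WebSystem V C) (aInf bInf : C → ℝ) (a b : ℝ) (r : C → ℝ)
    (F : C → ℕ → ℂ → ℂ) : Prop where
  jost : ∀ σ, IsJostFunction (S.onsite σ) (S.hop σ) (aInf σ) (bInf σ) (r σ) (F σ)
  hop_tendsto : ∀ σ, Tendsto (S.hop σ) atTop (𝓝 (bInf σ))
  b_pos : 0 < b
  subset : ∀ σ, Set.Icc (aInf σ - 2 * bInf σ) (aInf σ + 2 * bInf σ)
    ⊆ Set.Icc (a - 2 * b) (a + 2 * b)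

/-- A chart at `ω₀` in which all channel parameters are analytic functions `Θ σ` of the
coordinate. -/
structure IsLocalModel (aInf bInf : C → ℝ) (a b : ℝ) (ω₀ : ℂ) (s : ℂ → ℂ) (ζ₀ : ℂ) (Λ : ℂ → ℂ)
    (Θ : C → ℂ → ℂ) : Prop extends IsDiskChart a b ω₀ s ζ₀ Λ where
  center_ne_zero : ω₀ ≠ 0
  norm_center_le : ‖ω₀‖ ≤ 1
  analyticAt_param : ∀ σ, AnalyticAt ℂ (Θ σ) ζ₀
  param_ne_zero : ∀ σ, Θ σ ζ₀ ≠ 0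
  norm_param_le : ∀ σ, ‖Θ σ ζ₀‖ ≤ 1
  param_eq : ∀ σ, ∀ᶠ ω in 𝓝[Metric.ball 0 1] ω₀,
    channelParam (aInf σ) (bInf σ) a b ω = Θ σ (s ω)

variable [Fintype V] [DecidableEq V] [Fintype C] [DecidableEq C]

/-- The scattering matrix as a function of the coordinate of a chart. -/
def chartU (S : WebSystem V C) (bInf : C → ℝ) (F : C → ℕ → ℂ → ℂ) (Λ : ℂ → ℂ) (Θ : C → ℂ → ℂ)
    (k : ℕ) (ζ : ℂ) : Matrix C C ℂ :=
  S.scatterU bInf (Λ ζ) (jostFamily F fun σ => Θ σ ζ) (fun σ => Θ σ ζ) k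

/-- The function `cutColumn` in a chart. -/
def chartColumn (S : WebSystem V C) (bInf : C → ℝ) (F : C → ℕ → ℂ → ℂ) (Λ : ℂ → ℂ)
    (Θ : C → ℂ → ℂ) (σ : C) (j : ℕ) (ζ : ℂ) : C → ℕ → ℂ :=
  S.cutColumn bInf (Λ ζ) (jostFamily F fun σ => Θ σ ζ) (fun σ => Θ σ ζ) σ j

/-- The extension of `chartColumn` to the central part. -/
def chartCentral (S : WebSystem V C) (bInf : C → ℝ) (F : C → ℕ → ℂ → ℂ) (Λ : ℂ → ℂ)
    (Θ : C → ℂ → ℂ) (σ : C) (j : ℕ) (ζ : ℂ) : V → ℂ :=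
  S.centralExt (Λ ζ) fun ν => S.chartColumn bInf F Λ Θ σ j ζ ν 1

/-- The strength of the source at `σ(j + 1)` that generates `chartColumn`. -/
def chartSource (bInf : C → ℝ) (F : C → ℕ → ℂ → ℂ) (Θ : C → ℂ → ℂ) (σ : C) (j : ℕ) (ζ : ℂ) : ℂ :=
  bInf σ * ((Θ σ ζ)⁻¹ - Θ σ ζ) * (Θ σ ζ ^ (j + 1) * F σ (j + 1) (Θ σ ζ))⁻¹

lemma analyticAt_channelP (onsite hop : ℕ → ℝ) {Λ : ℂ → ℂ} {ζ₀ : ℂ} (hΛ : AnalyticAt ℂ Λ ζ₀)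
    (k : ℕ) : AnalyticAt ℂ (fun ζ => channelP onsite hop (Λ ζ) k) ζ₀ ∧
      AnalyticAt ℂ (fun ζ => channelP onsite hop (Λ ζ) (k + 1)) ζ₀ := by
  induction k with
  | zero => simp only [channelP]; exact ⟨analyticAt_const, analyticAt_const⟩
  | succ k ih =>
    refine ⟨ih.2, ?_⟩
    simp only [channelP, div_eq_mul_inv]
    exact (((analyticAt_const.sub hΛ).mul ih.2).sub (analyticAt_const.mul ih.1)).mul
      analyticAt_const

section

variable {S : WebSystem V C} {aInf bInf : C → ℝ} {a b : ℝ} {r : C → ℝ} {F : C → ℕ → ℂ → ℂ}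

/-- In the disk the scattering matrix is given by the Jost functions. -/
lemma IsScattering.uMatrix_eq (h : S.IsScattering aInf bInf a b r F) (k : ℕ) {ω : ℂ} (h0 : ω ≠ 0)
    (h1 : ‖ω‖ < 1) :
    S.uMatrix aInf bInf a b k ω = S.scatterU bInf (zhukovskii a b ω)
      (jostFamily F fun σ => channelParam (aInf σ) (bInf σ) a b ω)
      (fun σ => channelParam (aInf σ) (bInf σ) a b ω) k := by
  have hj : ∀ n, S.jostMatrix aInf bInf a b n ω = Matrix.diagonal fun σ =>
      jostFamily F (fun σ => channelParam (aInf σ) (bInf σ) a b ω) σ n := fun n => by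
    rw [jostMatrix]
    congr 1
    funext σ
    obtain ⟨p0, p1, -⟩ := channelParam_spec (h.jost σ).b_pos h.b_pos (h.subset σ) h0 h1
    exact (h.jost σ).jost_eq (h.hop_tendsto σ) p0 p1 n
  rw [uMatrix, scatterU, tMatrix, connectionMatrix, dMatrix, pMatrix, hj, hj, hj]

lemma IsScattering.isChannelSolution (h : S.IsScattering aInf bInf a b r F) {ω : ℂ} (h0 : ω ≠ 0)
    (h1 : ‖ω‖ < 1) (σ : C) :
    IsChannelSolution (S.onsite σ) (S.hop σ) (zhukovskii a b ω)
      (jostFamily F (fun σ => channelParam (aInf σ) (bInf σ) a b ω) σ) := by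
  obtain ⟨p0, p1, p2⟩ := channelParam_spec (h.jost σ).b_pos h.b_pos (h.subset σ) h0 h1
  rw [← p2]
  exact (h.jost σ).isChannelSolution p0 (p1.trans (h.jost σ).one_lt)

lemma IsScattering.jostFamily_decay (h : S.IsScattering aInf bInf a b r F) {ω : ℂ} (h0 : ω ≠ 0)
    (h1 : ‖ω‖ < 1) (σ : C) :
    Tendsto (jostFamily F (fun σ => channelParam (aInf σ) (bInf σ) a b ω) σ) atTop (𝓝 0) ∧
      ∃ k, jostFamily F (fun σ => channelParam (aInf σ) (bInf σ) a b ω) σ (k + 1) ≠ 0 := by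
  obtain ⟨p0, p1, -⟩ := channelParam_spec (h.jost σ).b_pos h.b_pos (h.subset σ) h0 h1
  have hr := p1.trans (h.jost σ).one_lt
  constructor
  · have := (tendsto_pow_atTop_nhds_zero_of_norm_lt_one p1).mul ((h.jost σ).tendsto_one _ hr)
    rw [zero_mul] at this
    exact this
  · rcases (h.jost σ).exists_ne_zero hr 1 with h2 | h2
    · exact ⟨0, mul_ne_zero (pow_ne_zero _ p0) h2⟩
    · exact ⟨1, mul_ne_zero (pow_ne_zero _ p0) h2⟩

lemma IsScattering.jostFamily_one_ne_zero (h : S.IsScattering aInf bInf a b r F) {ω : ℂ}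
    (h1 : ‖ω‖ < 1) (him : ω.im ≠ 0) (σ : C) :
    jostFamily F (fun σ => channelParam (aInf σ) (bInf σ) a b ω) σ 1 ≠ 0 := by
  have h0 : ω ≠ 0 := fun h => him (by simp [h])
  exact channelSolution_one_ne_zero (h.hop_tendsto σ) (zhukovskii_im_ne_zero h.b_pos h1 him)
    (h.isChannelSolution h0 h1 σ) (h.jostFamily_decay h0 h1 σ).1 (h.jostFamily_decay h0 h1 σ).2

variable {ω₀ ζ₀ : ℂ} {s Λ : ℂ → ℂ} {Θ : C → ℂ → ℂ}

lemma IsLocalModel.eventually_param_eq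
    (hm : IsLocalModel aInf bInf a b ω₀ s ζ₀ Λ Θ) :
    ∀ᶠ ω in 𝓝[Metric.ball 0 1] ω₀, ω ≠ 0 ∧ ‖ω‖ < 1 ∧
      (fun σ => channelParam (aInf σ) (bInf σ) a b ω) = fun σ => Θ σ (s ω) := by
  filter_upwards [eventually_all.2 hm.param_eq, self_mem_nhdsWithin,
    nhdsWithin_le_nhds (isOpen_ne.mem_nhds hm.center_ne_zero)] with ω h1 h2 h3
  exact ⟨h3, by simpa using h2, funext h1⟩

lemma IsLocalModel.eventually_uMatrix_eq (hm : IsLocalModel aInf bInf a b ω₀ s ζ₀ Λ Θ)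
    (h : S.IsScattering aInf bInf a b r F) (k : ℕ) :
    ∀ᶠ ω in 𝓝[Metric.ball 0 1] ω₀,
      S.uMatrix aInf bInf a b k ω = S.chartU bInf F Λ Θ k (s ω) := by
  filter_upwards [hm.eventually_param_eq] with ω ⟨h0, h1, h2⟩
  rw [h.uMatrix_eq k h0 h1, h2, chartU, hm.spectral_eq]

lemma IsLocalModel.analyticAt_jostFamily (hm : IsLocalModel aInf bInf a b ω₀ s ζ₀ Λ Θ)
    (h : S.IsScattering aInf bInf a b r F) (σ : C) (k : ℕ) :
    AnalyticAt ℂ (fun ζ => jostFamily F (fun σ => Θ σ ζ) σ k) ζ₀ := by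
  simp only [jostFamily]
  refine ((hm.analyticAt_param σ).pow k).mul ?_
  exact ((h.jost σ).analyticAt k _ ((hm.norm_param_le σ).trans_lt (h.jost σ).one_lt)).comp
    (hm.analyticAt_param σ)

lemma IsLocalModel.matMeromorphicAt_resolvent (hm : IsLocalModel aInf bInf a b ω₀ s ζ₀ Λ Θ)
    (S : WebSystem V C) : MatMeromorphicAt
      (fun ζ => (S.central.map (fun r : ℝ => (r : ℂ)) - Λ ζ • (1 : Matrix V V ℂ))⁻¹) ζ₀ := by
  refine MatMeromorphicAt.inv ((MatMeromorphicAt.const _).sub fun i j => ?_)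
  simp only [Matrix.smul_apply, smul_eq_mul]
  exact hm.analyticAt_spectral.meromorphicAt.mul (MeromorphicAt.const _ _)

/-- No determinant has to be non-zero here: where a determinant vanishes identically, the matrix
inverse is identically zero by convention. -/
lemma IsLocalModel.matMeromorphicAt_chartU (hm : IsLocalModel aInf bInf a b ω₀ s ζ₀ Λ Θ)
    (h : S.IsScattering aInf bInf a b r F) (k : ℕ) :
    MatMeromorphicAt (S.chartU bInf F Λ Θ k) ζ₀ := by
  have hE : ∀ n, MatMeromorphicAt
      (fun ζ => Matrix.diagonal fun σ => jostFamily F (fun σ => Θ σ ζ) σ n) ζ₀ := fun n =>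
    MatMeromorphicAt.diagonal fun σ => (hm.analyticAt_jostFamily h σ n).meromorphicAt
  have hP : MatMeromorphicAt
      (fun ζ => Matrix.diagonal fun σ => channelP (S.onsite σ) (S.hop σ) (Λ ζ) k) ζ₀ :=
    MatMeromorphicAt.diagonal fun σ =>
      (analyticAt_channelP _ _ hm.analyticAt_spectral k).1.meromorphicAt
  have hD : MatMeromorphicAt
      (fun ζ => Matrix.diagonal fun σ => (Θ σ ζ)⁻¹ - Θ σ ζ) ζ₀ :=
    MatMeromorphicAt.diagonal fun σ =>
      ((hm.analyticAt_param σ).meromorphicAt.inv).sub (hm.analyticAt_param σ).meromorphicAt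
  have hR : MatMeromorphicAt (fun ζ => S.resolventBlock (Λ ζ)) ζ₀ := fun i j =>
    hm.matMeromorphicAt_resolvent S _ _
  have hT : MatMeromorphicAt
      (fun ζ => S.connectionMatrix (Λ ζ) (jostFamily F fun σ => Θ σ ζ)) ζ₀ :=
    (hE 0).sub ((hR.mul (MatMeromorphicAt.const _)).mul (hE 1))
  exact ((((hP.neg.add ((hE k).mul hT.inv)).mul (MatMeromorphicAt.const _)).mul
    (MatMeromorphicAt.const _)).mul hD).mul (hE 1).inv

lemma IsLocalModel.meromorphicAt_chartColumn (hm : IsLocalModel aInf bInf a b ω₀ s ζ₀ Λ Θ)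
    (h : S.IsScattering aInf bInf a b r F) (σ : C) (j : ℕ) (ν : C) (k : ℕ) :
    MeromorphicAt (fun ζ => S.chartColumn bInf F Λ Θ σ j ζ ν k) ζ₀ := by
  simp only [chartColumn, cutColumn]
  split_ifs with hc
  · exact ((hm.matMeromorphicAt_chartU h (j + 1) σ σ).mul
      (hm.analyticAt_jostFamily h σ (j + 1)).meromorphicAt.inv).mul
      (hm.analyticAt_jostFamily h σ k).meromorphicAt
  · exact hm.matMeromorphicAt_chartU h k ν σ

lemma IsLocalModel.meromorphicAt_chartCentral (hm : IsLocalModel aInf bInf a b ω₀ s ζ₀ Λ Θ)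
    (h : S.IsScattering aInf bInf a b r F) (σ : C) (j : ℕ) (α : V) :
    MeromorphicAt (fun ζ => S.chartCentral bInf F Λ Θ σ j ζ α) ζ₀ := by
  simp only [chartCentral, centralExt]
  exact MeromorphicAt.fun_sum fun ν _ => (hm.matMeromorphicAt_resolvent S _ _).mul
    ((MeromorphicAt.const _ _).mul (hm.meromorphicAt_chartColumn h σ j ν 1))

/-- Near the centre of a chart, the columns of `U` are, up to a bounded factor, columns of the
resolvent of `L`. -/
lemma IsLocalModel.exists_bound (hm : IsLocalModel aInf bInf a b ω₀ s ζ₀ Λ Θ)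
    (h : S.IsScattering aInf bInf a b r F) (σ : C) (k₀ : ℕ) :
    ∃ j, k₀ ≤ j ∧ ∃ K : ℝ, ∀ᶠ ω in 𝓝[Metric.ball 0 1] ω₀, ω.im ≠ 0 →
      S.IsForcedSolution (zhukovskii a b ω) (S.chartCentral bInf F Λ Θ σ j (s ω))
        (S.chartColumn bInf F Λ Θ σ j (s ω)) σ j (chartSource bInf F Θ σ j (s ω)) ∧
      ‖chartSource bInf F Θ σ j (s ω)‖ ≤ K ∧
      ∀ N, ∑ α, ‖S.chartCentral bInf F Λ Θ σ j (s ω) α‖ ^ 2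
        + ∑ ν, ∑ k ∈ Finset.range N, ‖S.chartColumn bInf F Λ Θ σ j (s ω) ν (k + 1)‖ ^ 2
          ≤ (K / |(zhukovskii a b ω).im|) ^ 2 := by
  obtain ⟨j, hj, hF⟩ : ∃ j, k₀ ≤ j ∧ F σ (j + 1) (Θ σ ζ₀) ≠ 0 := by
    rcases (h.jost σ).exists_ne_zero ((hm.norm_param_le σ).trans_lt (h.jost σ).one_lt) (k₀ + 1)
      with h1 | h1
    · exact ⟨k₀, le_rfl, h1⟩
    · exact ⟨k₀ + 1, by omega, h1⟩
  have he : AnalyticAt ℂ (fun ζ => Θ σ ζ ^ (j + 1) * F σ (j + 1) (Θ σ ζ)) ζ₀ :=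
    hm.analyticAt_jostFamily h σ (j + 1)
  have he0 : Θ σ ζ₀ ^ (j + 1) * F σ (j + 1) (Θ σ ζ₀) ≠ 0 :=
    mul_ne_zero (pow_ne_zero _ (hm.param_ne_zero σ)) hF
  have hsrc : ContinuousAt (chartSource bInf F Θ σ j) ζ₀ := by
    have hθ := (hm.analyticAt_param σ).continuousAt
    exact (continuousAt_const.mul ((hθ.inv₀ (hm.param_ne_zero σ)).sub hθ)).mul
      (he.continuousAt.inv₀ he0)
  have hst : Tendsto s (𝓝[Metric.ball 0 1] ω₀) (𝓝 ζ₀) :=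
    hm.tendsto.mono_left (nhdsWithin_mono _ Metric.ball_subset_closedBall)
  refine ⟨j, hj, ‖chartSource bInf F Θ σ j ζ₀‖ + 1, ?_⟩
  filter_upwards [hm.eventually_param_eq, hst.eventually (he.continuousAt.eventually_ne he0),
    hst.eventually (hsrc.norm.eventually (gt_mem_nhds (lt_add_one _)))] with ω ⟨h0, h1, h2⟩ h3 h4 him
  have hz := zhukovskii_im_ne_zero (a := a) h.b_pos h1 him
  have hne := fun ν => h.jostFamily_one_ne_zero h1 him ν
  have hsol := fun ν => h.isChannelSolution h0 h1 ν
  have hdec := fun ν => (h.jostFamily_decay h0 h1 ν).1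
  have hT := S.isUnit_det_connectionMatrix hz h.hop_tendsto hsol hdec
    (fun ν => (h.jostFamily_decay h0 h1 ν).2)
  rw [h2] at hne hsol hdec hT
  rw [← hm.spectral_eq] at hz hsol hT ⊢
  have hforced := S.isForcedSolution_cutColumn bInf (fun σ => Θ σ (s ω)) hsol hne hT
    (S.isUnit_det_central_sub hz) σ j h3
  have hb := hforced.sum_norm_sq_le hz h.hop_tendsto
    (S.tendsto_cutColumn bInf (fun σ => Θ σ (s ω)) hne hdec σ j)
  refine ⟨hforced, h4.le, fun N => (hb N).trans ?_⟩
  have : ‖(bInf σ : ℂ) * ((Θ σ (s ω))⁻¹ - Θ σ (s ω))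
      * (jostFamily F (fun σ => Θ σ (s ω)) σ (j + 1))⁻¹‖ ≤ ‖chartSource bInf F Θ σ j ζ₀‖ + 1 := h4.le
  gcongr

end

end WebSystem

/-! ### Threshold eigenfunctions -/

namespace WebSystem

variable {V C : Type*} [Fintype V] [DecidableEq V] [Fintype C] [DecidableEq C]

/-- The function on all particles with values `y` on the central part and `x ν k` at `ν(k)`. -/
def combine (y : V → ℂ) (x : C → ℕ → ℂ) : V ⊕ (C × ℕ) → ℂ
  | Sum.inl α => y α
  | Sum.inr (ν, k) => x ν (k + 1)

lemma summable_combine {y : V → ℂ} {x : C → ℕ → ℂ} {B : ℝ}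
    (hB : ∀ N, ∑ α, ‖y α‖ ^ 2 + ∑ ν, ∑ k ∈ Finset.range N, ‖x ν (k + 1)‖ ^ 2 ≤ B) :
    Summable fun α => ‖combine y x α‖ ^ 2 := by
  refine summable_of_sum_le (c := B) (fun _ => by positivity) fun u => ?_
  set N := (u.toRight.image Prod.snd).sup id + 1 with hN
  have hsub : u ⊆ (Finset.univ : Finset V).disjSum
      ((Finset.univ : Finset C) ×ˢ Finset.range N) := by
    rintro (α | ⟨ν, k⟩) hmem
    · simp
    · have hk : k ≤ (u.toRight.image Prod.snd).sup id :=
        Finset.le_sup (f := id) (Finset.mem_image.2 ⟨(ν, k), Finset.mem_toRight.2 hmem, rfl⟩)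
      simp only [Finset.mem_disjSum, Finset.mem_product, Finset.mem_univ, Finset.mem_range, true_and,
        reduceCtorEq, and_false, exists_false, false_or, hN]
      exact ⟨(ν, k), by omega, rfl⟩
  refine (Finset.sum_le_sum_of_subset_of_nonneg hsub fun _ _ _ => by positivity).trans ?_
  rw [Finset.sum_disjSum, Finset.sum_product]
  exact hB N

lemma finsum_interaction_inl (S : WebSystem V C) (y : V → ℂ) (x : C → ℕ → ℂ) (α : V) :
    ∑ᶠ β, (S.interaction (Sum.inl α) β : ℂ) * combine y x β
      = ∑ β, (S.central α β : ℂ) * y β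
        - ∑ ν, (if S.attach ν = α then (S.hop ν 0 : ℂ) * x ν 1 else 0) := by
  rw [finsum_eq_sum_of_support_subset (s := (Finset.univ : Finset V).disjSum
      ((Finset.univ : Finset C) ×ˢ {0}))]
  · rw [Finset.sum_disjSum, Finset.sum_product, sub_eq_add_neg, ← Finset.sum_neg_distrib]
    congr 1
    refine Finset.sum_congr rfl fun ν _ => ?_
    rw [Finset.sum_singleton]
    by_cases h : S.attach ν = α
    · simp [interaction, combine, h]
    · simp [interaction, combine, h, Ne.symm h]
  · rintro (β | ⟨ν, k⟩) hβ
    · simp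
    · by_cases hk : k = 0
      · simp [hk]
      · simp [interaction, hk] at hβ

lemma finsum_interaction_inr (S : WebSystem V C) {y : V → ℂ} {x : C → ℕ → ℂ}
    (hxy : ∀ ν, x ν 0 = y (S.attach ν)) (σ : C) (k : ℕ) :
    ∑ᶠ β, (S.interaction (Sum.inr (σ, k)) β : ℂ) * combine y x β
      = -(S.hop σ k : ℂ) * x σ k + (S.onsite σ (k + 1) : ℂ) * x σ (k + 1)
        - (S.hop σ (k + 1) : ℂ) * x σ (k + 2) := by
  rw [finsum_eq_sum_of_support_subset (s := (Finset.univ : Finset V).disjSum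
      ({σ} ×ˢ ({k - 1, k, k + 1} : Finset ℕ)))]
  · rw [Finset.sum_disjSum, Finset.sum_product, Finset.sum_singleton]
    have hV : ∑ α, ((S.interaction (Sum.inr (σ, k)) (Sum.inl α) : ℝ) : ℂ)
        * combine y x (Sum.inl α) = if k = 0 then -(S.hop σ 0 : ℂ) * x σ 0 else 0 := by
      by_cases hk : k = 0
      · rw [Finset.sum_eq_single (S.attach σ)]
        · simp [interaction, combine, hk, hxy]
        · intro α _ hα
          simp [interaction, hα]
        · simp
      · simp [interaction, hk]
    rw [hV]
    rcases k with _ | k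
    · simp [interaction, combine]
      ring
    · rw [Finset.sum_insert (by simp; omega), Finset.sum_insert (by simp), Finset.sum_singleton]
      have hk : ¬ k = k + 1 + 1 := by omega
      simp [interaction, combine, hk]
      ring
  · rintro (β | ⟨ν, j⟩) hβ
    · simp
    · by_cases hν : σ = ν
      · subst hν
        by_contra hcon
        have h1 : ¬ k = j := fun h => hcon (by simp [h])
        have h2 : ¬ j = k + 1 := fun h => hcon (by simp [h])
        have h3 : ¬ k = j + 1 := fun h => hcon (by simp [h])
        simp [interaction, h1, h2, h3] at hβ
      · simp [interaction, hν] at hβ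

/-- A square summable solution without source vanishes, unless `z` is an eigenvalue. -/
lemma IsForcedSolution.eq_zero {S : WebSystem V C} {z : ℂ} {y : V → ℂ} {x : C → ℕ → ℂ}
    {σ : C} {j : ℕ} (h : S.IsForcedSolution z y x σ j 0) {B : ℝ}
    (hB : ∀ N, ∑ α, ‖y α‖ ^ 2 + ∑ ν, ∑ k ∈ Finset.range N, ‖x ν (k + 1)‖ ^ 2 ≤ B)
    (hz : ¬ S.IsEigenvalue z) (ν : C) (k : ℕ) : x ν k = 0 := by
  have h0 : combine y x = 0 := by
    by_contra hne
    refine hz ⟨combine y x, hne, summable_combine hB, ?_⟩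
    rintro (α | ⟨ν, k⟩)
    · rw [finsum_interaction_inl]
      exact h.central_eq α
    · rw [finsum_interaction_inr S h.attach_eq]
      have := h.channel_eq ν k
      simpa [combine] using this
  rcases k with _ | k
  · rw [h.attach_eq]
    exact congrFun h0 (Sum.inl (S.attach ν))
  · exact congrFun h0 (Sum.inr (ν, k))

/-! ### Orders of poles -/

/-- There is a path in the disk to the centre `ω₀` of the chart along which the coordinate
satisfies `|ζ - ζ₀| ^ m = O(|Im λ|)`. -/
def IsApproachOrder (a b : ℝ) (ω₀ : ℂ) (s : ℂ → ℂ) (ζ₀ : ℂ) (m : ℕ) : Prop :=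
  ∃ p : ℝ → ℂ, Tendsto p (𝓝[>] 0) (𝓝[Metric.ball 0 1] ω₀) ∧
    Tendsto (fun t => s (p t)) (𝓝[>] 0) (𝓝[≠] ζ₀) ∧ (∀ᶠ t in 𝓝[>] 0, (p t).im ≠ 0) ∧
    ∃ K : ℝ, ∀ᶠ t in 𝓝[>] 0, ‖s (p t) - ζ₀‖ ^ m ≤ K * |(zhukovskii a b (p t)).im|

variable {S : WebSystem V C} {aInf bInf : C → ℝ} {a b : ℝ} {r : C → ℝ} {F : C → ℕ → ℂ → ℂ}
  {ω₀ ζ₀ : ℂ} {s Λ : ℂ → ℂ} {Θ : C → ℂ → ℂ}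

/-- Along the path, the columns of the resolvent are `O(|ζ - ζ₀|⁻ᵐ)` in the norm of `ℓ²`. -/
lemma IsLocalModel.exists_path_bound (hm : IsLocalModel aInf bInf a b ω₀ s ζ₀ Λ Θ)
    (h : S.IsScattering aInf bInf a b r F) {m : ℕ} (hp : IsApproachOrder a b ω₀ s ζ₀ m) (σ : C)
    (k₀ : ℕ) : ∃ j, k₀ ≤ j ∧ ∃ q : ℝ → ℂ, Tendsto q (𝓝[>] 0) (𝓝[≠] ζ₀) ∧ ∃ K : ℝ, 0 ≤ K ∧
      ∀ᶠ t in 𝓝[>] 0,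
        S.IsForcedSolution (Λ (q t)) (S.chartCentral bInf F Λ Θ σ j (q t))
          (S.chartColumn bInf F Λ Θ σ j (q t)) σ j (chartSource bInf F Θ σ j (q t)) ∧
        ‖chartSource bInf F Θ σ j (q t)‖ ≤ K ∧
        ∀ N, ∑ α, ‖(q t - ζ₀) ^ m * S.chartCentral bInf F Λ Θ σ j (q t) α‖ ^ 2
          + ∑ ν, ∑ k ∈ Finset.range N,
            ‖(q t - ζ₀) ^ m * S.chartColumn bInf F Λ Θ σ j (q t) ν (k + 1)‖ ^ 2 ≤ K ^ 2 := by
  obtain ⟨j, hj, K, hK⟩ := hm.exists_bound h σ k₀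
  obtain ⟨p, hp1, hp2, hp3, K', hK'⟩ := hp
  refine ⟨j, hj, fun t => s (p t), hp2, max K (|K' * K|), (abs_nonneg _).trans (le_max_right _ _),
    ?_⟩
  filter_upwards [hp1.eventually hK, hp3, hK'] with t h1 h2 h3
  obtain ⟨e1, e2, e3⟩ := h1 h2
  rw [hm.spectral_eq]
  refine ⟨e1, e2.trans (le_max_left _ _), fun N => ?_⟩
  set I := |(zhukovskii a b (p t)).im| with hI
  have hnn : 0 ≤ I := abs_nonneg _
  have e4 : ‖s (p t) - ζ₀‖ ^ m * (K / I) ≤ |K' * K| := by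
    have hK0 : 0 ≤ K := (norm_nonneg _).trans e2
    rcases hnn.eq_or_lt with hz | hpos
    · rw [← hz, div_zero, mul_zero]; exact abs_nonneg _
    · calc ‖s (p t) - ζ₀‖ ^ m * (K / I) ≤ (K' * I) * (K / I) := by gcongr
        _ = K' * K := by field_simp
        _ ≤ _ := le_abs_self _
  have e5 : 0 ≤ ‖s (p t) - ζ₀‖ ^ m * (K / I) := by
    have hK0 : 0 ≤ K := (norm_nonneg _).trans e2
    positivity
  simp only [norm_mul, norm_pow, mul_pow, ← Finset.mul_sum, ← mul_add]
  calc (‖s (p t) - ζ₀‖ ^ m) ^ 2 * _ ≤ (‖s (p t) - ζ₀‖ ^ m) ^ 2 * (K / I) ^ 2 := by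
        gcongr
        exact e3 N
    _ = (‖s (p t) - ζ₀‖ ^ m * (K / I)) ^ 2 := by ring
    _ ≤ (max K |K' * K|) ^ 2 := by
        gcongr
        exact e4.trans (le_max_right _ _)

lemma norm_le_of_sum_sq_le {y : V → ℂ} {x : C → ℕ → ℂ} {K : ℝ} (hK : 0 ≤ K)
    (h : ∀ N, ∑ α, ‖y α‖ ^ 2 + ∑ ν, ∑ k ∈ Finset.range N, ‖x ν (k + 1)‖ ^ 2 ≤ K ^ 2) :
    (∀ α, ‖y α‖ ≤ K) ∧ ∀ ν k, ‖x ν (k + 1)‖ ≤ K := by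
  refine ⟨fun α => ?_, fun ν k => ?_⟩
  · refine abs_le_of_sq_le_sq' ?_ hK |>.2
    refine le_trans ?_ (h 0)
    simp only [Finset.range_zero, Finset.sum_empty, Finset.sum_const_zero, add_zero]
    exact Finset.single_le_sum (f := fun α => ‖y α‖ ^ 2) (fun _ _ => by positivity)
      (Finset.mem_univ α)
  · refine abs_le_of_sq_le_sq' ?_ hK |>.2
    refine le_trans ?_ (h (k + 1))
    have h1 : ‖x ν (k + 1)‖ ^ 2 ≤ ∑ l ∈ Finset.range (k + 1), ‖x ν (l + 1)‖ ^ 2 :=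
      Finset.single_le_sum (f := fun l => ‖x ν (l + 1)‖ ^ 2) (fun _ _ => by positivity)
        (Finset.mem_range.2 (Nat.lt_succ_self k))
    have h2 : ∑ l ∈ Finset.range (k + 1), ‖x ν (l + 1)‖ ^ 2
        ≤ ∑ ν, ∑ l ∈ Finset.range (k + 1), ‖x ν (l + 1)‖ ^ 2 :=
      Finset.single_le_sum (f := fun ν => ∑ l ∈ Finset.range (k + 1), ‖x ν (l + 1)‖ ^ 2)
        (fun _ _ => by positivity) (Finset.mem_univ ν)
    have h3 : 0 ≤ ∑ α, ‖y α‖ ^ 2 := by positivity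
    linarith

/-- The order of the poles of `U` in a chart is bounded by the approach order. -/
lemma IsLocalModel.exists_chartU_eq (hm : IsLocalModel aInf bInf a b ω₀ s ζ₀ Λ Θ)
    (h : S.IsScattering aInf bInf a b r F) {m : ℕ} (hp : IsApproachOrder a b ω₀ s ζ₀ m)
    (k : ℕ) (ν σ : C) : ∃ G : ℂ → ℂ, AnalyticAt ℂ G ζ₀ ∧
      ∀ᶠ ζ in 𝓝[≠] ζ₀, S.chartU bInf F Λ Θ k ζ ν σ = ((ζ - ζ₀) ^ m)⁻¹ * G ζ := by
  obtain ⟨j, hj, q, hq, K, hK0, hK⟩ := hm.exists_path_bound h hp σ k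
  refine (hm.matMeromorphicAt_chartU h k ν σ).exists_eq_inv_pow_mul m hq (K := K) ?_
  filter_upwards [hK] with t ⟨h1, _, h3⟩
  obtain ⟨b1, b2⟩ := norm_le_of_sum_sq_le (x := fun ν k =>
    (q t - ζ₀) ^ m * S.chartColumn bInf F Λ Θ σ j (q t) ν k) hK0 h3
  have hcol : S.chartU bInf F Λ Θ k (q t) ν σ = S.chartColumn bInf F Λ Θ σ j (q t) ν k := by
    rw [chartColumn, cutColumn, if_neg (by omega)]
    rfl
  rw [hcol, ← norm_pow, ← norm_mul]
  rcases k with _ | k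
  · rw [h1.attach_eq]
    exact b1 _
  · exact b2 ν k

/-- If the spectral parameter at the centre of the chart is not an eigenvalue, the order of the
poles is smaller than the approach order: the leading Laurent coefficients of a column of the
resolvent form a square summable eigenfunction. -/
lemma IsLocalModel.exists_chartU_eq_of_not_isEigenvalue
    (hm : IsLocalModel aInf bInf a b ω₀ s ζ₀ Λ Θ) (h : S.IsScattering aInf bInf a b r F) {m : ℕ}
    (hp : IsApproachOrder a b ω₀ s ζ₀ (m + 1)) (hz : ¬ S.IsEigenvalue (Λ ζ₀)) (k : ℕ) (ν σ : C) :
    ∃ G : ℂ → ℂ, AnalyticAt ℂ G ζ₀ ∧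
      ∀ᶠ ζ in 𝓝[≠] ζ₀, S.chartU bInf F Λ Θ k ζ ν σ = ((ζ - ζ₀) ^ m)⁻¹ * G ζ := by
  obtain ⟨j, hj, q, hq, K, hK0, hK⟩ := hm.exists_path_bound h hp σ k
  have hbounds : ∀ᶠ t in 𝓝[>] (0 : ℝ),
      (∀ α, ‖q t - ζ₀‖ ^ (m + 1) * ‖S.chartCentral bInf F Λ Θ σ j (q t) α‖ ≤ K) ∧
      ∀ ν k, ‖q t - ζ₀‖ ^ (m + 1) * ‖S.chartColumn bInf F Λ Θ σ j (q t) ν k‖ ≤ K := by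
    filter_upwards [hK] with t ⟨h1, _, h3⟩
    obtain ⟨b1, b2⟩ := norm_le_of_sum_sq_le (x := fun ν k =>
      (q t - ζ₀) ^ (m + 1) * S.chartColumn bInf F Λ Θ σ j (q t) ν k) hK0 h3
    simp only [norm_mul, norm_pow] at b1 b2
    refine ⟨b1, fun ν k => ?_⟩
    rcases k with _ | k
    · rw [h1.attach_eq]
      exact b1 _
    · exact b2 ν k
  choose Y hYa hYe using fun α => (hm.meromorphicAt_chartCentral h σ j α).exists_eq_inv_pow_mul
    (m + 1) hq (K := K) (hbounds.mono fun t ht => ht.1 α)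
  choose X hXa hXe using fun ν k => (hm.meromorphicAt_chartColumn h σ j ν k).exists_eq_inv_pow_mul
    (m + 1) hq (K := K) (hbounds.mono fun t ht => ht.2 ν k)
  have hq' : Tendsto q (𝓝[>] 0) (𝓝 ζ₀) := hq.mono_right nhdsWithin_le_nhds
  set w : ℝ → ℂ := fun t => (q t - ζ₀) ^ (m + 1) with hw
  have hwlim : Tendsto w (𝓝[>] 0) (𝓝 0) := by
    have := (hq'.sub_const ζ₀).pow (m + 1)
    simpa using this
  have hcancel : ∀ (f G : ℂ → ℂ), AnalyticAt ℂ G ζ₀ →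
      (∀ᶠ ζ in 𝓝[≠] ζ₀, f ζ = ((ζ - ζ₀) ^ (m + 1))⁻¹ * G ζ) →
      Tendsto (fun t => w t * f (q t)) (𝓝[>] 0) (𝓝 (G ζ₀)) := fun f G hG hf => by
    refine (hG.continuousAt.tendsto.comp hq').congr' ?_
    filter_upwards [hq.eventually hf, hq.eventually self_mem_nhdsWithin] with t ht hne
    have : (q t - ζ₀) ^ (m + 1) ≠ 0 := pow_ne_zero _ (sub_ne_zero.2 hne)
    rw [ht]
    simp only [hw, Function.comp]
    field_simp
  have hYlim := fun α => hcancel _ _ (hYa α) (hYe α)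
  have hXlim := fun ν k => hcancel _ _ (hXa ν k) (hXe ν k)
  have hΛlim : Tendsto (fun t => Λ (q t)) (𝓝[>] 0) (𝓝 (Λ ζ₀)) :=
    hm.analyticAt_spectral.continuousAt.tendsto.comp hq'
  have hclim : Tendsto (fun t => w t * chartSource bInf F Θ σ j (q t)) (𝓝[>] 0) (𝓝 0) := by
    refine squeeze_zero_norm' ?_ (by simpa using hwlim.norm.mul_const K :
      Tendsto (fun t => ‖w t‖ * K) (𝓝[>] 0) (𝓝 0))
    filter_upwards [hK] with t ht
    rw [norm_mul]
    exact mul_le_mul_of_nonneg_left ht.2.1 (norm_nonneg _)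
  have hforced : S.IsForcedSolution (Λ ζ₀) (fun α => Y α ζ₀) (fun ν k => X ν k ζ₀) σ j 0 := by
    refine ⟨fun ν => ?_, fun α => ?_, fun ν k => ?_⟩
    · refine tendsto_nhds_unique (hXlim ν 0) ((hYlim (S.attach ν)).congr' ?_)
      filter_upwards [hK] with t ht
      rw [ht.1.attach_eq]
    · have hl : Tendsto (fun t => ∑ β, (S.central α β : ℂ)
          * (w t * S.chartCentral bInf F Λ Θ σ j (q t) β) - ∑ ν, (if S.attach ν = α then
          (S.hop ν 0 : ℂ) * (w t * S.chartColumn bInf F Λ Θ σ j (q t) ν 1) else 0)) (𝓝[>] 0)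
          (𝓝 (∑ β, (S.central α β : ℂ) * Y β ζ₀
            - ∑ ν, (if S.attach ν = α then (S.hop ν 0 : ℂ) * X ν 1 ζ₀ else 0))) := by
        refine (tendsto_finsetSum _ fun β _ => (hYlim β).const_mul _).sub
          (tendsto_finsetSum _ fun ν _ => ?_)
        split_ifs
        · exact (hXlim ν 1).const_mul _
        · exact tendsto_const_nhds
      refine tendsto_nhds_unique hl ((hΛlim.mul (hYlim α)).congr' ?_)
      filter_upwards [hK] with t ht
      have e := ht.1.central_eq α
      have e1 : ∑ β, (S.central α β : ℂ) * (w t * S.chartCentral bInf F Λ Θ σ j (q t) β)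
          = w t * ∑ β, (S.central α β : ℂ) * S.chartCentral bInf F Λ Θ σ j (q t) β := by
        rw [Finset.mul_sum]
        exact Finset.sum_congr rfl fun _ _ => by ring
      have e2 : ∑ ν, (if S.attach ν = α then
          (S.hop ν 0 : ℂ) * (w t * S.chartColumn bInf F Λ Θ σ j (q t) ν 1) else 0)
          = w t * ∑ ν, (if S.attach ν = α then
          (S.hop ν 0 : ℂ) * S.chartColumn bInf F Λ Θ σ j (q t) ν 1 else 0) := by
        rw [Finset.mul_sum]
        refine Finset.sum_congr rfl fun _ _ => ?_
        split_ifs <;> ring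
      rw [e1, e2]
      linear_combination -w t * e
    · have hl := (((hXlim ν k).const_mul (-(S.hop ν k : ℂ))).add
        ((hXlim ν (k + 1)).const_mul (S.onsite ν (k + 1) : ℂ))).sub
        ((hXlim ν (k + 2)).const_mul (S.hop ν (k + 1) : ℂ))
      have hr : Tendsto (fun t => Λ (q t) * (w t * S.chartColumn bInf F Λ Θ σ j (q t) ν (k + 1))
          + if ν = σ ∧ k = j then w t * chartSource bInf F Θ σ j (q t) else 0) (𝓝[>] 0)
          (𝓝 (Λ ζ₀ * X ν (k + 1) ζ₀ + if ν = σ ∧ k = j then 0 else 0)) := by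
        refine (hΛlim.mul (hXlim ν (k + 1))).add ?_
        split_ifs
        · exact hclim
        · exact tendsto_const_nhds
      refine tendsto_nhds_unique hl (hr.congr' ?_)
      filter_upwards [hK] with t ht
      have e := ht.1.channel_eq ν k
      split_ifs at e ⊢ <;> linear_combination -w t * e
  have hB : ∀ N, ∑ α, ‖Y α ζ₀‖ ^ 2 + ∑ ν, ∑ k ∈ Finset.range N, ‖X ν (k + 1) ζ₀‖ ^ 2 ≤ K ^ 2 :=
    fun N => by
      refine le_of_tendsto ((tendsto_finsetSum _ fun α _ => (hYlim α).norm.pow 2).add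
        (tendsto_finsetSum _ fun ν _ => tendsto_finsetSum _ fun k _ =>
          (hXlim ν (k + 1)).norm.pow 2)) (hK.mono fun t ht => ht.2.2 N)
  have hX0 : X ν k ζ₀ = 0 := hforced.eq_zero hB hz ν k
  obtain ⟨H, hH, hXH⟩ := (hXa ν k).exists_eq_sub_mul hX0
  refine ⟨H, hH, ?_⟩
  filter_upwards [hXe ν k, self_mem_nhdsWithin] with ζ hζ hne
  have hcol : S.chartU bInf F Λ Θ k ζ ν σ = S.chartColumn bInf F Λ Θ σ j ζ ν k := by
    rw [chartColumn, cutColumn, if_neg (by omega)]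
    rfl
  have hne' : ζ - ζ₀ ≠ 0 := sub_ne_zero.2 hne
  rw [hcol, hζ, hXH]
  field_simp
  ring

end WebSystem

/-! ### Approach orders and charts at the points of the closed disk -/

namespace WebSystem

lemma tendsto_path {p : ℝ → ℂ} (hp : Continuous p) {ω₀ : ℂ} (h0 : p 0 = ω₀)
    (h1 : ∀ᶠ t in 𝓝[>] (0 : ℝ), ‖p t‖ < 1) :
    Tendsto p (𝓝[>] 0) (𝓝[Metric.ball 0 1] ω₀) := by
  refine tendsto_nhdsWithin_iff.2 ⟨?_, h1.mono fun t ht => by simpa using ht⟩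
  have := hp.tendsto 0
  rw [h0] at this
  exact this.mono_left nhdsWithin_le_nhds

/-- At a non-real point of the open disk `λ` is not real; any path does. -/
lemma isApproachOrder_zero {a b : ℝ} (hb : 0 < b) {ω₀ : ℂ} (h1 : ‖ω₀‖ < 1) (him : ω₀.im ≠ 0) :
    IsApproachOrder a b ω₀ id ω₀ 0 := by
  have h0 : ω₀ ≠ 0 := fun h => him (by simp [h])
  have hc : Continuous fun t : ℝ => ω₀ + t := by fun_prop
  have hnhds : Tendsto (fun t : ℝ => ω₀ + t) (𝓝[>] 0) (𝓝 ω₀) := by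
    have := hc.tendsto 0
    simp only [Complex.ofReal_zero, add_zero] at this
    exact this.mono_left nhdsWithin_le_nhds
  have ht := tendsto_path hc (ω₀ := ω₀) (by simp)
    (hnhds.norm.eventually (gt_mem_nhds h1))
  refine ⟨_, ht, ?_, by simp [him], |(zhukovskii a b ω₀).im|⁻¹ * 2, ?_⟩
  · refine tendsto_nhdsWithin_iff.2 ⟨hnhds, ?_⟩
    filter_upwards [self_mem_nhdsWithin] with t ht
    have : (t : ℂ) ≠ 0 := by exact_mod_cast (ne_of_gt ht)
    simpa using this
  · have hz : 0 < |(zhukovskii a b ω₀).im| := abs_pos.2 (zhukovskii_im_ne_zero hb h1 him)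
    have hlim : Tendsto (fun t : ℝ => |(zhukovskii a b (ω₀ + t)).im|) (𝓝[>] 0)
        (𝓝 |(zhukovskii a b ω₀).im|) :=
      ((Complex.continuous_im.continuousAt.tendsto.comp
        ((analyticAt_zhukovskii a b h0).continuousAt.tendsto.comp hnhds))).abs
    filter_upwards [hlim.eventually (lt_mem_nhds (half_lt_self hz))] with t ht
    rw [pow_zero, mul_assoc, ← div_eq_inv_mul, le_div_iff₀ hz]
    linarith

/-- The path is vertical, `x + i t`. -/
lemma isApproachOrder_one_of_real {a b : ℝ} (hb : 0 < b) {x : ℝ} (h0 : x ≠ 0) (h1 : |x| < 1) :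
    IsApproachOrder a b x id x 1 := by
  have hc : Continuous fun t : ℝ => (x : ℂ) + t * Complex.I := by fun_prop
  have hnhds : Tendsto (fun t : ℝ => (x : ℂ) + t * Complex.I) (𝓝[>] 0) (𝓝 x) := by
    have := hc.tendsto 0
    simp only [Complex.ofReal_zero, add_zero, zero_mul] at this
    exact this.mono_left nhdsWithin_le_nhds
  have hx1 : ‖(x : ℂ)‖ < 1 := by simpa using h1
  have ht := tendsto_path hc (ω₀ := x) (by simp) (hnhds.norm.eventually (gt_mem_nhds hx1))
  have hne : ∀ᶠ t in 𝓝[>] (0 : ℝ), t ≠ 0 := by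
    filter_upwards [self_mem_nhdsWithin] with t ht using ne_of_gt ht
  refine ⟨_, ht, tendsto_nhdsWithin_iff.2 ⟨hnhds, ?_⟩, ?_, ?_⟩
  · filter_upwards [hne] with t ht
    simpa using ht
  · filter_upwards [hne] with t ht
    simpa using ht
  · have hx2 : 0 < x ^ 2 := by positivity
    have hx3 : x ^ 2 < 1 := by rw [← sq_abs]; nlinarith [abs_nonneg x]
    have hκ : 0 < (x ^ 2)⁻¹ - 1 := by linarith [(one_lt_inv₀ hx2).2 hx3]
    have hlim : Tendsto (fun t : ℝ => (x ^ 2 + t ^ 2)⁻¹ - 1) (𝓝[>] 0) (𝓝 ((x ^ 2)⁻¹ - 1)) := by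
      have : ContinuousAt (fun t : ℝ => (x ^ 2 + t ^ 2)⁻¹ - 1) 0 := by
        have h : x ^ 2 + (0 : ℝ) ^ 2 ≠ 0 := by positivity
        fun_prop (disch := exact h)
      have ht := this.tendsto
      simp only [ne_eq, OfNat.ofNat_ne_zero, not_false_eq_true, zero_pow, add_zero] at ht
      exact ht.mono_left nhdsWithin_le_nhds
    refine ⟨2 / (b * ((x ^ 2)⁻¹ - 1)), ?_⟩
    filter_upwards [hlim.eventually (lt_mem_nhds (half_lt_self hκ)), self_mem_nhdsWithin]
      with t ht htpos
    have htpos : 0 < t := htpos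
    have e1 : (zhukovskii a b ((x : ℂ) + t * Complex.I)).im = b * t * ((x ^ 2 + t ^ 2)⁻¹ - 1) := by
      rw [zhukovskii_im, Complex.normSq_apply]
      simp [sq]
    have e2 : ‖(id ((x : ℂ) + t * Complex.I) - x)‖ = t := by
      simp [abs_of_pos htpos]
    rw [e1, e2, pow_one, abs_of_nonneg (by
      have : 0 < (x ^ 2 + t ^ 2)⁻¹ - 1 := by linarith
      positivity), div_mul_eq_mul_div, le_div_iff₀ (by positivity)]
    have : 0 < b * t := by positivity
    nlinarith

/-- On the radius through a non-real point of the unit circle, `|Im λ|` is bounded below by a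
multiple of the distance to the circle. -/
lemma exists_radial_bound {a b : ℝ} (hb : 0 < b) {ω₀ : ℂ} (h1 : ‖ω₀‖ = 1) (him : ω₀.im ≠ 0) :
    Tendsto (fun t : ℝ => ω₀ * (1 - t)) (𝓝[>] 0) (𝓝[Metric.ball 0 1] ω₀) ∧
      (∀ᶠ t : ℝ in 𝓝[>] 0, (ω₀ * (1 - t)).im ≠ 0) ∧
      ∃ K : ℝ, ∀ᶠ t : ℝ in 𝓝[>] 0, t ≤ K * |(zhukovskii a b (ω₀ * (1 - t))).im| := by
  have hsmall : ∀ᶠ t in 𝓝[>] (0 : ℝ), 0 < t ∧ t < 1 / 2 :=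
    Ioo_mem_nhdsGT (by norm_num : (0 : ℝ) < 1 / 2)
  have hcast : ∀ t : ℝ, ω₀ * (1 - t) = ω₀ * ((1 - t : ℝ) : ℂ) := fun t => by push_cast; rfl
  have himt : ∀ t : ℝ, (ω₀ * (1 - t)).im = ω₀.im * (1 - t) := fun t => by
    rw [hcast, Complex.im_mul_ofReal]
  refine ⟨tendsto_path (by fun_prop) (by simp) ?_, ?_, (b * |ω₀.im|)⁻¹, ?_⟩
  · filter_upwards [hsmall] with t ht
    rw [hcast, norm_mul, h1, one_mul, Complex.norm_real, Real.norm_eq_abs, abs_lt]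
    constructor <;> linarith
  · filter_upwards [hsmall] with t ht
    rw [himt]
    exact mul_ne_zero him (by linarith)
  · filter_upwards [hsmall] with t ht
    have hn : Complex.normSq (ω₀ * (1 - t)) = (1 - t) ^ 2 := by
      rw [hcast, Complex.normSq_eq_norm_sq, norm_mul, h1, one_mul, Complex.norm_real,
        Real.norm_eq_abs, sq_abs]
    have h1t : 0 < 1 - t := by linarith
    rw [zhukovskii_im, himt, hn]
    have e : b * (ω₀.im * (1 - t)) * (((1 - t) ^ 2)⁻¹ - 1) = b * ω₀.im * (t * (2 - t) / (1 - t)) := by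
      field_simp
      ring
    have hpos : 0 ≤ t * (2 - t) / (1 - t) := by
      have : 0 < t * (2 - t) := by nlinarith
      positivity
    rw [e, abs_mul, abs_mul, abs_of_pos hb, abs_of_nonneg hpos]
    have hi : 0 < b * |ω₀.im| := by have := abs_pos.2 him; positivity
    rw [← mul_assoc, inv_mul_cancel₀ hi.ne', one_mul, le_div_iff₀ h1t]
    nlinarith

/-- The path is radial, `(1 - t) ω₀`. -/
lemma isApproachOrder_one_of_circle {a b : ℝ} (hb : 0 < b) {ω₀ : ℂ} (h1 : ‖ω₀‖ = 1)
    (him : ω₀.im ≠ 0) : IsApproachOrder a b ω₀ id ω₀ 1 := by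
  obtain ⟨hp1, hp2, K, hK⟩ := exists_radial_bound (a := a) hb h1 him
  have h0 : ω₀ ≠ 0 := fun h => him (by simp [h])
  refine ⟨_, hp1, tendsto_nhdsWithin_iff.2 ⟨hp1.mono_right nhdsWithin_le_nhds, ?_⟩, hp2, K, ?_⟩
  · filter_upwards [self_mem_nhdsWithin] with t ht
    have htc : (t : ℂ) ≠ 0 := by exact_mod_cast (ne_of_gt ht)
    intro h
    have h : ω₀ * (1 - t) = ω₀ := h
    exact mul_ne_zero h0 htc (by linear_combination -h)
  · filter_upwards [hK, self_mem_nhdsWithin] with t ht htpos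
    have e : ‖id (ω₀ * (1 - t)) - ω₀‖ = t := by
      rw [id, show ω₀ * (1 - t) - ω₀ = -(ω₀ * t) by ring, norm_neg, norm_mul, h1, one_mul,
        Complex.norm_real, Real.norm_eq_abs, abs_of_pos htpos]
    rw [e, pow_one]
    exact ht

/-- On the radial path `(1 - t) ω₀` the coordinate is the square root of `t`. -/
lemma isApproachOrder_two_of_sqrtChart {a b : ℝ} (hb : 0 < b) {ω₀ : ℂ} (h1 : ‖ω₀‖ = 1)
    (him : ω₀.im ≠ 0) : IsApproachOrder a b ω₀ (sqrtChart ω₀) 0 2 := by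
  obtain ⟨hp1, hp2, K, hK⟩ := exists_radial_bound (a := a) hb h1 him
  have h0 : ω₀ ≠ 0 := fun h => him (by simp [h])
  have hchart := isDiskChart_sqrtChart a b h1
  have hsq : ∀ t : ℝ, sqrtChart ω₀ (ω₀ * (1 - t)) ^ 2 = t := fun t => by
    rw [sqrtChart_sq]
    field_simp
    ring
  refine ⟨_, hp1, tendsto_nhdsWithin_iff.2 ⟨?_, ?_⟩, hp2, K, ?_⟩
  · exact hchart.tendsto.comp (hp1.mono_right (nhdsWithin_mono _ Metric.ball_subset_closedBall))
  · filter_upwards [self_mem_nhdsWithin] with t ht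
    have htc : (t : ℂ) ≠ 0 := by exact_mod_cast (ne_of_gt ht)
    intro h
    have h : sqrtChart ω₀ (ω₀ * (1 - t)) = 0 := h
    have := hsq t
    rw [h] at this
    exact htc (by simpa using this.symm)
  · filter_upwards [hK, self_mem_nhdsWithin] with t ht htpos
    rw [sub_zero, ← norm_pow, hsq, Complex.norm_real, Real.norm_eq_abs, abs_of_pos htpos]
    exact ht

/-- At `η = ±1` the path `η (1 - t) + i t` leaves the real axis, on which `λ` is real, and is not
tangent to the circle, so that `|Im λ|` is comparable to `t ^ 2`. -/
lemma isApproachOrder_two_of_threshold {a b : ℝ} (hb : 0 < b) {ω₀ : ℂ} (h : ω₀ = 1 ∨ ω₀ = -1) :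
    IsApproachOrder a b ω₀ id ω₀ 2 := by
  obtain ⟨η, hη, hηω⟩ : ∃ η : ℝ, η ^ 2 = 1 ∧ ω₀ = η := by
    rcases h with h | h
    · exact ⟨1, by norm_num, by simp [h]⟩
    · exact ⟨-1, by norm_num, by simp [h]⟩
  have habs : |η| = 1 := by
    have := sq_abs η
    rw [hη] at this
    nlinarith [abs_nonneg η]
  set p : ℝ → ℂ := fun t => ⟨η * (1 - t), t⟩ with hp
  have hpc : Continuous p := by
    have : p = fun t : ℝ => ((η * (1 - t) : ℝ) : ℂ) + t * Complex.I := by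
      funext t
      apply Complex.ext <;> simp [hp]
    rw [this]
    fun_prop
  have hn : ∀ t, Complex.normSq (p t) = 1 - 2 * t + 2 * t ^ 2 := fun t => by
    simp only [hp, Complex.normSq_mk]
    linear_combination (1 - t) ^ 2 * hη
  have hsub : ∀ t, ‖p t - ω₀‖ ^ 2 = 2 * t ^ 2 := fun t => by
    rw [← Complex.normSq_eq_norm_sq, hηω, Complex.normSq_apply]
    simp only [hp, Complex.sub_re, Complex.sub_im, Complex.ofReal_re, Complex.ofReal_im]
    linear_combination t ^ 2 * hη
  have hsmall : ∀ᶠ t in 𝓝[>] (0 : ℝ), 0 < t ∧ t < 1 / 2 :=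
    Ioo_mem_nhdsGT (by norm_num : (0 : ℝ) < 1 / 2)
  have hp0 : p 0 = ω₀ := by
    rw [hηω]
    apply Complex.ext <;> simp [hp]
  have hp1 : Tendsto p (𝓝[>] 0) (𝓝[Metric.ball 0 1] ω₀) := by
    refine tendsto_path hpc hp0 ?_
    filter_upwards [hsmall] with t ht
    have := hn t
    rw [Complex.normSq_eq_norm_sq] at this
    nlinarith [norm_nonneg (p t)]
  refine ⟨p, hp1, tendsto_nhdsWithin_iff.2 ⟨hp1.mono_right nhdsWithin_le_nhds, ?_⟩, ?_, 2 / b, ?_⟩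
  · filter_upwards [hsmall] with t ht hmem
    have := hsub t
    rw [show p t = ω₀ from hmem, sub_self, norm_zero] at this
    nlinarith
  · filter_upwards [hsmall] with t ht
    simp only [hp]
    exact ht.1.ne'
  · filter_upwards [hsmall] with t ht
    rw [id, hsub, zhukovskii_im, hn]
    have him : (p t).im = t := rfl
    have hpos : 0 < 1 - 2 * t + 2 * t ^ 2 := by nlinarith
    have hinv : t ≤ (1 - 2 * t + 2 * t ^ 2)⁻¹ - 1 := by
      rw [le_sub_iff_add_le, le_inv_comm₀ (by linarith) hpos, inv_eq_one_div,
        le_div_iff₀ (by linarith)]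
      nlinarith
    rw [him, abs_of_nonneg (by have := ht.1; have := ht.1.le.trans hinv; positivity)]
    have : b * t * t ≤ b * t * ((1 - 2 * t + 2 * t ^ 2)⁻¹ - 1) := by
      have := ht.1
      gcongr
    calc 2 * t ^ 2 = 2 / b * (b * t * t) := by field_simp
      _ ≤ _ := by gcongr

variable {V C : Type*} [Fintype V] [DecidableEq V] [Fintype C] [DecidableEq C]
  {S : WebSystem V C} {aInf bInf : C → ℝ} {a b : ℝ} {r : C → ℝ} {F : C → ℕ → ℂ → ℂ}
  {ω₀ ζ₀ : ℂ} {s Λ : ℂ → ℂ}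

lemma IsScattering.exists_isLocalModel (h : S.IsScattering aInf bInf a b r F)
    (hs : IsDiskChart a b ω₀ s ζ₀ Λ) (h0 : ω₀ ≠ 0) (h1 : ‖ω₀‖ ≤ 1)
    (hΛ : ∀ σ, (Λ ζ₀ ≠ ((aInf σ - 2 * bInf σ : ℝ) : ℂ) ∧ Λ ζ₀ ≠ ((aInf σ + 2 * bInf σ : ℝ) : ℂ)) ∨
      ∃ v : ℂ → ℂ, AnalyticAt ℂ v ζ₀ ∧ v ζ₀ ≠ 0 ∧
        ∀ᶠ ζ in 𝓝 ζ₀, Λ ζ = Λ ζ₀ + (ζ - ζ₀) ^ 2 * v ζ) :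
    ∃ Θ, IsLocalModel aInf bInf a b ω₀ s ζ₀ Λ Θ := by
  choose Θ h2 h3 h4 h5 using fun σ =>
    hs.exists_channelParam_eq (h.jost σ).b_pos h.b_pos (h.subset σ) h0 h1 (hΛ σ)
  exact ⟨Θ, hs, h0, h1, h2, h3, h4, h5⟩

/-- At a point which is not a branch point, `ω` itself is a suitable coordinate. At `ω₀ = ±1` this
is so because `λ` attains its value to second order there. -/
lemma IsScattering.exists_isLocalModel_id (h : S.IsScattering aInf bInf a b r F)
    (h0 : ω₀ ≠ 0) (h1 : ‖ω₀‖ ≤ 1) (hbr : ¬ IsBranchPoint aInf bInf a b ω₀) :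
    ∃ Θ, IsLocalModel aInf bInf a b ω₀ id ω₀ (zhukovskii a b) Θ := by
  refine h.exists_isLocalModel (isDiskChart_id a b h0) h0 h1 fun σ => ?_
  have hbσ := (h.jost σ).b_pos
  by_cases hth : ω₀ = 1 ∨ ω₀ = -1
  · right
    have hsq : ω₀ ^ 2 = 1 := by rcases hth with h | h <;> simp [h]
    have hb : (b : ℂ) ≠ 0 := by exact_mod_cast h.b_pos.ne'
    refine ⟨fun ω => -b / ω, analyticAt_const.div analyticAt_id h0,
      div_ne_zero (neg_ne_zero.2 hb) h0, ?_⟩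
    filter_upwards [isOpen_ne.mem_nhds h0] with ω hω
    have hω : ω ≠ 0 := hω
    have hinv : ω₀⁻¹ = ω₀ := inv_eq_of_mul_eq_one_right (by rw [← sq, hsq])
    simp only [zhukovskii, hinv]
    field_simp
    linear_combination b * hsq
  · left
    push Not at hth
    rcases h1.lt_or_eq with hlt | heq
    · exact ⟨zhukovskii_ne_of_mem_ball h.b_pos (h.subset σ) h0 hlt _ ⟨le_rfl, by linarith⟩,
        zhukovskii_ne_of_mem_ball h.b_pos (h.subset σ) h0 hlt _ ⟨by linarith, le_rfl⟩⟩
    · constructor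
      · exact fun he => hbr ⟨heq, hth.1, hth.2, σ, Or.inl he⟩
      · exact fun he => hbr ⟨heq, hth.1, hth.2, σ, Or.inr he⟩

lemma im_ne_zero_of_norm_eq_one (h1 : ‖ω₀‖ = 1) (hp : ω₀ ≠ 1) (hn : ω₀ ≠ -1) : ω₀.im ≠ 0 := by
  intro him
  have hsq : ω₀.re * ω₀.re = 1 := by
    have := norm_sq_eq_re_im ω₀
    rw [h1, him] at this
    linarith
  rcases mul_self_eq_one_iff.1 hsq with h | h
  · exact hp (Complex.ext (by simpa using h) (by simpa using him))
  · exact hn (Complex.ext (by simpa using h) (by simpa using him))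

/-- In the square root coordinate `λ` attains its value at the centre to second order. -/
lemma IsScattering.exists_isLocalModel_sqrtChart (h : S.IsScattering aInf bInf a b r F)
    (h1 : ‖ω₀‖ = 1) (him : ω₀.im ≠ 0) :
    ∃ Θ, IsLocalModel aInf bInf a b ω₀ (sqrtChart ω₀) 0
      (fun ζ => zhukovskii a b (ω₀ * (1 - ζ ^ 2))) Θ := by
  have h0 : ω₀ ≠ 0 := fun h => him (by simp [h])
  refine h.exists_isLocalModel (isDiskChart_sqrtChart a b h1) h0 h1.le fun σ => Or.inr ?_
  have hb : (b : ℂ) ≠ 0 := by exact_mod_cast h.b_pos.ne'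
  refine ⟨fun ζ => b * ω₀ * (1 - (ω₀ ^ 2 * (1 - ζ ^ 2))⁻¹), ?_, ?_, ?_⟩
  · have hd : AnalyticAt ℂ (fun ζ : ℂ => ω₀ ^ 2 * (1 - ζ ^ 2)) 0 := by fun_prop
    exact analyticAt_const.mul (analyticAt_const.sub (hd.inv (by simpa using h0)))
  · refine mul_ne_zero (mul_ne_zero hb h0) fun he => him ?_
    have hsq : ω₀ ^ 2 = 1 := by
      have : (ω₀ ^ 2)⁻¹ = 1 := by
        simp only [ne_eq, OfNat.ofNat_ne_zero, not_false_eq_true, zero_pow, sub_zero, mul_one] at he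
        linear_combination -he
      exact inv_eq_one.1 this
    rcases sq_eq_one_iff.1 hsq with h | h <;> simp [h]
  · have hev : ∀ᶠ ζ : ℂ in 𝓝 0, 1 - ζ ^ 2 ≠ 0 := by
      have : ContinuousAt (fun ζ : ℂ => 1 - ζ ^ 2) 0 := by fun_prop
      exact this.eventually_ne (by simp)
    filter_upwards [hev] with ζ hζ
    simp only [zhukovskii]
    field_simp
    ring

variable {Θ : C → ℂ → ℂ}

lemma IsLocalModel.hasPoleOfOrderAtMost (hm : IsLocalModel aInf bInf a b ω₀ id ω₀ Λ Θ)
    (h : S.IsScattering aInf bInf a b r F) {k m : ℕ}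
    (hG : ∀ ν σ, ∃ G : ℂ → ℂ, AnalyticAt ℂ G ω₀ ∧
      ∀ᶠ ζ in 𝓝[≠] ω₀, S.chartU bInf F Λ Θ k ζ ν σ = ((ζ - ω₀) ^ m)⁻¹ * G ζ) :
    HasPoleOfOrderAtMost (S.uMatrix aInf bInf a b k) m ω₀ := by
  choose G hGa hGe using hG
  refine ⟨fun ω ν σ => G ν σ ω, hGa, ?_⟩
  have h1 := (hm.eventually_uMatrix_eq h k).filter_mono
    (nhdsWithin_mono ω₀ (Set.sdiff_subset (t := {ω₀})))
  have h2 := (eventually_all.2 fun ν => eventually_all.2 (hGe ν)).filter_mono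
    (nhdsWithin_mono ω₀ (fun x (hx : x ∈ Metric.ball (0 : ℂ) 1 \ {ω₀}) => hx.2))
  filter_upwards [h1, h2] with ω e1 e2
  rw [e1]
  ext ν σ
  exact e2 ν σ

/-- The singularities of `U` do not accumulate at the centre of a chart. -/
lemma IsLocalModel.eventually_holomorphic (hm : IsLocalModel aInf bInf a b ω₀ s ζ₀ Λ Θ)
    (h : S.IsScattering aInf bInf a b r F) (k : ℕ) :
    ∀ᶠ ω in 𝓝[≠] ω₀, ω ∈ Metric.closedBall (0 : ℂ) 1 →
      HasPoleOfOrderAtMost (S.uMatrix aInf bInf a b k) 0 ω := by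
  have h1 := hm.eventually_uMatrix_eq h k
  rw [eventually_nhdsWithin_iff] at h1
  have h2 : ∀ᶠ ζ in 𝓝[≠] ζ₀, ∀ ν σ, AnalyticAt ℂ (fun ζ => S.chartU bInf F Λ Θ k ζ ν σ) ζ :=
    eventually_all.2 fun ν => eventually_all.2 fun σ =>
      (hm.matMeromorphicAt_chartU h k ν σ).eventually_analyticAt
  rw [eventually_nhdsWithin_iff] at h2
  have h3 := hm.tendsto.eventually h2
  rw [eventually_nhdsWithin_iff] at h3
  filter_upwards [nhdsWithin_le_nhds h1.eventually_nhds, nhdsWithin_le_nhds h3,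
    self_mem_nhdsWithin] with ω e1 e3 hne hmem
  refine ⟨fun ω => S.chartU bInf F Λ Θ k (s ω), fun ν σ => ?_, ?_⟩
  · exact (e3 hmem (hm.ne ω hmem hne) ν σ).comp (hm.analyticAt ω hmem hne)
  · rw [eventually_nhdsWithin_iff]
    filter_upwards [e1] with ω' e hω'
    rw [pow_zero, inv_one, one_smul]
    exact e hω'.1

/-- At a point of the circle `ω - ω₀ = - ω₀ ζ²` in the square root coordinate. -/
lemma IsLocalModel.exists_tendsto (hm : IsLocalModel aInf bInf a b ω₀ (sqrtChart ω₀) 0 Λ Θ)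
    (h : S.IsScattering aInf bInf a b r F) (h1 : ‖ω₀‖ = 1) {k : ℕ}
    (hG : ∀ ν σ, ∃ G : ℂ → ℂ, AnalyticAt ℂ G 0 ∧
      ∀ᶠ ζ in 𝓝[≠] 0, S.chartU bInf F Λ Θ k ζ ν σ = ((ζ - 0) ^ 2)⁻¹ * G ζ) :
    ∃ M : Matrix C C ℂ, Tendsto (fun ω => (ω - ω₀) • S.uMatrix aInf bInf a b k ω)
      (𝓝[Metric.ball 0 1] ω₀) (𝓝 M) := by
  choose G hGa hGe using hG
  have h0 := hm.center_ne_zero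
  have hst : Tendsto (sqrtChart ω₀) (𝓝[Metric.ball 0 1] ω₀) (𝓝[≠] 0) := by
    refine tendsto_nhdsWithin_iff.2
      ⟨hm.tendsto.mono_left (nhdsWithin_mono _ Metric.ball_subset_closedBall), ?_⟩
    filter_upwards [self_mem_nhdsWithin] with ω hω
    refine hm.ne ω (Metric.ball_subset_closedBall hω) fun he => ?_
    rw [he, mem_ball_zero_iff, h1] at hω
    exact lt_irrefl _ hω
  refine ⟨Matrix.of fun ν σ => -ω₀ * G ν σ 0, ?_⟩
  refine tendsto_pi_nhds.2 fun ν => tendsto_pi_nhds.2 fun σ => ?_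
  have ht : Tendsto (fun ω => -ω₀ * G ν σ (sqrtChart ω₀ ω)) (𝓝[Metric.ball 0 1] ω₀)
      (𝓝 (-ω₀ * G ν σ 0)) :=
    ((hGa ν σ).continuousAt.tendsto.comp (hst.mono_right nhdsWithin_le_nhds)).const_mul _
  refine ht.congr' ?_
  filter_upwards [hm.eventually_uMatrix_eq h k, hst.eventually (hGe ν σ),
    hst.eventually self_mem_nhdsWithin] with ω e1 e2 hne
  have hne : sqrtChart ω₀ ω ≠ 0 := hne
  rw [Matrix.smul_apply, e1, smul_eq_mul, e2, sub_zero]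
  have hsq : ω - ω₀ = -ω₀ * sqrtChart ω₀ ω ^ 2 := by
    rw [sqrtChart_sq]
    field_simp
    ring
  rw [hsq]
  field_simp

end WebSystem

/-! ### The pole at the origin -/

/-- The channel parameter has a simple zero at the origin. -/
lemma exists_channelParam_eq_mul {aσ bσ a b : ℝ} (hbσ : 0 < bσ) (hb : 0 < b) :
    ∃ τ : ℂ → ℂ, AnalyticAt ℂ τ 0 ∧ τ 0 = bσ / b ∧
      ∀ᶠ ω in 𝓝[≠] 0, channelParam aσ bσ a b ω = ω * τ ω := by
  have hbc : (b : ℂ) ≠ 0 := by exact_mod_cast hb.ne'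
  have hbσc : (bσ : ℂ) ≠ 0 := by exact_mod_cast hbσ.ne'
  set m : ℂ → ℂ := fun ω => ((aσ - a) * ω + b * (ω ^ 2 + 1)) / bσ with hm
  have hm0 : m 0 = b / bσ := by simp [hm]
  have hm0' : m 0 ≠ 0 := by rw [hm0]; exact div_ne_zero hbc hbσc
  have hma : AnalyticAt ℂ m 0 := by
    simp only [hm, div_eq_mul_inv]
    fun_prop
  obtain ⟨q, hqa, hq0, hq⟩ : ∃ q : ℂ → ℂ, AnalyticAt ℂ q 0 ∧ q 0 = m 0 ∧
      ∀ ω, q ω ^ 2 = m ω ^ 2 - 4 * ω ^ 2 := by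
    have hu : AnalyticAt ℂ (fun ω => m ω ^ 2 - 4 * ω ^ 2) 0 := by fun_prop
    obtain ⟨q, hqa, hq⟩ := hu.exists_sq_eq (by simpa using hm0')
    have h0 : q 0 ^ 2 = m 0 ^ 2 := by simpa using hq 0
    rcases sq_eq_sq_iff_eq_or_eq_neg.1 h0 with h | h
    · exact ⟨q, hqa, h, hq⟩
    · exact ⟨fun ω => -q ω, hqa.neg, by simp [h], fun ω => by rw [neg_sq, hq]⟩
  have hsum0 : m 0 + q 0 ≠ 0 := by
    rw [hq0, ← two_mul]
    exact mul_ne_zero two_ne_zero hm0'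
  set τ : ℂ → ℂ := fun ω => 2 / (m ω + q ω) with hτ
  have hτa : AnalyticAt ℂ τ 0 := analyticAt_const.div (hma.add hqa) hsum0
  have hτ0 : τ 0 = bσ / b := by
    simp only [hτ, hq0, hm0]
    field_simp
    norm_num
  refine ⟨τ, hτa, hτ0, ?_⟩
  have hsmall : ∀ᶠ ω in 𝓝 (0 : ℂ), ‖ω * τ ω‖ < 1 := by
    have hc : ContinuousAt (fun ω => ‖ω * τ ω‖) 0 := (continuousAt_id.mul hτa.continuousAt).norm
    exact hc.eventually (gt_mem_nhds (by simp))
  filter_upwards [nhdsWithin_le_nhds hsmall, self_mem_nhdsWithin,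
    nhdsWithin_le_nhds ((hma.add hqa).continuousAt.eventually_ne hsum0)] with ω h1 hne hsum
  have hne : ω ≠ 0 := hne
  have hsum : m ω + q ω ≠ 0 := hsum
  have hτne : ω * τ ω ≠ 0 := mul_ne_zero hne (div_ne_zero two_ne_zero hsum)
  refine channelParam_eq hbσ hτne h1 ?_
  have e1 : (ω * τ ω)⁻¹ = (m ω + q ω) / (2 * ω) := by
    simp only [hτ]
    field_simp
  have e2 : ω * τ ω = (m ω - q ω) / (2 * ω) := by
    simp only [hτ]
    rw [mul_div_assoc', div_eq_div_iff hsum (by simpa using hne)]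
    linear_combination hq ω
  have e3 : ω * τ ω + (ω * τ ω)⁻¹ = m ω / ω := by
    rw [e1, e2]
    field_simp
    ring
  rw [zhukovskii, e3, zhukovskii]
  simp only [hm]
  field_simp
  ring

/-- All entries of the matrix function `M` are analytic at `x`. -/
def MatAnalyticAt {m n : Type*} (M : ℂ → Matrix m n ℂ) (x : ℂ) : Prop :=
  ∀ i j, AnalyticAt ℂ (fun ζ => M ζ i j) x

lemma MatAnalyticAt.det {m : Type*} [Fintype m] [DecidableEq m] {x : ℂ} {M : ℂ → Matrix m m ℂ}
    (hM : MatAnalyticAt M x) : AnalyticAt ℂ (fun ζ => (M ζ).det) x := by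
  simp only [Matrix.det_apply']
  exact Finset.analyticAt_fun_sum _ fun σ _ => analyticAt_const.mul
    (Finset.analyticAt_fun_prod _ fun i _ => hM _ _)

lemma MatAnalyticAt.inv {m : Type*} [Fintype m] [DecidableEq m] {x : ℂ} {M : ℂ → Matrix m m ℂ}
    (hM : MatAnalyticAt M x) (h0 : (M x).det ≠ 0) : MatAnalyticAt (fun ζ => (M ζ)⁻¹) x :=
  fun i j => by
    simp only [Matrix.inv_def, Ring.inverse_eq_inv', Matrix.smul_apply, smul_eq_mul,
      Matrix.adjugate_apply]
    refine (hM.det.inv h0).mul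
      (MatAnalyticAt.det (M := fun ζ => (M ζ).updateRow j (Pi.single i 1)) fun k l => ?_)
    by_cases hk : k = j
    · subst hk
      simp only [Matrix.updateRow_self]
      exact analyticAt_const
    · simp only [Matrix.updateRow_ne hk]
      exact hM k l

namespace WebSystem

variable {V C : Type*} [Fintype V] [DecidableEq V] [Fintype C] [DecidableEq C]
  {S : WebSystem V C} {aInf bInf : C → ℝ} {a b : ℝ} {r : C → ℝ} {F : C → ℕ → ℂ → ℂ}

/-- The three-term recurrence for the scattering matrix. -/
lemma IsScattering.uMatrix_recurrence (h : S.IsScattering aInf bInf a b r F) {ω : ℂ} (h0 : ω ≠ 0)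
    (h1 : ‖ω‖ < 1) (k : ℕ) (ν σ : C) :
    S.uMatrix aInf bInf a b (k + 2) ω ν σ
      = (((S.onsite ν (k + 1) : ℂ) - zhukovskii a b ω) * S.uMatrix aInf bInf a b (k + 1) ω ν σ
        - S.hop ν k * S.uMatrix aInf bInf a b k ω ν σ) * (S.hop ν (k + 1) : ℂ)⁻¹ := by
  have hsol := S.isChannelSolution_scatterU bInf
    (fun σ => channelParam (aInf σ) (bInf σ) a b ω) (fun ν => h.isChannelSolution h0 h1 ν) ν σ k
  have hne : (S.hop ν (k + 1) : ℂ) ≠ 0 := by exact_mod_cast (S.hop_pos ν (k + 1)).ne'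
  simp only [h.uMatrix_eq _ h0 h1]
  simp only at hsol
  rw [eq_mul_inv_iff_mul_eq₀ hne]
  linear_combination -hsol

/-- Holomorphy of `U(k)` away from the origin follows from the cases `k = 0` and `k = 1`. -/
lemma IsScattering.hasPoleOfOrderAtMost_zero (h : S.IsScattering aInf bInf a b r F) {ω₀ : ℂ}
    (hne : ω₀ ≠ 0) (h0 : HasPoleOfOrderAtMost (S.uMatrix aInf bInf a b 0) 0 ω₀)
    (h1 : HasPoleOfOrderAtMost (S.uMatrix aInf bInf a b 1) 0 ω₀) (k : ℕ) :
    HasPoleOfOrderAtMost (S.uMatrix aInf bInf a b k) 0 ω₀ := by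
  suffices hs : ∀ k, HasPoleOfOrderAtMost (S.uMatrix aInf bInf a b k) 0 ω₀ ∧
      HasPoleOfOrderAtMost (S.uMatrix aInf bInf a b (k + 1)) 0 ω₀ from (hs k).1
  intro k
  induction k with
  | zero => exact ⟨h0, h1⟩
  | succ k ih =>
    refine ⟨ih.2, ?_⟩
    obtain ⟨⟨G, hG, hGe⟩, G', hG', hGe'⟩ := ih
    refine ⟨fun ω => Matrix.of fun ν σ => (((S.onsite ν (k + 1) : ℂ) - zhukovskii a b ω)
      * G' ω ν σ - S.hop ν k * G ω ν σ) * (S.hop ν (k + 1) : ℂ)⁻¹, fun ν σ => ?_, ?_⟩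
    · exact (((analyticAt_const.sub (analyticAt_zhukovskii a b hne)).mul (hG' ν σ)).sub
        (analyticAt_const.mul (hG ν σ))).mul analyticAt_const
    · filter_upwards [hGe, hGe', self_mem_nhdsWithin,
        nhdsWithin_le_nhds (isOpen_ne.mem_nhds hne)] with ω e e' hω hω0
      simp only [pow_zero, inv_one, one_smul] at e e' ⊢
      ext ν σ
      rw [h.uMatrix_recurrence hω0 (by simpa using hω.1), e, e', Matrix.of_apply]

/-- At the origin `T` is invertible, and `ω U(1, ω)` and `U(0, ω)` have invertible diagonal values,
because `ω⁻¹ R(λ(ω))` tends to `b⁻¹`. -/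
lemma IsScattering.exists_origin_expansion [Nonempty C] (h : S.IsScattering aInf bInf a b r F) :
    HasPoleOfOrder (S.uMatrix aInf bInf a b 0) 0 0 ∧
      HasPoleOfOrder (S.uMatrix aInf bInf a b 1) 1 0 := by
  have hbc : (b : ℂ) ≠ 0 := by exact_mod_cast h.b_pos.ne'
  have hbσ : ∀ σ, (bInf σ : ℂ) ≠ 0 := fun σ => by exact_mod_cast (h.jost σ).b_pos.ne'
  have hhop : ∀ σ, (S.hop σ 0 : ℂ) ≠ 0 := fun σ => by exact_mod_cast (S.hop_pos σ 0).ne'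
  choose τ hτa hτ0 hτe using fun σ =>
    exists_channelParam_eq_mul (aσ := aInf σ) (a := a) (h.jost σ).b_pos h.b_pos
  have hτne : ∀ σ, τ σ 0 ≠ 0 := fun σ => by rw [hτ0]; exact div_ne_zero (hbσ σ) hbc
  -- the Jost functions along the channel parameters
  set f : ℕ → C → ℂ → ℂ := fun k σ ω => F σ k (ω * τ σ ω) with hf
  have hfa : ∀ k σ, AnalyticAt ℂ (f k σ) 0 := fun k σ => by
    have h1 : AnalyticAt ℂ (F σ k) ((fun ω => ω * τ σ ω) 0) := by
      refine (h.jost σ).analyticAt k _ ?_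
      simpa using zero_lt_one.trans (h.jost σ).one_lt
    exact h1.comp (f := fun ω => ω * τ σ ω) (analyticAt_id.mul (hτa σ))
  have hf0 : ∀ k σ, f k σ 0 ≠ 0 := fun k σ => by
    simp only [hf, zero_mul]
    exact (h.jost σ).apply_zero_ne_zero k
  -- the resolvent of the central part, divided by `ω`
  set M : ℂ → Matrix V V ℂ := fun ω => ω • S.central.map (fun r : ℝ => (r : ℂ))
    - (a * ω - b * (ω ^ 2 + 1)) • (1 : Matrix V V ℂ) with hM
  have hMa : MatAnalyticAt M 0 := fun α β => by
    simp only [hM, Matrix.sub_apply, Matrix.smul_apply, smul_eq_mul]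
    fun_prop
  have hM0 : M 0 = (b : ℂ) • (1 : Matrix V V ℂ) := by
    simp [hM]
  have hMdet : (M 0).det ≠ 0 := by
    rw [hM0, Matrix.det_smul, Matrix.det_one, mul_one]
    exact pow_ne_zero _ hbc
  have hMinv0 : (M 0)⁻¹ = (b : ℂ)⁻¹ • (1 : Matrix V V ℂ) := by
    refine Matrix.inv_eq_right_inv ?_
    rw [hM0, Matrix.smul_mul, Matrix.one_mul, smul_smul, mul_inv_cancel₀ hbc, one_smul]
  set R : ℂ → Matrix C C ℂ := fun ω => ((M ω)⁻¹).submatrix S.attach S.attach with hR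
  have hRa : MatAnalyticAt R 0 := fun ν μ => hMa.inv hMdet _ _
  have hR0 : ∀ ν μ, R 0 ν μ = if ν = μ then (b : ℂ)⁻¹ else 0 := fun ν μ => by
    simp only [hR, Matrix.submatrix_apply, hMinv0, Matrix.smul_apply, Matrix.one_apply,
      S.attach_injective.eq_iff, smul_eq_mul, mul_ite, mul_one, mul_zero]
  have hResolvent : ∀ ω, ω ≠ 0 → (M ω).det ≠ 0 →
      S.resolventBlock (zhukovskii a b ω) = ω • R ω := fun ω hω hdet => by
    have : (S.central.map (fun r : ℝ => (r : ℂ)) - zhukovskii a b ω • (1 : Matrix V V ℂ))⁻¹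
        = ω • (M ω)⁻¹ := by
      refine Matrix.inv_eq_right_inv ?_
      have e : S.central.map (fun r : ℝ => (r : ℂ)) - zhukovskii a b ω • (1 : Matrix V V ℂ)
          = ω⁻¹ • M ω := by
        simp only [hM]
        rw [smul_sub, smul_smul, smul_smul, inv_mul_cancel₀ hω, one_smul, zhukovskii]
        congr 2
        field_simp
      rw [e, Matrix.smul_mul, Matrix.mul_smul, smul_smul, inv_mul_cancel₀ hω, one_smul,
        Matrix.mul_nonsing_inv _ (isUnit_iff_ne_zero.2 hdet)]
    rw [resolventBlock, this]
    rfl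
  -- the matrix `T`
  set T : ℂ → Matrix C C ℂ := fun ω => Matrix.of fun ν μ =>
    (if ν = μ then f 0 μ ω else 0) - ω ^ 2 * R ω ν μ * S.hop μ 0 * τ μ ω * f 1 μ ω with hT
  have hTa : MatAnalyticAt T 0 := fun ν μ => by
    simp only [hT, Matrix.of_apply]
    have h1 := hRa ν μ
    have h2 := hτa μ
    have h3 := hfa 1 μ
    have h4 := hfa 0 μ
    split_ifs <;> fun_prop
  have hT0 : T 0 = Matrix.diagonal fun ν => f 0 ν 0 := by
    ext ν μ
    simp only [hT, Matrix.of_apply, Matrix.diagonal_apply]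
    by_cases hνμ : ν = μ
    · subst hνμ; simp
    · simp [hνμ]
  have hTdet : (T 0).det ≠ 0 := by
    rw [hT0, Matrix.det_diagonal]
    exact Finset.prod_ne_zero_iff.2 fun ν _ => hf0 0 ν
  have hTinv0 : (T 0)⁻¹ = Matrix.diagonal fun ν => (f 0 ν 0)⁻¹ := by
    rw [hT0, inv_diagonal_of_ne_zero fun ν => hf0 0 ν]
  have hTia := hTa.inv hTdet
  -- the values of `ω U(1, ω)`
  set G₁ : ℂ → Matrix C C ℂ := fun ω => Matrix.of fun ν σ => (T ω)⁻¹ ν σ * (τ ν ω * f 1 ν ω)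
    * (bInf σ * (S.hop σ 0 : ℂ)⁻¹ * (1 - ω ^ 2 * τ σ ω ^ 2) * (τ σ ω ^ 2 * f 1 σ ω)⁻¹) with hG₁
  have hG₁a : MatAnalyticAt G₁ 0 := fun ν σ => by
    simp only [hG₁, Matrix.of_apply]
    have h1 := hTia ν σ
    have h2 := hτa σ
    have h3 := hfa 1 σ
    have h4 := hτa ν
    have h5 := hfa 1 ν
    have h6 : AnalyticAt ℂ (fun ω => (τ σ ω ^ 2 * f 1 σ ω)⁻¹) 0 :=
      ((h2.pow 2).mul h3).inv (mul_ne_zero (pow_ne_zero _ (hτne σ)) (hf0 1 σ))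
    fun_prop
  have hG₁0 : ∀ ν σ, G₁ 0 ν σ = if ν = σ then b * (S.hop σ 0 : ℂ)⁻¹ * (f 0 σ 0)⁻¹ else 0 :=
    fun ν σ => by
      simp only [hG₁, Matrix.of_apply, hTinv0, Matrix.diagonal_apply]
      by_cases hνσ : ν = σ
      · subst hνσ
        have h1 := hf0 1 ν
        have h2 := hf0 0 ν
        have h3 := hbσ ν
        have h4 := hhop ν
        simp only [if_true, hτ0]
        field_simp
        ring
      · simp [hνσ]
  set G₀ : ℂ → Matrix C C ℂ := fun ω => Matrix.of fun ν σ =>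
    ∑ μ, R ω ν μ * (S.hop μ 0 * G₁ ω μ σ) with hG₀
  have hG₀a : MatAnalyticAt G₀ 0 := fun ν σ => by
    simp only [hG₀, Matrix.of_apply]
    exact Finset.analyticAt_fun_sum _ fun μ _ =>
      (hRa ν μ).mul (analyticAt_const.mul (hG₁a μ σ))
  have hG₀0 : ∀ σ, G₀ 0 σ σ = (f 0 σ 0)⁻¹ := fun σ => by
    simp only [hG₀, Matrix.of_apply, hR0, hG₁0]
    have h1 := hhop σ
    rw [Finset.sum_eq_single σ]
    · simp only [if_true]
      field_simp
    · intro μ _ hμ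
      simp [hμ]
    · simp
  -- comparison with `U`
  have hev : ∀ᶠ ω in 𝓝[Metric.ball (0 : ℂ) 1 \ {0}] 0,
      (∀ ν σ, S.uMatrix aInf bInf a b 1 ω ν σ = ω⁻¹ * G₁ ω ν σ) ∧
      ∀ ν σ, S.uMatrix aInf bInf a b 0 ω ν σ = G₀ ω ν σ := by
    have hle : 𝓝[Metric.ball (0 : ℂ) 1 \ {0}] 0 ≤ 𝓝[≠] (0 : ℂ) :=
      nhdsWithin_mono _ fun x hx => hx.2
    have hle' : 𝓝[Metric.ball (0 : ℂ) 1 \ {0}] 0 ≤ 𝓝 (0 : ℂ) := nhdsWithin_le_nhds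
    filter_upwards [hle (eventually_all.2 hτe), self_mem_nhdsWithin,
      hle' (hMa.det.continuousAt.eventually_ne hMdet),
      hle' (hTa.det.continuousAt.eventually_ne hTdet),
      hle' (eventually_all.2 fun σ => (hτa σ).continuousAt.eventually_ne (hτne σ)),
      hle' (eventually_all.2 fun σ => (hfa 1 σ).continuousAt.eventually_ne (hf0 1 σ))]
      with ω e1 e2 e3 e4 e5 e6
    have hω0 : ω ≠ 0 := e2.2
    have hω1 : ‖ω‖ < 1 := by simpa using e2.1
    have hθ : (fun σ => channelParam (aInf σ) (bInf σ) a b ω) = fun σ => ω * τ σ ω := funext e1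
    have hfam : ∀ σ k, jostFamily F (fun σ => ω * τ σ ω) σ k = (ω * τ σ ω) ^ k * f k σ ω :=
      fun _ _ => rfl
    have hconn : S.connectionMatrix (zhukovskii a b ω) (jostFamily F fun σ => ω * τ σ ω) = T ω := by
      ext ν μ
      rw [connectionMatrix, hResolvent ω hω0 e3]
      simp only [hT, Matrix.sub_apply, Matrix.of_apply, Matrix.diagonal_apply, hopMatrix,
        Matrix.mul_diagonal, Matrix.smul_apply, smul_eq_mul, hfam, pow_zero, pow_one, one_mul]
      split_ifs with hνμ
      · subst hνμ; ring
      · ring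
    have hne1 : ∀ ν, jostFamily F (fun σ => ω * τ σ ω) ν 1 ≠ 0 := fun ν => by
      rw [hfam, pow_one]
      exact mul_ne_zero (mul_ne_zero hω0 (e5 ν)) (e6 ν)
    have hU1 : ∀ ν σ, S.uMatrix aInf bInf a b 1 ω ν σ = ω⁻¹ * G₁ ω ν σ := fun ν σ => by
      rw [h.uMatrix_eq 1 hω0 hω1, hθ, scatterU_apply S bInf _ _ hne1, hconn]
      simp only [channelP, ite_self, neg_zero, zero_add, hfam, pow_one, hG₁, Matrix.of_apply]
      have h1 := e5 σ
      have h2 := e6 σ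
      have h3 := hhop σ
      field_simp
    refine ⟨hU1, fun ν σ => ?_⟩
    have hz := S.scatterU_zero bInf (fun σ => ω * τ σ ω) hne1
      (by rw [hconn]; exact isUnit_iff_ne_zero.2 e4) ν σ
    rw [centralExt_attach, hResolvent ω hω0 e3, ← hθ, ← h.uMatrix_eq 1 hω0 hω1,
      ← h.uMatrix_eq 0 hω0 hω1] at hz
    rw [hz]
    simp only [Matrix.mulVec, dotProduct, hopMatrix, Matrix.mul_diagonal, Matrix.smul_apply,
      smul_eq_mul, hU1, hG₀, Matrix.of_apply]
    refine Finset.sum_congr rfl fun μ _ => ?_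
    field_simp
  obtain ⟨σ₀⟩ := ‹Nonempty C›
  refine ⟨⟨G₀, hG₀a, fun hz => ?_, hev.mono fun ω hω => ?_⟩,
    ⟨G₁, hG₁a, fun hz => ?_, hev.mono fun ω hω => ?_⟩⟩
  · have := hG₀0 σ₀
    rw [hz] at this
    exact inv_ne_zero (hf0 0 σ₀) this.symm
  · ext ν σ
    rw [hω.2]
    simp
  · have := hG₁0 σ₀ σ₀
    rw [hz, if_pos rfl] at this
    exact mul_ne_zero (mul_ne_zero hbc (inv_ne_zero (hhop σ₀))) (inv_ne_zero (hf0 0 σ₀)) this.symm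
  · ext ν σ
    rw [hω.1]
    simp

/-- At the origin `U(k)` has a pole of order `k`: the recurrence raises the order by one, since `λ`
has a simple pole. -/
lemma IsScattering.hasPoleOfOrder_origin [Nonempty C] (h : S.IsScattering aInf bInf a b r F)
    (k : ℕ) : HasPoleOfOrder (S.uMatrix aInf bInf a b k) k 0 := by
  suffices hs : ∀ k, HasPoleOfOrder (S.uMatrix aInf bInf a b k) k 0 ∧
      HasPoleOfOrder (S.uMatrix aInf bInf a b (k + 1)) (k + 1) 0 from (hs k).1
  intro k
  induction k with
  | zero => exact h.exists_origin_expansion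
  | succ k ih =>
    refine ⟨ih.2, ?_⟩
    obtain ⟨⟨G, hG, -, hGe⟩, G', hG', hG0', hGe'⟩ := ih
    have hbc : (b : ℂ) ≠ 0 := by exact_mod_cast h.b_pos.ne'
    refine ⟨fun ω => Matrix.of fun ν σ =>
      (((S.onsite ν (k + 1) - a) * ω + b * (ω ^ 2 + 1)) * G' ω ν σ - S.hop ν k * ω ^ 2 * G ω ν σ) * (S.hop ν (k + 1) : ℂ)⁻¹, fun ν σ => ?_, fun hz => ?_, ?_⟩
    · have h1 := hG ν σ
      have h2 := hG' ν σ
      simp only [Matrix.of_apply]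
      fun_prop
    · refine hG0' ?_
      ext ν σ
      have hne : (S.hop ν (k + 1) : ℂ) ≠ 0 := by exact_mod_cast (S.hop_pos ν (k + 1)).ne'
      have := congrFun (congrFun hz ν) σ
      simpa [hbc, hne] using this
    · filter_upwards [hGe, hGe', self_mem_nhdsWithin] with ω e e' hω
      have hω0 : ω ≠ 0 := hω.2
      ext ν σ
      rw [h.uMatrix_recurrence hω0 (by simpa using hω.1), e, e', zhukovskii]
      simp only [Matrix.smul_apply, Matrix.of_apply, smul_eq_mul, sub_zero]
      field_simp
      ring

end WebSystem

end

theorem mainTheorem3 {V C : Type*} [Fintype V] [DecidableEq V] [Fintype C] [DecidableEq C]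
    (S : WebSystem V C) (aInf bInf : C → ℝ) (hbInf : ∀ σ, 0 < bInf σ)
    (hdecay : ∀ σ, ∃ ε : ℝ, 0 < ε ∧ Summable fun k : ℕ =>
      (1 + ε) ^ (k + 1) * (|S.onsite σ (k + 1) - aInf σ| + |S.hop σ (k + 1) - bInf σ|))
    (hconn : IsConnected (⋃ σ, Set.Ioo (aInf σ - 2 * bInf σ) (aInf σ + 2 * bInf σ)))
    (a b : ℝ)
    (hI : (⋃ σ, Set.Icc (aInf σ - 2 * bInf σ) (aInf σ + 2 * bInf σ))
      = Set.Icc (a - 2 * b) (a + 2 * b)) :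
    ∃ Ω : Set ℂ, Ω.Finite ∧
      Ω ⊆ Metric.sphere (0 : ℂ) 1 ∪ (fun t : ℝ => (t : ℂ)) '' Set.Ioo (-1) 1 ∧
      (0 : ℂ) ∉ Ω ∧
      ∀ k : ℕ,
        -- all singularities in the closed disk lie in `Ω ∪ {0}`
        (∀ ω₀ ∈ Metric.closedBall (0 : ℂ) 1, ω₀ ∉ Ω ∪ {0} →
          HasPoleOfOrderAtMost (S.uMatrix aInf bInf a b k) 0 ω₀) ∧
        -- at the origin there is a pole of order `k`
        HasPoleOfOrder (S.uMatrix aInf bInf a b k) k 0 ∧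
        -- the poles in `Ω` are simple, except possibly at `±1` when there is a threshold eigenvalue
        (∀ ω₀ ∈ Ω, ¬ IsBranchPoint aInf bInf a b ω₀ →
          (ω₀ = 1 ∨ ω₀ = -1 → ¬ S.IsEigenvalue (zhukovskii a b ω₀)) →
          HasPoleOfOrderAtMost (S.uMatrix aInf bInf a b k) 1 ω₀) ∧
        -- in any case the singularities at `±1` are poles of order at most two
        (∀ ω₀ ∈ Ω, ω₀ = 1 ∨ ω₀ = -1 →
          HasPoleOfOrderAtMost (S.uMatrix aInf bInf a b k) 2 ω₀) ∧
        -- the singularities at branch points are no worse than simple poles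
        (∀ ω₀ ∈ Ω, IsBranchPoint aInf bInf a b ω₀ →
          ∃ M : Matrix C C ℂ, Tendsto (fun ω => (ω - ω₀) • S.uMatrix aInf bInf a b k ω)
            (𝓝[Metric.ball 0 1] ω₀) (𝓝 M)) := by
  classical
  have hne : (⋃ σ, Set.Ioo (aInf σ - 2 * bInf σ) (aInf σ + 2 * bInf σ)).Nonempty := hconn.nonempty
  obtain ⟨x, hx⟩ := hne
  obtain ⟨σ₀, -⟩ := Set.mem_iUnion.1 hx
  have : Nonempty C := ⟨σ₀⟩
  have hsub : ∀ σ, Set.Icc (aInf σ - 2 * bInf σ) (aInf σ + 2 * bInf σ)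
      ⊆ Set.Icc (a - 2 * b) (a + 2 * b) := fun σ => by
    rw [← hI]
    exact Set.subset_iUnion (fun σ => Set.Icc (aInf σ - 2 * bInf σ) (aInf σ + 2 * bInf σ)) σ
  have hb : 0 < b := by
    have hpos := hbInf σ₀
    have h1 := hsub σ₀ ⟨le_rfl, by linarith⟩
    have h2 := hsub σ₀ ⟨by linarith, le_rfl⟩
    linarith [h1.1, h2.2]
  have hex : ∀ σ, Tendsto (S.hop σ) atTop (𝓝 (bInf σ)) ∧
      ∃ r F, IsJostFunction (S.onsite σ) (S.hop σ) (aInf σ) (bInf σ) r F := fun σ => by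
    obtain ⟨ε, hε, hs⟩ := hdecay σ
    exact exists_isJostFunction (S.hop_pos σ) (hbInf σ) hε hs
  choose hhop r F hF using hex
  have h : S.IsScattering aInf bInf a b r F := ⟨hF, hhop, hb, hsub⟩
  set U := S.uMatrix aInf bInf a b with hU
  -- by the recurrence in `k`, holomorphy of `U 0` and `U 1` at `ω ≠ 0` gives that of every `U k`
  set Ω : Set ℂ := {ω | ω ∈ Metric.closedBall (0 : ℂ) 1 ∧ ω ≠ 0 ∧
    ¬ (HasPoleOfOrderAtMost (U 0) 0 ω ∧ HasPoleOfOrderAtMost (U 1) 0 ω)} with hΩ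
  have horder : ∀ ω₀ : ℂ, ω₀ ≠ 0 → ‖ω₀‖ ≤ 1 → ¬ IsBranchPoint aInf bInf a b ω₀ → ∀ m,
      WebSystem.IsApproachOrder a b ω₀ id ω₀ m → ∀ k, HasPoleOfOrderAtMost (U k) m ω₀ :=
    fun ω₀ h0 h1 hbr m hm k => by
      obtain ⟨Θ, hΘ⟩ := h.exists_isLocalModel_id h0 h1 hbr
      exact hΘ.hasPoleOfOrderAtMost h fun ν σ => hΘ.exists_chartU_eq h hm k ν σ
  have hnonreal : ∀ ω ∈ Ω, ‖ω‖ < 1 → ω.im = 0 := fun ω hω h1 => by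
    by_contra him
    have hbr : ¬ IsBranchPoint aInf bInf a b ω := fun hbr => h1.ne hbr.1
    have ho := horder ω hω.2.1 h1.le hbr 0 (WebSystem.isApproachOrder_zero hb h1 him)
    exact hω.2.2 ⟨ho 0, ho 1⟩
  refine ⟨Ω, ?_, ?_, fun h0 => h0.2.1 rfl, fun k => ⟨?_, h.hasPoleOfOrder_origin k, ?_, ?_, ?_⟩⟩
  · -- an accumulation point of `Ω` in the closed disk would contradict local holomorphy
    by_contra hinf
    obtain ⟨ω₀, hω₀, hacc⟩ := Set.Infinite.exists_accPt_of_subset_isCompact hinf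
      (isCompact_closedBall (0 : ℂ) 1) (fun ω hω => hω.1)
    rw [accPt_iff_frequently_nhdsNE] at hacc
    refine hacc ?_
    have h1 : ‖ω₀‖ ≤ 1 := by simpa using hω₀
    have key : ∀ k, ∀ᶠ ω in 𝓝[≠] ω₀, ω ∈ Metric.closedBall (0 : ℂ) 1 →
        HasPoleOfOrderAtMost (U k) 0 ω := fun k => by
      by_cases h0 : ω₀ = 0
      · subst h0
        obtain ⟨G, hG, -, hGe⟩ := h.hasPoleOfOrder_origin k
        rw [eventually_nhdsWithin_iff] at hGe
        have hGa : ∀ᶠ ω in 𝓝 (0 : ℂ), ∀ ν σ, AnalyticAt ℂ (fun ω => G ω ν σ) ω :=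
          eventually_all.2 fun ν => eventually_all.2 fun σ => (hG ν σ).eventually_analyticAt
        filter_upwards [nhdsWithin_le_nhds hGe.eventually_nhds, nhdsWithin_le_nhds hGa,
          self_mem_nhdsWithin] with ω e1 e2 hne _
        have hne : ω ≠ 0 := hne
        refine ⟨fun ω => ((ω - 0) ^ k)⁻¹ • G ω, fun ν σ => ?_, ?_⟩
        · simp only [Matrix.smul_apply, smul_eq_mul]
          have h3 : AnalyticAt ℂ (fun ω : ℂ => (ω - 0) ^ k) ω := by fun_prop
          exact (h3.inv (pow_ne_zero _ (by simpa using hne))).mul (e2 ν σ)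
        · rw [eventually_nhdsWithin_iff]
          filter_upwards [e1, isOpen_ne.mem_nhds hne] with ω' e hne' hmem
          rw [pow_zero, inv_one, one_smul]
          exact e ⟨hmem.1, hne'⟩
      · by_cases hbr : IsBranchPoint aInf bInf a b ω₀
        · obtain ⟨Θ, hΘ⟩ := h.exists_isLocalModel_sqrtChart hbr.1
            (WebSystem.im_ne_zero_of_norm_eq_one hbr.1 hbr.2.1 hbr.2.2.1)
          exact hΘ.eventually_holomorphic h k
        · obtain ⟨Θ, hΘ⟩ := h.exists_isLocalModel_id h0 h1 hbr
          exact hΘ.eventually_holomorphic h k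
    filter_upwards [key 0, key 1] with ω e0 e1 hω
    exact hω.2.2 ⟨e0 hω.1, e1 hω.1⟩
  · intro ω hω
    have h1 : ‖ω‖ ≤ 1 := by simpa using hω.1
    rcases h1.lt_or_eq with hlt | heq
    · right
      have hre : ω = (ω.re : ℂ) := Complex.ext rfl (by simpa using hnonreal ω hω hlt)
      refine ⟨ω.re, abs_lt.1 ?_, hre.symm⟩
      rwa [hre, Complex.norm_real, Real.norm_eq_abs] at hlt
    · left
      simpa using heq
  · intro ω₀ hmem hnot
    rw [Set.mem_union, not_or] at hnot
    have h0 : ω₀ ≠ 0 := hnot.2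
    have hboth : HasPoleOfOrderAtMost (U 0) 0 ω₀ ∧ HasPoleOfOrderAtMost (U 1) 0 ω₀ := by
      by_contra hcon
      exact hnot.1 ⟨hmem, h0, hcon⟩
    exact h.hasPoleOfOrderAtMost_zero h0 hboth.1 hboth.2 k
  · intro ω₀ hmem hbr heig
    have h0 : ω₀ ≠ 0 := hmem.2.1
    have h1 : ‖ω₀‖ ≤ 1 := by simpa using hmem.1
    by_cases hth : ω₀ = 1 ∨ ω₀ = -1
    · obtain ⟨Θ, hΘ⟩ := h.exists_isLocalModel_id h0 h1 hbr
      exact hΘ.hasPoleOfOrderAtMost h fun ν σ => hΘ.exists_chartU_eq_of_not_isEigenvalue h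
        (WebSystem.isApproachOrder_two_of_threshold hb hth) (heig hth) k ν σ
    · rcases h1.lt_or_eq with hlt | heq
      · have hre : ω₀ = (ω₀.re : ℂ) := Complex.ext rfl (by simpa using hnonreal ω₀ hmem hlt)
        refine horder ω₀ h0 h1 hbr 1 ?_ k
        rw [hre] at h0 hlt ⊢
        exact WebSystem.isApproachOrder_one_of_real hb (by exact_mod_cast h0)
          (by rwa [Complex.norm_real, Real.norm_eq_abs] at hlt)
      · rw [not_or] at hth
        exact horder ω₀ h0 h1 hbr 1 (WebSystem.isApproachOrder_one_of_circle hb heq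
          (WebSystem.im_ne_zero_of_norm_eq_one heq hth.1 hth.2)) k
  · intro ω₀ hmem hth
    have hbr : ¬ IsBranchPoint aInf bInf a b ω₀ := fun hbr =>
      hth.elim hbr.2.1 hbr.2.2.1
    exact horder ω₀ hmem.2.1 (by simpa using hmem.1) hbr 2
      (WebSystem.isApproachOrder_two_of_threshold hb hth) k
  · intro ω₀ _ hbr
    have him := WebSystem.im_ne_zero_of_norm_eq_one hbr.1 hbr.2.1 hbr.2.2.1
    obtain ⟨Θ, hΘ⟩ := h.exists_isLocalModel_sqrtChart hbr.1 him
    exact hΘ.exists_tendsto h hbr.1 fun ν σ =>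
      hΘ.exists_chartU_eq h (WebSystem.isApproachOrder_two_of_sqrtChart hb hbr.1 him) k ν σ
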